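/- **Conventions.** Let $n,p,q,r\ge 0$ be integers, $m=p+q$, and $\theta\in\{1,-1\}$. The ground field is $\mathbb C$. *The Yangian.* $\mathrm Y(\mathfrak{gl}_n)$ is the unital associative algebra generated by $T_{ij}^{(s)}$ ($1\le i,j\le n$, $s\ge1$) with the relations $(u-v)[T_{ij}(u),T_{kl}(v)]=T_{kj}(u)T_{il}(v)-T_{kj}(v)T_{il}(u)$, where $T_{ij}(u)=\delta_{ij}+\sum_{s\ge1}T_{ij}^{(s)}u^{-s}$. Its comultiplication is $T_{ij}(u)\mapsto\sum_k T_{ik}(u)\otimes T_{kj}(u)$; the tensor product of two $\mathrm Y(\mathfrak{gl}_n)$-modules is a module through it. A bimodule over $\mathrm Y(\mathfrak{gl}_n)$ and a Lie algebra is a vector space with commuting actions of the two. *The bimodules $\mathcal E_{p,q}(V)$.* Let $\mathcal H$ be the polynomial algebra (if $\theta=1$) or the Grassmann algebra (if $\theta=-1$) in the variables $x_{ai}$, $1\le a\le m$, $1\le i\le n$, and let $\partial_{ai}$ be the corresponding left derivations. As operators on $\mathcal H$ put $p_{ai}=-\theta x_{ai}$, $q_{ai}=\partial_{ai}$ for $a\le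 p$, and $p_{ai}=\partial_{ai}$, $q_{ai}=x_{ai}$ for $a>p$. Let $E'$ be the $m\times m$ matrix whose $(a,b)$ entry is the matrix unit $E_{ba}\in\mathfrak{gl}_m$, and $X(u)=(u+\theta E')^{-1}=\sum_{s\ge0}(-\theta E')^s u^{-s-1}$, a matrix over $\mathrm U(\mathfrak{gl}_m)[[u^{-1}]]$. For a $\mathfrak{gl}_m$-module $V$ let $\mathcal E_{p,q}(V)$ be the bimodule over $\mathrm Y(\mathfrak{gl}_n)$ and $\mathfrak{gl}_m$ with the underlying space $V\otimes\mathcal H$ and the actions $$T_{ij}(u)\mapsto\delta_{ij}+\sum_{a,b=1}^m X_{ab}(u)\otimes q_{ai}p_{bj},\qquad E_{ab}\mapsto E_{ab}\otimes1+1\otimes\Big(\theta\delta_{ab}\tfrac n2+\sum_{k=1}^n q_{ak}p_{bk}\Big).$$ For $z\in\mathbb C$ let $\mathcal E^{z}_{p,q}(V)$ be the same $\mathfrak{gl}_m$-module on which $T_{ij}(u)$ acts as $T_{ij}(u-\theta z)$ acts on $\mathcal E_{p,q}(V)$. The same notation is used for every pair of non-negative integers in place of $(p,q)$. *Induction and coinvariants.*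 For $k,l\ge0$ regard $\mathfrak{gl}_k\oplus\mathfrak{gl}_l$ as the block diagonal subalgebra of $\mathfrak{gl}_{k+l}$, and let $\mathfrak q$ and $\mathfrak q'$ be the spans of the $E_{ba}$ and of the $E_{ab}$, respectively, with $a\le k<b$. For a $\mathfrak{gl}_k$-module $V$ and a $\mathfrak{gl}_l$-module $U$, let $\mathfrak q'$ act on $V\otimes U$ by zero and put $V\boxtimes U=\mathrm U(\mathfrak{gl}_{k+l})\otimes_{\mathrm U(\mathfrak{gl}_k\oplus\mathfrak{gl}_l\oplus\mathfrak q')}(V\otimes U)$. If $W$ is a bimodule over $\mathrm Y(\mathfrak{gl}_n)$ and $\mathfrak{gl}_{k+l}$, then $W_{\mathfrak q}=W/\mathfrak qW$ is a bimodule over $\mathrm Y(\mathfrak{gl}_n)$ and $\mathfrak{gl}_k\oplus\mathfrak{gl}_l$. **Theorem 2.1.** (i) For every $\mathfrak{gl}_m$-module $V$ and every $\mathfrak{gl}_r$-module $U$ there is an isomorphism $$\mathcal E_{p,q+r}(V\boxtimes U)_{\mathfrak q}\;\cong\;\mathcal E_{p,q}(V)\otimes\mathcal E^{m}_{0,r}(U)$$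 of bimodules over $\mathrm Y(\mathfrak{gl}_n)$ and $\mathfrak{gl}_m\oplus\mathfrak{gl}_r$ (here $k=m$, $l=r$). (ii) For every $\mathfrak{gl}_r$-module $V$ and every $\mathfrak{gl}_m$-module $U$ there is an isomorphism $$\mathcal E_{p+r,q}(V\boxtimes U)_{\mathfrak q}\;\cong\;\mathcal E_{r,0}(V)\otimes\mathcal E^{r}_{p,q}(U)$$ of bimodules over $\mathrm Y(\mathfrak{gl}_n)$ and $\mathfrak{gl}_r\oplus\mathfrak{gl}_m$ (here $k=r$, $l=m$). On the right-hand sides $\mathrm Y(\mathfrak{gl}_n)$ acts through the comultiplication and the two summands of the Lie algebra act on the two tensor factors. -/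

import Mathlib

open scoped TensorProduct

attribute [local instance 100] LieRing.ofAssociativeRing

universe u v

namespace RatYangian

/-! ### The Yangian of `gl_n` -/

section Yangian

/-- A family `t r i j` of elements of a ring, thought of as the coefficients of the series
`t_ij(u) = ∑_r t r i j * u ^ (-r)` with `t 0 i j = δ_ij`, that satisfies the relations
`(u - v) [t_ij(u), t_kl(v)] = t_kj(u) t_il(v) - t_kj(v) t_il(u)`,
written out at `u ^ (-r) * v ^ (-s)`. -/
structure IsYangianFamily {n : ℕ} {A : Type*} [Ring A] (t : ℕ → Fin n → Fin n → A) : Prop where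
  zero : ∀ i j, t 0 i j = if i = j then 1 else 0
  rel : ∀ r s i j k l,
    (t (r + 1) i j * t s k l - t s k l * t (r + 1) i j)
      - (t r i j * t (s + 1) k l - t (s + 1) k l * t r i j)
      = t r k j * t s i l - t s k j * t r i l

/-- The free generator `T_ij^(r)` for `r ≥ 1`, together with the convention `T_ij^(0) = δ_ij`. -/
noncomputable def freeT (n : ℕ) : ℕ → Fin n → Fin n → FreeAlgebra ℂ (ℕ × Fin n × Fin n)
  | 0, i, j => if i = j then 1 else 0
  | r + 1, i, j => FreeAlgebra.ι ℂ (r, i, j)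

/-- The defining relations of the Yangian. -/
inductive YangianRel (n : ℕ) :
    FreeAlgebra ℂ (ℕ × Fin n × Fin n) → FreeAlgebra ℂ (ℕ × Fin n × Fin n) → Prop
  | mk (r s : ℕ) (i j k l : Fin n) : YangianRel n
      ((freeT n (r + 1) i j * freeT n s k l - freeT n s k l * freeT n (r + 1) i j)
        - (freeT n r i j * freeT n (s + 1) k l - freeT n (s + 1) k l * freeT n r i j))
      (freeT n r k j * freeT n s i l - freeT n s k j * freeT n r i l)

/-- The Yangian `Y(gl_n)`. -/
def Yangian (n : ℕ) : Type := RingQuot (YangianRel n)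

noncomputable instance (n : ℕ) : Ring (Yangian n) := inferInstanceAs (Ring (RingQuot _))
noncomputable instance (n : ℕ) : Algebra ℂ (Yangian n) :=
  inferInstanceAs (Algebra ℂ (RingQuot _))

/-- The generators `T_ij^(r)` of the Yangian, with `T_ij^(0) = δ_ij`. -/
noncomputable def Yangian.T (n : ℕ) (r : ℕ) (i j : Fin n) : Yangian n :=
  RingQuot.mkAlgHom ℂ (YangianRel n) (freeT n r i j)

theorem Yangian.isYangianFamily (n : ℕ) : IsYangianFamily (Yangian.T n) where
  zero i j := by
    change RingQuot.mkAlgHom ℂ (YangianRel n) (if i = j then 1 else 0) = _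
    split_ifs
    · exact map_one (RingQuot.mkAlgHom ℂ (YangianRel n))
    · exact map_zero (RingQuot.mkAlgHom ℂ (YangianRel n))
  rel r s i j k l := by
    have := RingQuot.mkAlgHom_rel ℂ (YangianRel.mk r s i j k l)
    simp only [map_sub, map_mul] at this
    exact this

/-- The algebra homomorphism out of the free algebra that is determined by a family. -/
noncomputable def freeLift {n : ℕ} {A : Type*} [Ring A] [Algebra ℂ A]
    (t : ℕ → Fin n → Fin n → A) : FreeAlgebra ℂ (ℕ × Fin n × Fin n) →ₐ[ℂ] A :=
  FreeAlgebra.lift ℂ fun x => t (x.1 + 1) x.2.1 x.2.2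

theorem freeLift_freeT {n : ℕ} {A : Type*} [Ring A] [Algebra ℂ A]
    {t : ℕ → Fin n → Fin n → A} (ht : IsYangianFamily t) (r : ℕ) (i j : Fin n) :
    freeLift t (freeT n r i j) = t r i j := by
  cases r with
  | zero =>
    rw [ht.zero, freeT]
    split_ifs <;> simp
  | succ r => simp [freeT, freeLift]

/-- The algebra homomorphism out of the Yangian with `T_ij^(r) ↦ t r i j`. -/
noncomputable def Yangian.lift {n : ℕ} {A : Type*} [Ring A] [Algebra ℂ A]
    (t : ℕ → Fin n → Fin n → A) (ht : IsYangianFamily t) : Yangian n →ₐ[ℂ] A :=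
  RingQuot.liftAlgHom ℂ ⟨freeLift t, by
    rintro _ _ ⟨r, s, i, j, k, l⟩
    simp only [map_sub, map_mul, freeLift_freeT ht]
    exact ht.rel r s i j k l⟩

theorem Yangian.lift_T {n : ℕ} {A : Type*} [Ring A] [Algebra ℂ A]
    (t : ℕ → Fin n → Fin n → A) (ht : IsYangianFamily t) (r : ℕ) (i j : Fin n) :
    Yangian.lift t ht (Yangian.T n r i j) = t r i j :=
  (RingQuot.liftAlgHom_mkAlgHom_apply ℂ _ _ _).trans (freeLift_freeT ht r i j)

/-- An element that commutes with the images of all generators commutes with the image of the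
Yangian. -/
theorem Yangian.commute_of_T {n : ℕ} {A : Type*} [Ring A] [Algebra ℂ A]
    (f : Yangian n →ₐ[ℂ] A) (a : A) (h : ∀ r i j, Commute (f (Yangian.T n r i j)) a)
    (y : Yangian n) : Commute (f y) a := by
  obtain ⟨y, rfl⟩ := RingQuot.mkAlgHom_surjective ℂ (YangianRel n) y
  induction y using FreeAlgebra.induction with
  | grade0 c =>
    have : f (RingQuot.mkAlgHom ℂ (YangianRel n) (algebraMap ℂ _ c)) = algebraMap ℂ A c := by
      rw [AlgHom.commutes]; exact f.commutes c
    rw [this]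
    exact Algebra.commutes c a
  | grade1 x => exact h (x.1 + 1) x.2.1 x.2.2
  | mul x y hx hy =>
    rw [map_mul]
    exact (map_mul f (RingQuot.mkAlgHom ℂ (YangianRel n) x) _).symm ▸ hx.mul_left hy
  | add x y hx hy =>
    rw [map_add]
    exact (map_add f (RingQuot.mkAlgHom ℂ (YangianRel n) x) _).symm ▸ hx.add_left hy

theorem IsYangianFamily.map {n : ℕ} {A B : Type*} [Ring A] [Ring B]
    {t : ℕ → Fin n → Fin n → A} (ht : IsYangianFamily t) (f : A →+* B) :
    IsYangianFamily fun r i j => f (t r i j) where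
  zero i j := by
    rw [ht.zero]
    split_ifs <;> simp
  rel r s i j k l := by
    simpa only [map_sub, map_mul] using congrArg f (ht.rel r s i j k l)

/-! The comultiplication -/

/-- The computation behind multiplicativity of the comultiplication. -/
theorem mul_rel {n : ℕ} {R : Type*} [Ring R] (c d : R) (hc : ∀ x, Commute c x)
    (hd : ∀ x, Commute d x) (T T' S S' : Fin n → Fin n → R)
    (hT : ∀ i j k l, c * (T i j * T' k l - T' k l * T i j)
      = d * (T k j * T' i l - T' k j * T i l))
    (hS : ∀ i j k l, c * (S i j * S' k l - S' k l * S i j)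
      = d * (S k j * S' i l - S' k j * S i l))
    (h1 : ∀ i j k l, Commute (T i j) (S' k l))
    (h2 : ∀ i j k l, Commute (T' i j) (S k l)) (i j k l : Fin n) :
    c * ((∑ a, T i a * S a j) * (∑ b, T' k b * S' b l)
        - (∑ b, T' k b * S' b l) * (∑ a, T i a * S a j))
      = d * ((∑ a, T k a * S a j) * (∑ b, T' i b * S' b l)
        - (∑ a, T' k a * S' a j) * (∑ b, T i b * S b l)) := by
  have key : ∀ a b, c * (T i a * S a j * (T' k b * S' b l) - T' k b * S' b l * (T i a * S a j))
      = d * (T k a * S a j * (T' i b * S' b l) - T' k b * S' b j * (T i a * S a l))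
        + (d * (T' k b * T i a * (S b j * S' a l)) - d * (T' k a * T i b * (S a j * S' b l))) := by
    intro a b
    have e1 : T i a * S a j * (T' k b * S' b l) - T' k b * S' b l * (T i a * S a j)
        = (T i a * T' k b - T' k b * T i a) * (S a j * S' b l)
          + (T' k b * T i a) * (S a j * S' b l - S' b l * S a j) := by
      have p1 : T i a * S a j * (T' k b * S' b l) = T i a * T' k b * (S a j * S' b l) := by
        rw [mul_assoc, ← mul_assoc (S a j), ← (h2 k b a j).eq]; noncomm_ring
      have p2 : T' k b * S' b l * (T i a * S a j) = T' k b * T i a * (S' b l * S a j) := by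
        rw [mul_assoc, ← mul_assoc (S' b l), ← (h1 i a b l).eq]; noncomm_ring
      rw [p1, p2]; noncomm_ring
    have e2 : c * ((T' k b * T i a) * (S a j * S' b l - S' b l * S a j))
        = d * ((T' k b * T i a) * (S b j * S' a l - S' b j * S a l)) := by
      rw [← mul_assoc, (hc _).eq, mul_assoc, hS, ← mul_assoc, ← (hd _).eq, mul_assoc]
    have p3 : T k a * S a j * (T' i b * S' b l) = T k a * T' i b * (S a j * S' b l) := by
      rw [mul_assoc, ← mul_assoc (S a j), ← (h2 i b a j).eq]; noncomm_ring
    have p4 : T' k b * S' b j * (T i a * S a l) = T' k b * T i a * (S' b j * S a l) := by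
      rw [mul_assoc, ← mul_assoc (S' b j), ← (h1 i a b j).eq]; noncomm_ring
    rw [e1, mul_add, e2, ← mul_assoc c, hT, p3, p4]
    noncomm_ring
  have swap : ∑ a, ∑ b, d * (T' k b * T i a * (S b j * S' a l))
      = ∑ a, ∑ b, d * (T' k a * T i b * (S a j * S' b l)) := Finset.sum_comm
  simp only [Finset.sum_mul_sum]
  rw [Finset.sum_comm (f := fun b a => T' k b * S' b l * (T i a * S a j)),
    Finset.sum_comm (f := fun b a => T' k b * S' b j * (T i a * S a l))]
  simp only [← Finset.sum_sub_distrib, Finset.mul_sum]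
  rw [Finset.sum_congr rfl fun a _ => Finset.sum_congr rfl fun b _ => key a b]
  simp only [Finset.sum_add_distrib, Finset.sum_sub_distrib]
  rw [swap, sub_self, add_zero]

/-- The series `t_ij(u)` in the outer variable `u⁻¹` of `A[[v⁻¹]][[u⁻¹]]`. -/
noncomputable def serU {n : ℕ} {A : Type*} [Ring A] (t : ℕ → Fin n → Fin n → A)
    (i j : Fin n) : PowerSeries (PowerSeries A) :=
  PowerSeries.mk fun r => PowerSeries.C (t r i j)

/-- The series `t_ij(v)` in the inner variable `v⁻¹` of `A[[v⁻¹]][[u⁻¹]]`. -/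
noncomputable def serV {n : ℕ} {A : Type*} [Ring A] (t : ℕ → Fin n → Fin n → A)
    (i j : Fin n) : PowerSeries (PowerSeries A) :=
  PowerSeries.C (PowerSeries.mk fun r => t r i j)

theorem rel_iff_series {n : ℕ} {A : Type*} [Ring A] (t : ℕ → Fin n → Fin n → A)
    (h0 : ∀ i j, t 0 i j = if i = j then 1 else 0) (i j k l : Fin n) :
    (PowerSeries.C PowerSeries.X - PowerSeries.X)
        * (serU t i j * serV t k l - serV t k l * serU t i j)
      = (PowerSeries.C PowerSeries.X * PowerSeries.X)
        * (serU t k j * serV t i l - serV t k j * serU t i l) ↔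
    ∀ r s, (t (r + 1) i j * t s k l - t s k l * t (r + 1) i j)
      - (t r i j * t (s + 1) k l - t (s + 1) k l * t r i j)
      = t r k j * t s i l - t s k j * t r i l := by
  have c0 : ∀ i j x, t 0 i j * x - x * t 0 i j = 0 := by
    intro i j x; rw [h0]; split_ifs <;> simp
  have c0' : ∀ i j x, x * t 0 i j - t 0 i j * x = 0 := by
    intro i j x; rw [h0]; split_ifs <;> simp
  constructor
  · intro h r s
    have := congrArg (fun f => PowerSeries.coeff (s + 1) (PowerSeries.coeff (r + 1) f)) h
    simp only [sub_mul, mul_assoc, serU, serV, PowerSeries.coeff_C_mul, PowerSeries.coeff_mul_C,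
      PowerSeries.coeff_succ_X_mul, map_sub, PowerSeries.coeff_mk] at this
    exact this
  · intro h
    ext r s
    rcases r with _ | r <;> rcases s with _ | s <;>
      simp only [sub_mul, mul_assoc, serU, serV, PowerSeries.coeff_C_mul, PowerSeries.coeff_mul_C,
        PowerSeries.coeff_succ_X_mul, PowerSeries.coeff_zero_X_mul, map_sub, PowerSeries.coeff_mk,
        map_zero, sub_zero, zero_sub]
    · exact c0 i j (t s k l)
    · exact neg_eq_zero.2 (c0' k l (t r i j))
    · exact h r s

/-- The coefficients of the series `∑_k t_ik(u) s_kj(u)`. -/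
def convFamily {n : ℕ} {A : Type*} [Ring A] (t s : ℕ → Fin n → Fin n → A)
    (r : ℕ) (i j : Fin n) : A :=
  ∑ k, ∑ x ∈ Finset.HasAntidiagonal.antidiagonal r, t x.1 i k * s x.2 k j

theorem serU_conv {n : ℕ} {A : Type*} [Ring A] (t s : ℕ → Fin n → Fin n → A) (i j : Fin n) :
    serU (convFamily t s) i j = ∑ k, serU t i k * serU s k j := by
  ext1 r
  simp [serU, convFamily, PowerSeries.coeff_mul, map_sum]

theorem serV_conv {n : ℕ} {A : Type*} [Ring A] (t s : ℕ → Fin n → Fin n → A) (i j : Fin n) :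
    serV (convFamily t s) i j = ∑ k, serV t i k * serV s k j := by
  simp only [serV, ← map_mul, ← map_sum]
  congr 1
  ext1 r
  simp [convFamily, PowerSeries.coeff_mul]

theorem serU_serV_commute {n : ℕ} {A : Type*} [Ring A] {t s : ℕ → Fin n → Fin n → A}
    (h : ∀ r i j r' k l, Commute (t r i j) (s r' k l)) (i j k l : Fin n) :
    Commute (serU t i j) (serV s k l) := by
  ext r r'
  simp [serU, serV, (h r i j r' k l).eq]

theorem IsYangianFamily.conv {n : ℕ} {A : Type*} [Ring A] {t s : ℕ → Fin n → Fin n → A}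
    (ht : IsYangianFamily t) (hs : IsYangianFamily s)
    (h : ∀ r i j r' k l, Commute (t r i j) (s r' k l)) : IsYangianFamily (convFamily t s) := by
  have h0 : ∀ i j, convFamily t s 0 i j = if i = j then 1 else 0 := by
    intro i j
    simp [convFamily, ht.zero, hs.zero]
  refine ⟨h0, fun r s' i j k l => (rel_iff_series _ h0 i j k l).1 ?_ r s'⟩
  simp only [serU_conv, serV_conv]
  have hX : ∀ f : PowerSeries (PowerSeries A), Commute PowerSeries.X f :=
    fun f => (PowerSeries.commute_X f).symm
  have hY : ∀ f : PowerSeries (PowerSeries A), Commute (PowerSeries.C PowerSeries.X) f := by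
    intro f
    ext1 r
    simp only [PowerSeries.coeff_C_mul, PowerSeries.coeff_mul_C]
    exact ((PowerSeries.commute_X _).symm).eq
  refine mul_rel _ _ (fun x => (hY x).sub_left (hX x)) (fun x => (hY x).mul_left (hX x))
    _ _ _ _ (fun i j k l => (rel_iff_series _ ht.zero i j k l).2 fun r s => ht.rel r s i j k l)
    (fun i j k l => (rel_iff_series _ hs.zero i j k l).2 fun r s => hs.rel r s i j k l)
    (serU_serV_commute h) ?_ i j k l
  intro i j k l
  exact (serU_serV_commute (fun r i j r' k l => (h r' k l r i j).symm) k l i j).symm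

/-- The comultiplication `T_ij(u) ↦ ∑_k T_ik(u) ⊗ T_kj(u)` of the Yangian. -/
noncomputable def Yangian.comul (n : ℕ) : Yangian n →ₐ[ℂ] Yangian n ⊗[ℂ] Yangian n :=
  Yangian.lift
    (fun r i j => ∑ k, ∑ x ∈ Finset.HasAntidiagonal.antidiagonal r, Yangian.T n x.1 i k ⊗ₜ[ℂ] Yangian.T n x.2 k j)
    (by
      have h1 := (Yangian.isYangianFamily n).map
        (Algebra.TensorProduct.includeLeft : Yangian n →ₐ[ℂ] Yangian n ⊗[ℂ] Yangian n).toRingHom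
      have h2 := (Yangian.isYangianFamily n).map
        (Algebra.TensorProduct.includeRight : Yangian n →ₐ[ℂ] Yangian n ⊗[ℂ] Yangian n).toRingHom
      have := h1.conv h2 (by
        intro r i j r' k l
        simp [Commute, SemiconjBy])
      convert this using 4 with r i j
      simp [convFamily])

/-! The shift automorphisms -/

/-- The coefficients of the series `t_ij(u - z)`, re-expanded in `u⁻¹`. -/
noncomputable def shiftFamily {n : ℕ} {A : Type*} [Ring A] [Algebra ℂ A] (z : ℂ)
    (t : ℕ → Fin n → Fin n → A) : ℕ → Fin n → Fin n → A
  | 0, i, j => t 0 i j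
  | s + 1, i, j => ∑ r ∈ Finset.range (s + 1), ((s.choose r : ℂ) * z ^ (s - r)) • t (r + 1) i j

/-- The linear map from polynomials that sends `w ^ r` to `t_ij^(r + 1)`. -/
noncomputable def momentMap {n : ℕ} {A : Type*} [Ring A] [Algebra ℂ A]
    (t : ℕ → Fin n → Fin n → A) (i j : Fin n) : Polynomial ℂ →ₗ[ℂ] A :=
  Polynomial.lsum fun r => LinearMap.toSpanSingleton ℂ A (t (r + 1) i j)

theorem momentMap_X_pow {n : ℕ} {A : Type*} [Ring A] [Algebra ℂ A]
    (t : ℕ → Fin n → Fin n → A) (i j : Fin n) (r : ℕ) :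
    momentMap t i j (Polynomial.X ^ r) = t (r + 1) i j := by
  rw [← Polynomial.monomial_one_right_eq_X_pow]
  simp [momentMap, Polynomial.sum_monomial_index]

theorem shiftFamily_succ {n : ℕ} {A : Type*} [Ring A] [Algebra ℂ A] (z : ℂ)
    (t : ℕ → Fin n → Fin n → A) (s : ℕ) (i j : Fin n) :
    shiftFamily z t (s + 1) i j
      = momentMap t i j ((Polynomial.X + Polynomial.C z) ^ s) := by
  rw [add_pow, map_sum]
  refine Finset.sum_congr rfl fun r _ => ?_
  have : (Polynomial.X : Polynomial ℂ) ^ r * Polynomial.C z ^ (s - r) * (s.choose r : Polynomial ℂ)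
      = ((s.choose r : ℂ) * z ^ (s - r)) • Polynomial.X ^ r := by
    rw [Polynomial.smul_eq_C_mul, map_mul, map_pow, map_natCast]; ring
  rw [this, map_smul, momentMap_X_pow]

theorem IsYangianFamily.momentMap_rel {n : ℕ} {A : Type*} [Ring A] [Algebra ℂ A]
    {t : ℕ → Fin n → Fin n → A} (ht : IsYangianFamily t) (i j k l : Fin n)
    (f g : Polynomial ℂ) :
    (momentMap t i j (Polynomial.X * f) * momentMap t k l g
        - momentMap t k l g * momentMap t i j (Polynomial.X * f))
      - (momentMap t i j f * momentMap t k l (Polynomial.X * g)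
        - momentMap t k l (Polynomial.X * g) * momentMap t i j f)
      = momentMap t k j f * momentMap t i l g - momentMap t k j g * momentMap t i l f := by
  induction f using Polynomial.induction_on' with
  | add f f' hf hf' =>
    simp only [mul_add, map_add, add_mul]
    have := congrArg₂ (· + ·) hf hf'
    refine Eq.trans ?_ (this.trans ?_) <;> abel
  | monomial r c =>
    induction g using Polynomial.induction_on' with
    | add f f' hf hf' =>
      simp only [mul_add, map_add, add_mul]
      have := congrArg₂ (· + ·) hf hf'
      refine Eq.trans ?_ (this.trans ?_) <;> abel
    | monomial s d =>
      have hm : ∀ (r : ℕ) (c : ℂ), Polynomial.monomial r c = c • (Polynomial.X : Polynomial ℂ) ^ r := by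
        intro r c; rw [Polynomial.smul_eq_C_mul, Polynomial.C_mul_X_pow_eq_monomial]
      simp only [hm, mul_smul_comm, map_smul, ← pow_succ', momentMap_X_pow, smul_mul_assoc]
      have := congrArg (fun x => c • d • x) (ht.rel (r + 1) (s + 1) i j k l)
      simp only [smul_sub] at this
      simp only [smul_comm d c]
      exact this

theorem IsYangianFamily.momentMap_one {n : ℕ} {A : Type*} [Ring A] [Algebra ℂ A]
    {t : ℕ → Fin n → Fin n → A} (ht : IsYangianFamily t) (i j k l : Fin n)
    (g : Polynomial ℂ) :
    momentMap t i j 1 * momentMap t k l g - momentMap t k l g * momentMap t i j 1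
      = t 0 k j * momentMap t i l g - momentMap t k j g * t 0 i l := by
  have h1 : ∀ i j, momentMap t i j 1 = t 1 i j := fun i j => by
    simpa using momentMap_X_pow t i j 0
  induction g using Polynomial.induction_on' with
  | add f f' hf hf' =>
    simp only [mul_add, map_add, add_mul]
    have := congrArg₂ (· + ·) hf hf'
    refine Eq.trans ?_ (this.trans ?_) <;> abel
  | monomial s d =>
    have hm : Polynomial.monomial s d = d • (Polynomial.X : Polynomial ℂ) ^ s := by
      rw [Polynomial.smul_eq_C_mul, Polynomial.C_mul_X_pow_eq_monomial]
    have := congrArg (fun x => d • x) (ht.rel 0 (s + 1) i j k l)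
    have c0 : t 0 i j * t (s + 1 + 1) k l - t (s + 1 + 1) k l * t 0 i j = 0 := by
      rw [ht.zero]; split_ifs <;> simp
    simp only [c0, sub_zero, smul_sub, zero_add] at this
    simpa only [hm, map_smul, momentMap_X_pow, h1, mul_smul_comm, smul_mul_assoc] using this

theorem IsYangianFamily.shift {n : ℕ} {A : Type*} [Ring A] [Algebra ℂ A]
    {t : ℕ → Fin n → Fin n → A} (ht : IsYangianFamily t) (z : ℂ) :
    IsYangianFamily (shiftFamily z t) := by
  have c0 : ∀ i j x, t 0 i j * x - x * t 0 i j = 0 := by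
    intro i j x; rw [ht.zero]; split_ifs <;> simp
  have c0' : ∀ i j x, t 0 i j * x = x * t 0 i j := fun i j x => sub_eq_zero.1 (c0 i j x)
  refine ⟨ht.zero, ?_⟩
  intro r s i j k l
  rcases r with _ | r <;> rcases s with _ | s
  · have e : shiftFamily z t 0 = t 0 := rfl
    rw [e, c0, c0' k l]
    simp
  · have := ht.momentMap_one i j k l ((Polynomial.X + Polynomial.C z) ^ s)
    have e : shiftFamily z t 0 = t 0 := rfl
    have e' : ∀ i j, shiftFamily z t 1 i j = momentMap t i j 1 := fun i j => by
      rw [show (1 : ℕ) = 0 + 1 from rfl, shiftFamily_succ, pow_zero]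
    rw [zero_add, e, e', c0, sub_zero, shiftFamily_succ, shiftFamily_succ, shiftFamily_succ, this]
  · have := ht.momentMap_one k l i j ((Polynomial.X + Polynomial.C z) ^ r)
    have e : shiftFamily z t 0 = t 0 := rfl
    have e' : ∀ i j, shiftFamily z t 1 i j = momentMap t i j 1 := fun i j => by
      rw [show (1 : ℕ) = 0 + 1 from rfl, shiftFamily_succ, pow_zero]
    rw [zero_add, e, e', ← neg_sub (t 0 k l * _), c0, neg_zero, zero_sub, shiftFamily_succ,
      shiftFamily_succ, shiftFamily_succ, neg_sub, this, c0', ← c0' k j]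
  · have := ht.momentMap_rel i j k l ((Polynomial.X + Polynomial.C z) ^ r)
      ((Polynomial.X + Polynomial.C z) ^ s)
    have e : ∀ i j r, shiftFamily z t (r + 1 + 1) i j
        = momentMap t i j (Polynomial.X * (Polynomial.X + Polynomial.C z) ^ r)
          + z • momentMap t i j ((Polynomial.X + Polynomial.C z) ^ r) := by
      intro i j r
      rw [shiftFamily_succ, pow_succ', add_mul, map_add, ← Polynomial.smul_eq_C_mul, map_smul]
    rw [e, e, shiftFamily_succ, shiftFamily_succ, shiftFamily_succ, shiftFamily_succ,
      shiftFamily_succ, shiftFamily_succ, ← this]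
    simp only [add_mul, mul_add, smul_mul_assoc, mul_smul_comm]
    abel

/-- The automorphism `τ_z : T_ij(u) ↦ T_ij(u - z)`. -/
noncomputable def Yangian.tau (n : ℕ) (z : ℂ) : Yangian n →ₐ[ℂ] Yangian n :=
  Yangian.lift (shiftFamily z (Yangian.T n)) ((Yangian.isYangianFamily n).shift z)

end Yangian
/-! ### Oscillators -/

section Oscillators

/-- Families `p`, `q` with `q q - θ q q = 0`, `p p - θ p p = 0` and `p q - θ q p = δ δ`. -/
structure IsOscillator {m n : ℕ} {A : Type*} [Ring A] [Algebra ℂ A] (θ : ℂ)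
    (p q : Fin m → Fin n → A) : Prop where
  qq : ∀ a i b j, q a i * q b j = θ • (q b j * q a i)
  pp : ∀ a i b j, p a i * p b j = θ • (p b j * p a i)
  pq : ∀ a i b j, p a i * q b j = θ • (q b j * p a i) + if a = b ∧ i = j then 1 else 0

theorem IsOscillator.rel2 {m n : ℕ} {A : Type*} [Ring A] [Algebra ℂ A] {θ : ℂ}
    {p q : Fin m → Fin n → A} (h : IsOscillator θ p q) (hθ : θ * θ = 1)
    (a : Fin m) (i : Fin n) (b : Fin m) (j : Fin n) (c : Fin m) (k : Fin n)
    (d : Fin m) (l : Fin n) :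
    q a i * p b j * (q c k * p d l)
      = θ • (q c k * p b j * (q a i * p d l))
          - θ • ((if a = b ∧ i = j then 1 else 0) * (q c k * p d l))
        + (if b = c ∧ j = k then 1 else 0) * (q a i * p d l) := by
  have e1 : q a i * p b j * (q c k * p d l) = q a i * (p b j * q c k) * p d l := by noncomm_ring
  have e2 : q c k * p b j * (q a i * p d l) = q c k * (p b j * q a i) * p d l := by noncomm_ring
  have e3 : q a i * q c k = θ • (q c k * q a i) := h.qq a i c k
  have e4 : (if b = a ∧ j = i then (1 : A) else 0) = if a = b ∧ i = j then 1 else 0 := by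
    simp only [eq_comm]
  rw [e1, e2, h.pq b j c k, h.pq b j a i, e4]
  have e5 : q a i * (q c k * p b j) = θ • (q c k * (q a i * p b j)) := by
    rw [← mul_assoc, e3, smul_mul_assoc, mul_assoc]
  simp only [mul_add, add_mul, mul_smul_comm, smul_mul_assoc, smul_add, smul_smul, hθ, one_smul,
    e5]
  split_ifs <;> simp

theorem IsOscillator.rel3 {m n : ℕ} {A : Type*} [Ring A] [Algebra ℂ A] {θ : ℂ}
    {p q : Fin m → Fin n → A} (h : IsOscillator θ p q) (hθ : θ * θ = 1)
    (a : Fin m) (i : Fin n) (b : Fin m) (j : Fin n) (c : Fin m) (k : Fin n)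
    (d : Fin m) (l : Fin n) :
    q c k * p d l * (q a i * p b j)
      = θ • (q c k * p b j * (q a i * p d l))
          - θ • ((if a = b ∧ i = j then 1 else 0) * (q c k * p d l))
        + (if a = d ∧ i = l then 1 else 0) * (q c k * p b j) := by
  have e1 : q c k * p d l * (q a i * p b j) = q c k * (p d l * q a i) * p b j := by noncomm_ring
  have e2 : q c k * p b j * (q a i * p d l) = q c k * (p b j * q a i) * p d l := by noncomm_ring
  have e4 : ∀ b j, (if b = a ∧ j = i then (1 : A) else 0) = if a = b ∧ i = j then 1 else 0 := by
    intro b j; simp only [eq_comm]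
  rw [e1, e2, h.pq d l a i, h.pq b j a i, e4, e4]
  have e5 : q c k * (q a i * p d l) * p b j = θ • (q c k * (q a i * p b j) * p d l) := by
    have := h.pp d l b j
    simp only [mul_assoc, this, mul_smul_comm]
  simp only [mul_add, add_mul, mul_smul_comm, smul_mul_assoc, smul_add, smul_smul, hθ, one_smul,
    e5]
  split_ifs <;> simp

/-- The commutation relations of the bilinear elements `q_ai p_bj`. -/
theorem IsOscillator.rel1 {m n : ℕ} {A : Type*} [Ring A] [Algebra ℂ A] {θ : ℂ}
    {p q : Fin m → Fin n → A} (h : IsOscillator θ p q) (hθ : θ * θ = 1)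
    (a : Fin m) (i : Fin n) (b : Fin m) (j : Fin n) (c : Fin m) (k : Fin n)
    (d : Fin m) (l : Fin n) :
    q a i * p b j * (q c k * p d l) - q c k * p d l * (q a i * p b j)
      = (if b = c ∧ j = k then 1 else 0) * (q a i * p d l)
        - (if a = d ∧ i = l then 1 else 0) * (q c k * p b j) := by
  rw [h.rel2 hθ a i b j c k d l, h.rel3 hθ a i b j c k d l]
  abel

/-- Elements with the commutation relations of the matrix units of `gl_m`. -/
def IsGlFamily {m : ℕ} {A : Type*} [Ring A] (E : Fin m → Fin m → A) : Prop :=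
  ∀ a b c d, E a b * E c d - E c d * E a b
    = (if b = c then 1 else 0) * E a d - (if a = d then 1 else 0) * E c b

/-- The transpose of the matrix of generators. -/
def transposeMatrix {m : ℕ} {A : Type*} (E : Fin m → Fin m → A) : Matrix (Fin m) (Fin m) A :=
  Matrix.of fun a b => E b a

theorem IsGlFamily.equivariant {m : ℕ} {A : Type*} [Ring A] {E : Fin m → Fin m → A}
    (hE : IsGlFamily E) (r : ℕ) (h g a b : Fin m) :
    E h g * (transposeMatrix E ^ r) a b - (transposeMatrix E ^ r) a b * E h g
      = (if b = g then 1 else 0) * (transposeMatrix E ^ r) a h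
        - (if a = h then 1 else 0) * (transposeMatrix E ^ r) g b := by
  induction r generalizing a b with
  | zero =>
    simp only [pow_zero, Matrix.one_apply]
    simp only [eq_comm (a := g) (b := b)]
    by_cases h1 : a = h <;> by_cases h2 : b = g <;> simp [h1, h2]
  | succ r ih =>
    rw [pow_succ]
    simp only [Matrix.mul_apply, transposeMatrix, Matrix.of_apply]
    change E h g * ∑ e, (transposeMatrix E ^ r) a e * E b e
      - (∑ e, (transposeMatrix E ^ r) a e * E b e) * E h g
      = (if b = g then 1 else 0) * ∑ e, (transposeMatrix E ^ r) a e * E h e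
        - (if a = h then 1 else 0) * ∑ e, (transposeMatrix E ^ r) g e * E b e
    have key : ∀ e, E h g * ((transposeMatrix E ^ r) a e * E b e)
        - (transposeMatrix E ^ r) a e * E b e * E h g
        = ((if e = g then 1 else 0) * (transposeMatrix E ^ r) a h
            - (if a = h then 1 else 0) * (transposeMatrix E ^ r) g e) * E b e
          + (transposeMatrix E ^ r) a e
            * ((if g = b then 1 else 0) * E h e - (if h = e then 1 else 0) * E b g) := by
      intro e
      rw [← ih, ← hE]
      noncomm_ring
    rw [Finset.mul_sum, Finset.sum_mul, ← Finset.sum_sub_distrib,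
      Finset.sum_congr rfl fun e _ => key e]
    simp only [sub_mul, mul_sub, Finset.sum_add_distrib, Finset.sum_sub_distrib]
    simp only [ite_mul, mul_ite, one_mul, zero_mul, mul_zero, Finset.sum_ite_eq,
      Finset.sum_ite_eq', Finset.mem_univ, if_true]
    simp only [eq_comm (a := g) (b := b)]
    by_cases h1 : a = h <;> by_cases h2 : b = g <;> (simp [h1, h2]; try abel)

theorem IsGlFamily.power_rel {m : ℕ} {A : Type*} [Ring A] {E : Fin m → Fin m → A}
    (hE : IsGlFamily E) (r s : ℕ) (a b c d : Fin m) :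
    ((transposeMatrix E ^ (r + 1)) a b * (transposeMatrix E ^ s) c d
        - (transposeMatrix E ^ s) c d * (transposeMatrix E ^ (r + 1)) a b)
      - ((transposeMatrix E ^ r) a b * (transposeMatrix E ^ (s + 1)) c d
        - (transposeMatrix E ^ (s + 1)) c d * (transposeMatrix E ^ r) a b)
      = (transposeMatrix E ^ r) a d * (transposeMatrix E ^ s) c b
        - (transposeMatrix E ^ s) a d * (transposeMatrix E ^ r) c b := by
  have step : ∀ r s a b c d, (transposeMatrix E ^ (r + 1)) a b * (transposeMatrix E ^ s) c d
        - (transposeMatrix E ^ s) c d * (transposeMatrix E ^ (r + 1)) a b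
      = ∑ e, E e a * ((transposeMatrix E ^ r) e b * (transposeMatrix E ^ s) c d
        - (transposeMatrix E ^ s) c d * (transposeMatrix E ^ r) e b)
        + ((if d = a then 1 else 0) * (transposeMatrix E ^ (s + r)) c b
          - (transposeMatrix E ^ s) a d * (transposeMatrix E ^ r) c b) := by
    intro r s a b c d
    have key : ∀ e, E e a * (transposeMatrix E ^ r) e b * (transposeMatrix E ^ s) c d
        - (transposeMatrix E ^ s) c d * (E e a * (transposeMatrix E ^ r) e b)
        = E e a * ((transposeMatrix E ^ r) e b * (transposeMatrix E ^ s) c d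
            - (transposeMatrix E ^ s) c d * (transposeMatrix E ^ r) e b)
          + ((if d = a then 1 else 0) * (transposeMatrix E ^ s) c e
            - (if c = e then 1 else 0) * (transposeMatrix E ^ s) a d)
            * (transposeMatrix E ^ r) e b := by
      intro e
      rw [← hE.equivariant]
      noncomm_ring
    have hpow : (transposeMatrix E ^ (r + 1)) a b = ∑ e, E e a * (transposeMatrix E ^ r) e b := by
      rw [pow_succ', Matrix.mul_apply]; rfl
    rw [hpow, Finset.mul_sum, Finset.sum_mul, ← Finset.sum_sub_distrib,
      Finset.sum_congr rfl fun e _ => key e, Finset.sum_add_distrib]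
    congr 1
    rw [pow_add, Matrix.mul_apply]
    simp only [sub_mul, Finset.sum_sub_distrib, Finset.mul_sum, mul_assoc]
    simp
  induction r generalizing a with
  | zero =>
    rw [step 0 s]
    simp [Matrix.one_apply]
    simp only [eq_comm (a := d) (b := a)]
  | succ r ih =>
    have hpow : ∀ r a b, (transposeMatrix E ^ (r + 1)) a b
        = ∑ e, E e a * (transposeMatrix E ^ r) e b := by
      intro r a b; rw [pow_succ', Matrix.mul_apply]; rfl
    rw [step (r + 1) s, step r (s + 1), add_sub_add_comm, ← Finset.sum_sub_distrib]
    simp only [← mul_sub, ih]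
    rw [show s + 1 + r = s + (r + 1) by ring, hpow r a d, hpow s a d, Finset.sum_mul,
      Finset.sum_mul]
    simp only [mul_sub, Finset.sum_sub_distrib, mul_assoc]
    abel

/-- The sum `∑_ab M_ab q_ai p_bj`. -/
def contract {m n : ℕ} {A : Type*} [Ring A] (p q : Fin m → Fin n → A)
    (M : Matrix (Fin m) (Fin m) A) (i j : Fin n) : A :=
  ∑ a, ∑ b, M a b * (q a i * p b j)

theorem contract_smul {m n : ℕ} {A : Type*} [Ring A] [Algebra ℂ A] (p q : Fin m → Fin n → A)
    (M : Matrix (Fin m) (Fin m) A) (c : ℂ) (i j : Fin n) :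
    contract p q (c • M) i j = c • contract p q M i j := by
  simp [contract, Finset.smul_sum]

theorem contract_mul {m n : ℕ} {A : Type*} [Ring A] {p q : Fin m → Fin n → A}
    {M N : Matrix (Fin m) (Fin m) A}
    (hN : ∀ a b c i d j, Commute (N a b) (q c i * p d j)) (i j k l : Fin n) :
    contract p q M i j * contract p q N k l
      = ∑ a, ∑ b, ∑ c, ∑ d, M a b * N c d * (q a i * p b j * (q c k * p d l)) := by
  simp only [contract, Finset.sum_mul]
  simp only [Finset.mul_sum]
  refine Finset.sum_congr rfl fun a _ => Finset.sum_congr rfl fun b _ =>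
    Finset.sum_congr rfl fun c _ => Finset.sum_congr rfl fun d _ => ?_
  rw [mul_assoc (M a b), ← mul_assoc (q a i * p b j), ← (hN c d a i b j).eq]
  simp only [mul_assoc]

theorem contract_commutator {m n : ℕ} {A : Type*} [Ring A] [Algebra ℂ A] {θ : ℂ}
    {p q : Fin m → Fin n → A} (h : IsOscillator θ p q) (hθ : θ * θ = 1)
    {M N : Matrix (Fin m) (Fin m) A}
    (hM : ∀ a b c i d j, Commute (M a b) (q c i * p d j))
    (hN : ∀ a b c i d j, Commute (N a b) (q c i * p d j)) (i j k l : Fin n) :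
    contract p q M i j * contract p q N k l - contract p q N k l * contract p q M i j
      = ∑ a, ∑ b, ∑ c, ∑ d, (M a b * N c d - N c d * M a b)
          * (θ • (q c k * p b j * (q a i * p d l))
            - θ • ((if a = b ∧ i = j then 1 else 0) * (q c k * p d l)))
        + ((if j = k then 1 else 0) * contract p q (M * N) i l
          - (if i = l then 1 else 0) * contract p q (N * M) k j) := by
  have hNM : contract p q N k l * contract p q M i j
      = ∑ a, ∑ b, ∑ c, ∑ d, N c d * M a b * (q c k * p d l * (q a i * p b j)) := by
    rw [contract_mul hM]
    have : ∀ f : Fin m → Fin m → Fin m → Fin m → A,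
        ∑ c, ∑ d, ∑ a, ∑ b, f a b c d = ∑ a, ∑ b, ∑ c, ∑ d, f a b c d := by
      intro f
      calc ∑ c, ∑ d, ∑ a, ∑ b, f a b c d
          = ∑ x : Fin m × Fin m, ∑ y : Fin m × Fin m, f y.1 y.2 x.1 x.2 := by
            simp only [Fintype.sum_prod_type]
        _ = ∑ y : Fin m × Fin m, ∑ x : Fin m × Fin m, f y.1 y.2 x.1 x.2 := Finset.sum_comm
        _ = _ := by simp only [Fintype.sum_prod_type]
    exact this fun a b c d => N c d * M a b * (q c k * p d l * (q a i * p b j))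
  have u : (if j = k then 1 else 0) * contract p q (M * N) i l
      = ∑ a, ∑ b, ∑ c, ∑ d, M a b * N c d
          * ((if b = c ∧ j = k then 1 else 0) * (q a i * p d l)) := by
    by_cases hjk : j = k
    · simp only [hjk, if_true, one_mul, and_true, contract, Matrix.mul_apply, ite_mul, zero_mul,
        mul_ite, mul_zero]
      refine Finset.sum_congr rfl fun a _ => ?_
      simp only [Finset.sum_mul]
      rw [Finset.sum_comm]
      refine Finset.sum_congr rfl fun b _ => ?_
      rw [Finset.sum_comm]
      refine Finset.sum_congr rfl fun d _ => ?_
      simp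
    · simp [hjk]
  have v : (if i = l then 1 else 0) * contract p q (N * M) k j
      = ∑ a, ∑ b, ∑ c, ∑ d, N c d * M a b
          * ((if a = d ∧ i = l then 1 else 0) * (q c k * p b j)) := by
    by_cases hil : i = l
    · simp only [hil, if_true, one_mul, and_true, contract, Matrix.mul_apply, ite_mul, zero_mul,
        mul_ite, mul_zero, Finset.sum_ite_eq, Finset.mem_univ, Finset.sum_mul]
      rw [Finset.sum_comm]
      have : ∀ f : Fin m → Fin m → Fin m → A,
          ∑ b, ∑ c, ∑ a, f a b c = ∑ a, ∑ b, ∑ c, f a b c := by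
        intro f
        rw [Finset.sum_comm' (t' := Finset.univ) (s' := fun _ => Finset.univ) (by simp)]
        rw [Finset.sum_congr rfl fun c _ => Finset.sum_comm]
        rw [Finset.sum_comm]
        exact Finset.sum_congr rfl fun a _ => Finset.sum_comm
      exact this fun a b c => N c a * M a b * (q c k * p b j)
    · simp [hil]
  rw [contract_mul hN, hNM, u, v]
  simp only [← Finset.sum_sub_distrib, ← Finset.sum_add_distrib]
  refine Finset.sum_congr rfl fun a _ => Finset.sum_congr rfl fun b _ =>
    Finset.sum_congr rfl fun c _ => Finset.sum_congr rfl fun d _ => ?_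
  rw [h.rel2 hθ a i b j c k d l, h.rel3 hθ a i b j c k d l]
  simp only [mul_add, mul_sub, sub_mul]
  abel

/-- The coefficients of the series `δ_ij + ∑_ab X_ab(u) q_ai p_bj` where
`X(u) = (u + θ E')⁻¹ = ∑_r (-θ E') ^ r u ^ (-r - 1)`. -/
def alphaFamily {m n : ℕ} {A : Type*} [Ring A] [Algebra ℂ A] (θ : ℂ) (E : Fin m → Fin m → A)
    (p q : Fin m → Fin n → A) : ℕ → Fin n → Fin n → A
  | 0, i, j => if i = j then 1 else 0
  | r + 1, i, j => contract p q ((-θ) ^ r • transposeMatrix E ^ r) i j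

theorem isYangianFamily_alpha {m n : ℕ} {A : Type*} [Ring A] [Algebra ℂ A] {θ : ℂ}
    {E : Fin m → Fin m → A} {p q : Fin m → Fin n → A} (hE : IsGlFamily E)
    (h : IsOscillator θ p q) (hθ : θ * θ = 1)
    (hc : ∀ r a b c i d j, Commute ((transposeMatrix E ^ r) a b) (q c i * p d j)) :
    IsYangianFamily (alphaFamily θ E p q) := by
  set P : ℕ → Matrix (Fin m) (Fin m) A := fun r => (-θ) ^ r • transposeMatrix E ^ r with hP
  have hPc : ∀ r a b c i d j, Commute (P r a b) (q c i * p d j) :=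
    fun r a b c i d j => (hc r a b c i d j).smul_left _
  have hPP : ∀ r s, P r * P s = P (r + s) := by
    intro r s
    simp only [hP, smul_mul_smul_comm, pow_add]
  have hrel : ∀ r s a b c d, (P (r + 1) a b * P s c d - P s c d * P (r + 1) a b)
      - (P r a b * P (s + 1) c d - P (s + 1) c d * P r a b)
      = θ • (P r c b * P s a d - P s c b * P r a d) := by
    intro r s a b c d
    have := hE.power_rel s r c d a b
    have e1 : ∀ r s a b c d, P r a b * P s c d
        = (-θ) ^ (r + s) • ((transposeMatrix E ^ r) a b * (transposeMatrix E ^ s) c d) := by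
      intro r s a b c d
      simp only [hP, Matrix.smul_apply, smul_mul_smul_comm, pow_add]
    simp only [e1]
    rw [show s + (r + 1) = r + s + 1 by ring, show r + 1 + s = r + s + 1 by ring,
      show r + (s + 1) = r + s + 1 by ring, show s + 1 + r = r + s + 1 by ring, add_comm s r,
      ← smul_sub, ← smul_sub, ← smul_sub, ← smul_sub, smul_smul, pow_succ', neg_mul, neg_smul,
      ← smul_neg]
    congr 1
    rw [← neg_sub ((transposeMatrix E ^ s) c b * _), ← this]
    abel
  have one : ∀ s i j k l, contract p q (P 0) i j * contract p q (P s) k l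
      - contract p q (P s) k l * contract p q (P 0) i j
      = (if j = k then 1 else 0) * contract p q (P s) i l
          - (if i = l then 1 else 0) * contract p q (P s) k j := by
    intro s i j k l
    rw [contract_commutator h hθ (hPc _) (hPc _), hPP, hPP, zero_add, add_zero]
    rw [add_eq_right]
    refine Finset.sum_eq_zero fun a _ => Finset.sum_eq_zero fun b _ =>
      Finset.sum_eq_zero fun c _ => Finset.sum_eq_zero fun d _ => ?_
    have : P 0 a b * P s c d - P s c d * P 0 a b = 0 := by
      simp only [hP, pow_zero, one_smul, Matrix.one_apply]
      split_ifs <;> simp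
    rw [this, zero_mul]
  refine ⟨fun i j => rfl, ?_⟩
  intro r s i j k l
  rcases r with _ | r <;> rcases s with _ | s
  · simp only [alphaFamily]
    split_ifs <;> simp
  · have := one (s + 1 - 1 + 0) i j k l
    change (contract p q (P 0) i j * contract p q (P s) k l
      - contract p q (P s) k l * contract p q (P 0) i j)
      - ((if i = j then 1 else 0) * contract p q (P (s + 1)) k l
        - contract p q (P (s + 1)) k l * (if i = j then 1 else 0))
      = (if k = j then 1 else 0) * contract p q (P s) i l
        - contract p q (P s) k j * (if i = l then 1 else 0)
    rw [one]
    simp only [eq_comm (a := k) (b := j)]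
    split_ifs <;> simp
  · change (contract p q (P (r + 1)) i j * (if k = l then 1 else 0)
        - (if k = l then 1 else 0) * contract p q (P (r + 1)) i j)
      - (contract p q (P r) i j * contract p q (P 0) k l
        - contract p q (P 0) k l * contract p q (P r) i j)
      = contract p q (P r) k j * (if i = l then 1 else 0)
        - (if k = j then 1 else 0) * contract p q (P r) i l
    rw [← neg_sub (contract p q (P 0) k l * _), one]
    simp only [eq_comm (a := l) (b := i)]
    split_ifs <;> simp
  · change (contract p q (P (r + 1)) i j * contract p q (P s) k l
      - contract p q (P s) k l * contract p q (P (r + 1)) i j)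
      - (contract p q (P r) i j * contract p q (P (s + 1)) k l
        - contract p q (P (s + 1)) k l * contract p q (P r) i j)
      = contract p q (P r) k j * contract p q (P s) i l
        - contract p q (P s) k j * contract p q (P r) i l
    rw [contract_commutator h hθ (hPc _) (hPc _), contract_commutator h hθ (hPc _) (hPc _),
      hPP, hPP, hPP, hPP, show s + (r + 1) = r + s + 1 by ring,
      show r + 1 + s = r + s + 1 by ring, show r + (s + 1) = r + s + 1 by ring,
      show s + 1 + r = r + s + 1 by ring, add_sub_add_right_eq_sub]
    simp only [← Finset.sum_sub_distrib, ← sub_mul, hrel]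
    have sw : ∀ f : Fin m → Fin m → Fin m → Fin m → A,
        ∑ a, ∑ b, ∑ c, ∑ d, f a b c d = ∑ c, ∑ b, ∑ a, ∑ d, f a b c d := by
      intro f
      rw [Finset.sum_comm, Finset.sum_congr rfl fun b _ => Finset.sum_comm, Finset.sum_comm]
    have main : ∀ r s, contract p q (P r) k j * contract p q (P s) i l
        = ∑ a, ∑ b, ∑ c, ∑ d, P r c b * P s a d * (q c k * p b j * (q a i * p d l)) := by
      intro r s
      rw [contract_mul (hPc _)]
      exact sw fun c b a d => P r c b * P s a d * (q c k * p b j * (q a i * p d l))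
    have diag : ∑ a, ∑ b, ∑ c, ∑ d, (P r c b * P s a d - P s c b * P r a d)
        * ((if a = b ∧ i = j then 1 else 0) * (q c k * p d l)) = 0 := by
      by_cases hij : i = j
      · simp only [hij, and_true, ite_mul, one_mul, zero_mul, mul_ite, mul_zero]
        rw [Finset.sum_congr rfl fun a _ => Finset.sum_comm]
        have : ∀ a c, ∑ b, ∑ d, (if a = b then (P r c b * P s a d - P s c b * P r a d)
            * (q c k * p d l) else 0)
            = ∑ d, (P r c a * P s a d - P s c a * P r a d) * (q c k * p d l) := by
          intro a c
          rw [Finset.sum_comm]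
          simp
        simp only [this]
        rw [Finset.sum_comm]
        refine Finset.sum_eq_zero fun c _ => ?_
        rw [Finset.sum_comm]
        refine Finset.sum_eq_zero fun d _ => ?_
        rw [← Finset.sum_mul, Finset.sum_sub_distrib, ← Matrix.mul_apply, ← Matrix.mul_apply,
          hPP, hPP, add_comm s r, sub_self, zero_mul]
      · simp [hij]
    rw [main, main]
    simp only [mul_sub, Finset.sum_sub_distrib, smul_mul_assoc, mul_smul_comm, smul_smul, hθ,
      one_smul]
    rw [diag, sub_zero]
    simp only [sub_mul, Finset.sum_sub_distrib]

/-- The image of the Yangian commutes with the diagonal action of `gl_m`. -/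
theorem commute_contract {m n : ℕ} {A : Type*} [Ring A] [Algebra ℂ A] {θ : ℂ}
    {E : Fin m → Fin m → A} {p q : Fin m → Fin n → A} (hE : IsGlFamily E)
    (h : IsOscillator θ p q) (hθ : θ * θ = 1)
    (hc : ∀ r a b c i d j, Commute ((transposeMatrix E ^ r) a b) (q c i * p d j))
    (r : ℕ) (i j : Fin n) (c d : Fin m) :
    Commute (contract p q (transposeMatrix E ^ r) i j) (E c d + ∑ k, q c k * p d k) := by
  have hEc : ∀ a b c i d j, Commute (E a b) (q c i * p d j) := by
    intro a b c i d j
    have := hc 1 b a c i d j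
    rwa [pow_one] at this
  have D : ∀ a b, (∑ k, q c k * p d k) * (q a i * p b j) - (q a i * p b j) * ∑ k, q c k * p d k
      = (if a = d then 1 else 0) * (q c i * p b j)
        - (if b = c then 1 else 0) * (q a i * p d j) := by
    intro a b
    rw [Finset.sum_mul, Finset.mul_sum, ← Finset.sum_sub_distrib]
    simp only [h.rel1 hθ, Finset.sum_sub_distrib]
    simp only [eq_comm (a := a) (b := d), eq_comm (a := b) (b := c)]
    by_cases h1 : d = a <;> by_cases h2 : c = b <;> simp [h1, h2]
  have key : ∀ a b, (E c d + ∑ k, q c k * p d k) * ((transposeMatrix E ^ r) a b * (q a i * p b j))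
      - ((transposeMatrix E ^ r) a b * (q a i * p b j)) * (E c d + ∑ k, q c k * p d k)
      = ((if b = d then 1 else 0) * (transposeMatrix E ^ r) a c
          - (if a = c then 1 else 0) * (transposeMatrix E ^ r) d b) * (q a i * p b j)
        + (transposeMatrix E ^ r) a b * ((if a = d then 1 else 0) * (q c i * p b j)
          - (if b = c then 1 else 0) * (q a i * p d j)) := by
    intro a b
    rw [← D, ← hE.equivariant]
    have hS : Commute ((transposeMatrix E ^ r) a b) (∑ k, q c k * p d k) :=
      Commute.sum_right _ _ _ fun k _ => hc r a b c k d k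
    have e1 := (hEc c d a i b j).eq
    have e2 := hS.eq
    generalize (∑ k, q c k * p d k) = S at *
    generalize (transposeMatrix E ^ r) a b = Q at *
    generalize q a i * p b j = Z at *
    generalize E c d = F at *
    have : S * (Q * Z) = Q * S * Z := by rw [← mul_assoc, e2]
    rw [add_mul, this, mul_add, mul_assoc Q Z F, ← e1]
    noncomm_ring
  rw [Commute, SemiconjBy, ← sub_eq_zero, ← neg_eq_zero, neg_sub]
  simp only [contract, Finset.mul_sum (Finset.univ : Finset (Fin m)),
    Finset.sum_mul (Finset.univ : Finset (Fin m)), ← Finset.sum_sub_distrib]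
  rw [Finset.sum_congr rfl fun a _ => Finset.sum_congr rfl fun b _ => key a b]
  simp only [sub_mul, mul_sub, Finset.sum_add_distrib, Finset.sum_sub_distrib]
  simp only [ite_mul, mul_ite, one_mul, zero_mul, mul_zero]
  have s1 : ∀ f : Fin m → Fin m → A, ∀ c : Fin m,
      ∑ a, ∑ b, (if a = c then f a b else 0) = ∑ b, f c b := by
    intro f c; rw [Finset.sum_comm]; simp
  simp only [s1, Finset.sum_ite_eq', Finset.mem_univ, if_true]
  abel

end Oscillators

/-! ### Fock spaces -/

section Fock

/-- The two cases: commuting variables (`θ = 1`) and anticommuting variables (`θ = -1`). -/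
inductive VarKind
  | commuting
  | anticommuting

/-- The sign `θ`. -/
noncomputable def VarKind.sign : VarKind → ℂ
  | .commuting => 1
  | .anticommuting => -1

theorem VarKind.sign_mul_sign (σ : VarKind) : σ.sign * σ.sign = 1 := by
  cases σ <;> simp [VarKind.sign]

/-- The space `ℋ(ℂ^m ⊗ ℂ^n)`: polynomials in the `x_ai` for `θ = 1`, the Grassmann algebra of
the `x_ai` for `θ = -1`. -/
def Fock : VarKind → ℕ → ℕ → Type
  | .commuting, m, n => MvPolynomial (Fin m × Fin n) ℂ
  | .anticommuting, m, n => ExteriorAlgebra ℂ (Fin m × Fin n → ℂ)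

noncomputable instance : (σ : VarKind) → (m n : ℕ) → AddCommGroup (Fock σ m n)
  | .commuting, m, n => inferInstanceAs (AddCommGroup (MvPolynomial (Fin m × Fin n) ℂ))
  | .anticommuting, m, n =>
    inferInstanceAs (AddCommGroup (ExteriorAlgebra ℂ (Fin m × Fin n → ℂ)))

noncomputable instance : (σ : VarKind) → (m n : ℕ) → Module ℂ (Fock σ m n)
  | .commuting, m, n => inferInstanceAs (Module ℂ (MvPolynomial (Fin m × Fin n) ℂ))
  | .anticommuting, m, n => inferInstanceAs (Module ℂ (ExteriorAlgebra ℂ (Fin m × Fin n → ℂ)))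

/-- Multiplication by `x_ai` on polynomials. -/
noncomputable def polyX {m n : ℕ} (a : Fin m) (i : Fin n) :
    Module.End ℂ (MvPolynomial (Fin m × Fin n) ℂ) :=
  LinearMap.mulLeft ℂ (MvPolynomial.X (a, i))

/-- The partial derivative `∂_ai` on polynomials. -/
noncomputable def polyD {m n : ℕ} (a : Fin m) (i : Fin n) :
    Module.End ℂ (MvPolynomial (Fin m × Fin n) ℂ) :=
  (MvPolynomial.pderiv (a, i)).toLinearMap

/-- Left multiplication by `x_ai` on the Grassmann algebra. -/
noncomputable def grassX {m n : ℕ} (a : Fin m) (i : Fin n) :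
    Module.End ℂ (ExteriorAlgebra ℂ (Fin m × Fin n → ℂ)) :=
  LinearMap.mulLeft ℂ (ExteriorAlgebra.ι ℂ (Pi.single (a, i) 1))

/-- The left derivation `∂_ai` on the Grassmann algebra. -/
noncomputable def grassD {m n : ℕ} (a : Fin m) (i : Fin n) :
    Module.End ℂ (ExteriorAlgebra ℂ (Fin m × Fin n → ℂ)) :=
  CliffordAlgebra.contractLeft (Q := (0 : QuadraticForm ℂ (Fin m × Fin n → ℂ)))
    (LinearMap.proj (a, i))

/-- Left multiplication by `x_ai`. -/
noncomputable def xOp : (σ : VarKind) → {m n : ℕ} → Fin m → Fin n → Module.End ℂ (Fock σ m n)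
  | .commuting, _, _, a, i => polyX a i
  | .anticommuting, _, _, a, i => grassX a i

/-- The (left) derivation `∂_ai`. -/
noncomputable def dOp : (σ : VarKind) → {m n : ℕ} → Fin m → Fin n → Module.End ℂ (Fock σ m n)
  | .commuting, _, _, a, i => polyD a i
  | .anticommuting, _, _, a, i => grassD a i

theorem polyX_polyX {m n : ℕ} (a : Fin m) (i : Fin n) (b : Fin m) (j : Fin n) :
    polyX a i * polyX b j = (1 : ℂ) • (polyX b j * polyX a i) := by
  refine LinearMap.ext fun f => ?_
  simp only [polyX, Module.End.mul_apply, LinearMap.mulLeft_apply, one_smul]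
  ring

theorem polyD_polyD {m n : ℕ} (a : Fin m) (i : Fin n) (b : Fin m) (j : Fin n) :
    polyD a i * polyD b j = (1 : ℂ) • (polyD b j * polyD a i) := by
  refine LinearMap.ext fun f => ?_
  have h : ⁅MvPolynomial.pderiv (R := ℂ) (a, i), MvPolynomial.pderiv (R := ℂ) (b, j)⁆ = 0 := by
    refine MvPolynomial.derivation_ext fun x => ?_
    simp [Derivation.commutator_apply, MvPolynomial.pderiv_X, Pi.single_apply, apply_ite]
  have := congrArg (fun D => D f) h
  simpa [polyD, Derivation.commutator_apply, sub_eq_zero] using this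

theorem polyD_polyX {m n : ℕ} (a : Fin m) (i : Fin n) (b : Fin m) (j : Fin n) :
    polyD a i * polyX b j
      = (1 : ℂ) • (polyX b j * polyD a i) + if a = b ∧ i = j then 1 else 0 := by
  refine LinearMap.ext fun f => ?_
  by_cases h : a = b ∧ i = j
  · obtain ⟨rfl, rfl⟩ := h
    simp [polyD, polyX]
  · have h' : ¬ (b, j) = (a, i) := by
      rw [Prod.mk.injEq]; rintro ⟨rfl, rfl⟩; exact h ⟨rfl, rfl⟩
    simp [polyD, polyX, h, h', MvPolynomial.pderiv_X]

theorem grassX_grassX {m n : ℕ} (a : Fin m) (i : Fin n) (b : Fin m) (j : Fin n) :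
    grassX a i * grassX b j = (-1 : ℂ) • (grassX b j * grassX a i) := by
  refine LinearMap.ext fun f => ?_
  have := ExteriorAlgebra.ι_add_mul_swap (R := ℂ) (Pi.single (a, i) 1 : Fin m × Fin n → ℂ)
    (Pi.single (b, j) 1)
  rw [add_eq_zero_iff_eq_neg] at this
  simp only [grassX, Module.End.mul_apply, LinearMap.smul_apply, LinearMap.mulLeft_apply]
  rw [← mul_assoc, this, neg_smul, one_smul, neg_mul, mul_assoc]

theorem grassD_grassD {m n : ℕ} (a : Fin m) (i : Fin n) (b : Fin m) (j : Fin n) :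
    grassD a i * grassD b j = (-1 : ℂ) • (grassD b j * grassD a i) := by
  refine LinearMap.ext fun f => ?_
  simp only [grassD, Module.End.mul_apply, LinearMap.smul_apply]
  rw [CliffordAlgebra.contractLeft_comm, neg_smul, one_smul]

theorem grassD_grassX {m n : ℕ} (a : Fin m) (i : Fin n) (b : Fin m) (j : Fin n) :
    grassD a i * grassX b j
      = (-1 : ℂ) • (grassX b j * grassD a i) + if a = b ∧ i = j then 1 else 0 := by
  refine LinearMap.ext fun f => ?_
  simp only [grassD, grassX, Module.End.mul_apply, LinearMap.smul_apply, LinearMap.add_apply,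
    LinearMap.mulLeft_apply]
  rw [ExteriorAlgebra.ι, CliffordAlgebra.contractLeft_ι_mul, neg_smul, one_smul, sub_eq_neg_add]
  congr 1
  by_cases h : a = b ∧ i = j
  · obtain ⟨rfl, rfl⟩ := h
    simp
  · have h' : ¬ (a, i) = (b, j) := by
      rw [Prod.mk.injEq]; exact h
    simp [h, h']

theorem xOp_xOp (σ : VarKind) {m n : ℕ} (a : Fin m) (i : Fin n) (b : Fin m) (j : Fin n) :
    xOp σ a i * xOp σ b j = σ.sign • (xOp σ b j * xOp σ a i) := by
  cases σ with
  | commuting => exact polyX_polyX a i b j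
  | anticommuting => exact grassX_grassX a i b j

theorem dOp_dOp (σ : VarKind) {m n : ℕ} (a : Fin m) (i : Fin n) (b : Fin m) (j : Fin n) :
    dOp σ a i * dOp σ b j = σ.sign • (dOp σ b j * dOp σ a i) := by
  cases σ with
  | commuting => exact polyD_polyD a i b j
  | anticommuting => exact grassD_grassD a i b j

theorem dOp_xOp (σ : VarKind) {m n : ℕ} (a : Fin m) (i : Fin n) (b : Fin m) (j : Fin n) :
    dOp σ a i * xOp σ b j
      = σ.sign • (xOp σ b j * dOp σ a i) + if a = b ∧ i = j then 1 else 0 := by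
  cases σ with
  | commuting => exact polyD_polyX a i b j
  | anticommuting => exact grassD_grassX a i b j

/-- The coordinates `p_ci`: `-θ x_ci` for the first `k` values of `c`, and `∂_ci` otherwise. -/
noncomputable def pOp (σ : VarKind) (k : ℕ) {m n : ℕ} (c : Fin m) (i : Fin n) :
    Module.End ℂ (Fock σ m n) :=
  if c.val < k then (-σ.sign) • xOp σ c i else dOp σ c i

/-- The coordinates `q_ci`: `∂_ci` for the first `k` values of `c`, and `x_ci` otherwise. -/
noncomputable def qOp (σ : VarKind) (k : ℕ) {m n : ℕ} (c : Fin m) (i : Fin n) :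
    Module.End ℂ (Fock σ m n) :=
  if c.val < k then dOp σ c i else xOp σ c i

theorem isOscillator (σ : VarKind) (k m n : ℕ) :
    IsOscillator (m := m) (n := n) σ.sign (pOp σ k) (qOp σ k) where
  qq a i b j := by
    have hs := σ.sign_mul_sign
    unfold qOp
    split_ifs with ha hb hb
    · exact dOp_dOp σ a i b j
    · have hab : ¬ (a = b ∧ i = j) := by rintro ⟨rfl, -⟩; exact hb ha
      rw [dOp_xOp, if_neg hab, add_zero]
    · have hab : ¬ (b = a ∧ j = i) := by rintro ⟨rfl, -⟩; exact ha hb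
      rw [dOp_xOp, if_neg hab, add_zero, smul_smul, hs, one_smul]
    · exact xOp_xOp σ a i b j
  pp a i b j := by
    have hs := σ.sign_mul_sign
    unfold pOp
    split_ifs with ha hb hb
    · simp only [smul_mul_assoc, mul_smul_comm]
      rw [xOp_xOp σ a i b j]
      simp only [smul_smul]
      congr 1; ring
    · have hab : ¬ (b = a ∧ j = i) := by rintro ⟨rfl, -⟩; exact hb ha
      rw [mul_smul_comm, smul_mul_assoc, dOp_xOp, if_neg hab, add_zero]
      simp only [smul_smul]
      congr 1
      linear_combination (σ.sign) * hs
    · have hab : ¬ (a = b ∧ i = j) := by rintro ⟨rfl, -⟩; exact ha hb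
      rw [mul_smul_comm, smul_mul_assoc, dOp_xOp, if_neg hab, add_zero]
      simp only [smul_smul]
      congr 1; ring
    · exact dOp_dOp σ a i b j
  pq a i b j := by
    have hs := σ.sign_mul_sign
    unfold pOp qOp
    by_cases ha : a.val < k <;> by_cases hb : b.val < k <;> simp only [ha, hb, if_true, if_false]
    · have hab : (if b = a ∧ j = i then (1 : Module.End ℂ (Fock σ m n)) else 0)
          = if a = b ∧ i = j then 1 else 0 := by simp only [eq_comm]
      rw [mul_smul_comm, smul_mul_assoc, dOp_xOp, hab]
      simp only [smul_add, smul_smul]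
      have e : σ.sign * (-σ.sign * σ.sign) = -σ.sign := by linear_combination (-σ.sign) * hs
      rw [e, mul_neg, hs, neg_smul, neg_smul, one_smul]
      abel
    · have hab : ¬ (a = b ∧ i = j) := by rintro ⟨rfl, -⟩; exact hb ha
      rw [if_neg hab, add_zero, smul_mul_assoc, mul_smul_comm, xOp_xOp σ a i b j]
      simp only [smul_smul]
      congr 1; ring
    · have hab : ¬ (a = b ∧ i = j) := by rintro ⟨rfl, -⟩; exact ha hb
      rw [if_neg hab, add_zero]
      exact dOp_dOp σ a i b j
    · exact dOp_xOp σ a i b j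

end Fock

/-! ### The bimodules -/

section Bimodules

/-- The Lie algebra `gl_m` of complex matrices. -/
abbrev Gl (m : ℕ) : Type := Matrix (Fin m) (Fin m) ℂ

/-- The universal enveloping algebra `U(gl_m)`. -/
abbrev UGl (m : ℕ) : Type := UniversalEnvelopingAlgebra ℂ (Gl m)

/-- The generator `E_ab` of `U(gl_m)`. -/
noncomputable def genE {m : ℕ} (a b : Fin m) : UGl m :=
  UniversalEnvelopingAlgebra.ι ℂ (Matrix.single a b (1 : ℂ) : Gl m)

theorem single_lie {m : ℕ} (a b c d : Fin m) :
    ⁅(Matrix.single a b (1 : ℂ) : Gl m), (Matrix.single c d (1 : ℂ) : Gl m)⁆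
      = (if b = c then (1 : ℂ) else 0) • Matrix.single a d (1 : ℂ)
        - (if a = d then (1 : ℂ) else 0) • Matrix.single c b (1 : ℂ) := by
  rw [LieRing.of_associative_ring_bracket]
  congr 1
  · by_cases h : b = c
    · subst h; simp
    · simp [h]
  · by_cases h : a = d
    · subst h; simp
    · have h' : ¬ d = a := fun e => h e.symm
      simp [h, h']

theorem isGlFamily_genE (m : ℕ) : IsGlFamily (genE (m := m)) := by
  intro a b c d
  have := (UniversalEnvelopingAlgebra.ι ℂ (L := Gl m)).map_lie
    (Matrix.single a b (1 : ℂ)) (Matrix.single c d (1 : ℂ))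
  rw [single_lie, map_sub, map_smul, map_smul, LieRing.of_associative_ring_bracket] at this
  simp only [genE, ← this, ite_smul, one_smul, zero_smul, ite_mul, one_mul, zero_mul]

/-- The algebra `U(gl_m) ⊗ End ℋ`, which contains `U(gl_m) ⊗ ℋ𝒟`. -/
abbrev BigAlg (σ : VarKind) (m n : ℕ) : Type := UGl m ⊗[ℂ] Module.End ℂ (Fock σ m n)

/-- The coefficient of `u ^ (-r - 1)` in the matrix `X(u) = (u + θ E')⁻¹`, where `E'` is the
transpose of the matrix with the entries `E_ab`; it is `(-θ E') ^ r`. -/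
noncomputable def coeffX (σ : VarKind) (m r : ℕ) : Matrix (Fin m) (Fin m) (UGl m) :=
  (-σ.sign) ^ r • transposeMatrix (genE (m := m)) ^ r

/-- The coefficients of `δ_ij + ∑_ab X_ab(u) ⊗ q_ai p_bj`. -/
noncomputable def alphaCoeff (σ : VarKind) (k m n : ℕ) :
    ℕ → Fin n → Fin n → BigAlg σ m n
  | 0, i, j => if i = j then 1 else 0
  | r + 1, i, j => ∑ a, ∑ b, coeffX σ m r a b ⊗ₜ[ℂ] (qOp σ k a i * pOp σ k b j)

theorem transposeMatrix_map {m : ℕ} {A B : Type*} [Ring A] [Ring B] (f : A →+* B)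
    (E : Fin m → Fin m → A) (r : ℕ) :
    transposeMatrix (fun a b => f (E a b)) ^ r = (transposeMatrix E ^ r).map f := by
  have := map_pow (RingHom.mapMatrix (m := Fin m) f) (transposeMatrix E) r
  rw [RingHom.mapMatrix_apply, RingHom.mapMatrix_apply] at this
  rw [this]
  rfl

/-- `E_ab ⊗ 1`. -/
noncomputable def bigE (σ : VarKind) (m n : ℕ) (a b : Fin m) : BigAlg σ m n :=
  (Algebra.TensorProduct.includeLeft : UGl m →ₐ[ℂ] BigAlg σ m n).toRingHom (genE a b)

/-- `1 ⊗ p_ai`. -/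
noncomputable def bigP (σ : VarKind) (k m n : ℕ) (a : Fin m) (i : Fin n) : BigAlg σ m n :=
  (1 : UGl m) ⊗ₜ[ℂ] pOp σ k a i

/-- `1 ⊗ q_ai`. -/
noncomputable def bigQ (σ : VarKind) (k m n : ℕ) (a : Fin m) (i : Fin n) : BigAlg σ m n :=
  (1 : UGl m) ⊗ₜ[ℂ] qOp σ k a i

theorem isGlFamily_bigE (σ : VarKind) (m n : ℕ) : IsGlFamily (bigE σ m n) := by
  intro a b c d
  have := congrArg (Algebra.TensorProduct.includeLeft : UGl m →ₐ[ℂ] BigAlg σ m n).toRingHom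
    (isGlFamily_genE m a b c d)
  rw [map_sub, map_sub, map_mul, map_mul, map_mul, map_mul] at this
  refine this.trans ?_
  congr 1
  · congr 1
    split_ifs
    · exact map_one _
    · exact map_zero _
  · congr 1
    split_ifs
    · exact map_one _
    · exact map_zero _

theorem isOscillator_big (σ : VarKind) (k m n : ℕ) :
    IsOscillator σ.sign (bigP σ k m n) (bigQ σ k m n) := by
  have h := isOscillator σ k m n
  refine ⟨fun a i b j => ?_, fun a i b j => ?_, fun a i b j => ?_⟩
  · simp only [bigQ, Algebra.TensorProduct.tmul_mul_tmul, mul_one, ← TensorProduct.tmul_smul]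
    rw [h.qq]
  · simp only [bigP, Algebra.TensorProduct.tmul_mul_tmul, mul_one, ← TensorProduct.tmul_smul]
    rw [h.pp]
  · simp only [bigP, bigQ, Algebra.TensorProduct.tmul_mul_tmul, mul_one,
      ← TensorProduct.tmul_smul]
    rw [h.pq, TensorProduct.tmul_add]
    congr 1
    split_ifs
    · rfl
    · exact TensorProduct.tmul_zero _ _

theorem bigE_pow (σ : VarKind) (m n r : ℕ) (a b : Fin m) :
    (transposeMatrix (bigE σ m n) ^ r) a b
      = (transposeMatrix (genE (m := m)) ^ r) a b ⊗ₜ[ℂ] 1 := by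
  have := transposeMatrix_map
    (Algebra.TensorProduct.includeLeft : UGl m →ₐ[ℂ] BigAlg σ m n).toRingHom (genE (m := m)) r
  exact congrFun (congrFun this a) b

theorem bigE_pow_commute (σ : VarKind) (k m n r : ℕ) (a b c : Fin m) (i : Fin n) (d : Fin m)
    (j : Fin n) :
    Commute ((transposeMatrix (bigE σ m n) ^ r) a b) (bigQ σ k m n c i * bigP σ k m n d j) := by
  rw [bigE_pow]
  simp [bigQ, bigP, Commute, SemiconjBy]

theorem alphaCoeff_eq (σ : VarKind) (k m n : ℕ) :
    alphaCoeff σ k m n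
      = alphaFamily σ.sign (bigE σ m n) (bigP σ k m n) (bigQ σ k m n) := by
  funext r i j
  cases r with
  | zero => rfl
  | succ r =>
    simp only [alphaCoeff, alphaFamily, contract, coeffX]
    refine Finset.sum_congr rfl fun a _ => Finset.sum_congr rfl fun b _ => ?_
    rw [Matrix.smul_apply, Matrix.smul_apply, bigE_pow]
    simp [bigQ, bigP, TensorProduct.smul_tmul']

/-- The homomorphism `α_m : Y(gl_n) → U(gl_m) ⊗ ℋ𝒟`,
`T_ij(u) ↦ δ_ij + ∑_ab X_ab(u) ⊗ q_ai p_bj`, for the coordinates `p`, `q` that are flipped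
for the first `k` values of the first index. -/
noncomputable def alpha (σ : VarKind) (k m n : ℕ) : Yangian n →ₐ[ℂ] BigAlg σ m n :=
  Yangian.lift (alphaCoeff σ k m n) (by
    rw [alphaCoeff_eq]
    exact isYangianFamily_alpha (isGlFamily_bigE σ m n) (isOscillator_big σ k m n)
      σ.sign_mul_sign (bigE_pow_commute σ k m n))

/-- The element `ζ_n(E_ab) = θ δ_ab n / 2 + ∑_k q_ak p_bk`. -/
noncomputable def zetaGen (σ : VarKind) (k m n : ℕ) (a b : Fin m) :
    Module.End ℂ (Fock σ m n) :=
  (if a = b then σ.sign * (n / 2 : ℂ) else 0) • 1 + ∑ i : Fin n, qOp σ k a i * pOp σ k b i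

theorem zetaGen_comm (σ : VarKind) (k m n : ℕ) (a b c d : Fin m) :
    zetaGen σ k m n a b * zetaGen σ k m n c d - zetaGen σ k m n c d * zetaGen σ k m n a b
      = (if b = c then (1 : ℂ) else 0) • zetaGen σ k m n a d
        - (if a = d then (1 : ℂ) else 0) • zetaGen σ k m n c b := by
  have h := isOscillator σ k m n
  have key : (∑ i : Fin n, qOp σ k a i * pOp σ k b i) * (∑ i : Fin n, qOp σ k c i * pOp σ k d i)
      - (∑ i : Fin n, qOp σ k c i * pOp σ k d i) * (∑ i : Fin n, qOp σ k a i * pOp σ k b i)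
      = (if b = c then (1 : ℂ) else 0) • (∑ i : Fin n, qOp σ k a i * pOp σ k d i)
        - (if a = d then (1 : ℂ) else 0) • (∑ i : Fin n, qOp σ k c i * pOp σ k b i) := by
    rw [Finset.sum_mul_sum, Finset.sum_mul_sum,
      Finset.sum_comm (f := fun i j => qOp σ k c i * pOp σ k d i * (qOp σ k a j * pOp σ k b j))]
    simp only [← Finset.sum_sub_distrib]
    rw [Finset.sum_congr rfl fun i _ => Finset.sum_congr rfl fun j _ =>
      h.rel1 σ.sign_mul_sign a i b i c j d j]
    simp only [Finset.sum_sub_distrib]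
    congr 1
    · by_cases hbc : b = c <;> simp [hbc]
    · by_cases had : a = d <;> simp [had]
  have e : ∀ (x y : ℂ) (S T : Module.End ℂ (Fock σ m n)),
      (x • 1 + S) * (y • 1 + T) - (y • 1 + T) * (x • 1 + S) = S * T - T * S := by
    intro x y S T
    simp only [add_mul, mul_add, smul_mul_assoc, mul_smul_comm, one_mul, mul_one, smul_add]
    rw [smul_comm x y]
    abel
  unfold zetaGen
  rw [e, key]
  by_cases hbc : b = c <;> by_cases had : a = d
  · subst hbc had; simp
  · subst hbc; simp [had]
  · subst had
    have hbc' : ¬ c = b := fun e => hbc e.symm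
    simp [hbc, hbc']
  · simp [hbc, had]

theorem lie_of_single {m : ℕ} {A : Type*} [Ring A] [Algebra ℂ A] (f : Gl m →ₗ[ℂ] A)
    (h : ∀ a b c d, f (Matrix.single a b 1) * f (Matrix.single c d 1)
      - f (Matrix.single c d 1) * f (Matrix.single a b 1)
      = (if b = c then (1 : ℂ) else 0) • f (Matrix.single a d 1)
        - (if a = d then (1 : ℂ) else 0) • f (Matrix.single c b 1))
    (X Y : Gl m) : f ⁅X, Y⁆ = f X * f Y - f Y * f X := by
  have hs : ∀ (a b : Fin m) (x : ℂ),
      (Matrix.single a b x : Gl m) = x • Matrix.single a b (1 : ℂ) := by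
    intro a b x; simp
  induction X using Matrix.induction_on' with
  | h_zero => simp
  | h_add X X' hX hX' =>
    rw [add_lie, map_add, hX, hX', map_add]
    noncomm_ring
  | h_std_basis a b x =>
    induction Y using Matrix.induction_on' with
    | h_zero => simp
    | h_add Y Y' hY hY' =>
      rw [lie_add, map_add, hY, hY', map_add]
      noncomm_ring
    | h_std_basis c d y =>
      rw [hs a b x, hs c d y, smul_lie, lie_smul, single_lie]
      rw [map_smul, map_smul, map_sub, map_smul, map_smul, ← h, map_smul, map_smul,
        smul_mul_smul_comm, smul_mul_smul_comm, smul_smul, mul_comm y x, smul_sub]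

/-- The homomorphism `ζ_n : gl_m → ℋ𝒟`. -/
noncomputable def zeta (σ : VarKind) (k m n : ℕ) :
    Gl m →ₗ⁅ℂ⁆ Module.End ℂ (Fock σ m n) where
  toFun X := ∑ a, ∑ b, X a b • zetaGen σ k m n a b
  map_add' X Y := by simp [add_smul, Finset.sum_add_distrib]
  map_smul' c X := by simp [Finset.smul_sum, mul_smul]
  map_lie' {X Y} := by
    let f : Gl m →ₗ[ℂ] Module.End ℂ (Fock σ m n) :=
      { toFun := fun X => ∑ a, ∑ b, X a b • zetaGen σ k m n a b
        map_add' := fun X Y => by simp [add_smul, Finset.sum_add_distrib]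
        map_smul' := fun c X => by simp [Finset.smul_sum, mul_smul] }
    have hf : ∀ a b, f (Matrix.single a b 1) = zetaGen σ k m n a b := by
      intro a b
      change ∑ a', ∑ b', (Matrix.single a b (1 : ℂ)) a' b' • zetaGen σ k m n a' b' = _
      rw [Finset.sum_eq_single a, Finset.sum_eq_single b]
      · simp
      · intro b' _ hb; simp [hb.symm]
      · simp
      · intro a' _ ha; simp [ha.symm]
      · simp
    refine lie_of_single f (fun a b c d => ?_) X Y
    simp only [hf]
    exact zetaGen_comm σ k m n a b c d

theorem zeta_apply (σ : VarKind) (k m n : ℕ) (X : Gl m) :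
    zeta σ k m n X = ∑ a, ∑ b, X a b • zetaGen σ k m n a b := rfl

/-- The embedding `gl_m → U(gl_m) ⊗ ℋ𝒟`, `E_ab ↦ E_ab ⊗ 1 + 1 ⊗ ζ_n(E_ab)`. -/
noncomputable def glEmb (σ : VarKind) (k m n : ℕ) : Gl m →ₗ⁅ℂ⁆ BigAlg σ m n where
  toFun X := UniversalEnvelopingAlgebra.ι ℂ X ⊗ₜ[ℂ] 1 + 1 ⊗ₜ[ℂ] zeta σ k m n X
  map_add' X Y := by
    rw [map_add, map_add, TensorProduct.add_tmul, TensorProduct.tmul_add]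
    abel
  map_smul' c X := by
    rw [map_smul, map_smul, TensorProduct.tmul_smul, ← TensorProduct.smul_tmul', smul_add]
    rfl
  map_lie' {X Y} := by
    rw [LieHom.map_lie, LieHom.map_lie]
    simp only [LieRing.of_associative_ring_bracket, add_mul, mul_add,
      Algebra.TensorProduct.tmul_mul_tmul, one_mul, mul_one, TensorProduct.sub_tmul,
      TensorProduct.tmul_sub]
    abel

theorem ι_eq_sum {m : ℕ} (X : Gl m) :
    UniversalEnvelopingAlgebra.ι ℂ X = ∑ a, ∑ b, X a b • genE a b := by
  conv_lhs => rw [Matrix.matrix_eq_sum_single X]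
  simp only [map_sum]
  refine Finset.sum_congr rfl fun a _ => Finset.sum_congr rfl fun b _ => ?_
  rw [genE, ← map_smul, Matrix.smul_single, smul_eq_mul, mul_one]

theorem alpha_commute (σ : VarKind) (k m n : ℕ) (y : Yangian n) (X : Gl m) :
    Commute (alpha σ k m n y) (glEmb σ k m n X) := by
  refine Yangian.commute_of_T (alpha σ k m n) (glEmb σ k m n X) (fun r i j => ?_) y
  rw [alpha, Yangian.lift_T, alphaCoeff_eq]
  have hX : glEmb σ k m n X = ∑ a, ∑ b, X a b • (bigE σ m n a b
      + ∑ i, bigQ σ k m n a i * bigP σ k m n b i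
      + (if a = b then σ.sign * (n / 2 : ℂ) else 0) • 1) := by
    change UniversalEnvelopingAlgebra.ι ℂ X ⊗ₜ[ℂ] 1 + 1 ⊗ₜ[ℂ] zeta σ k m n X = _
    rw [ι_eq_sum, zeta_apply, TensorProduct.sum_tmul, TensorProduct.tmul_sum,
      ← Finset.sum_add_distrib]
    refine Finset.sum_congr rfl fun a _ => ?_
    rw [TensorProduct.sum_tmul, TensorProduct.tmul_sum, ← Finset.sum_add_distrib]
    refine Finset.sum_congr rfl fun b _ => ?_
    rw [TensorProduct.tmul_smul, ← TensorProduct.smul_tmul', ← smul_add]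
    congr 1
    rw [zetaGen, TensorProduct.tmul_add, TensorProduct.tmul_smul, TensorProduct.tmul_sum,
      add_assoc, add_comm (_ • _) (Finset.sum _ _)]
    simp only [bigQ, bigP, Algebra.TensorProduct.tmul_mul_tmul, mul_one]
    rfl
  rw [hX]
  refine Commute.sum_right _ _ _ fun a _ => Commute.sum_right _ _ _ fun b _ => ?_
  refine (Commute.add_right ?_ ((Commute.one_right _).smul_right _)).smul_right _
  cases r with
  | zero =>
    simp only [alphaFamily]
    split_ifs
    · exact Commute.one_left _
    · exact Commute.zero_left _
  | succ r =>
    rw [alphaFamily, contract_smul]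
    exact (commute_contract (isGlFamily_bigE σ m n) (isOscillator_big σ k m n)
      σ.sign_mul_sign (bigE_pow_commute σ k m n) r i j a b).smul_left _

/-- A bimodule over the Yangian `Y(gl_n)` and a Lie algebra `L`: a vector space with commuting
actions of the two algebras. -/
structure YBimodule (n : ℕ) (L : Type) [LieRing L] [LieAlgebra ℂ L] : Type (u + 1) where
  carrier : Type u
  [addCommGroup : AddCommGroup carrier]
  [module : Module ℂ carrier]
  yangian : Yangian n →ₐ[ℂ] Module.End ℂ carrier
  lie : L →ₗ⁅ℂ⁆ Module.End ℂ carrier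
  commute : ∀ y x, Commute (yangian y) (lie x)

attribute [instance] YBimodule.addCommGroup YBimodule.module

/-- An isomorphism of bimodules. -/
structure YBimodule.Iso {n : ℕ} {L : Type} [LieRing L] [LieAlgebra ℂ L]
    (M : YBimodule.{u} n L) (N : YBimodule.{v} n L) where
  toLinearEquiv : M.carrier ≃ₗ[ℂ] N.carrier
  map_yangian : ∀ y w, toLinearEquiv (M.yangian y w) = N.yangian y (toLinearEquiv w)
  map_lie : ∀ x w, toLinearEquiv (M.lie x w) = N.lie x (toLinearEquiv w)

/-- The action of `U(gl_m) ⊗ End ℋ` on `V ⊗ ℋ`. -/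
noncomputable def bigAction (σ : VarKind) (m n : ℕ) (V : Type u) [AddCommGroup V] [Module ℂ V]
    [LieRingModule (Gl m) V] [LieModule ℂ (Gl m) V] :
    BigAlg σ m n →ₐ[ℂ] Module.End ℂ (V ⊗[ℂ] Fock σ m n) :=
  (Module.endTensorEndAlgHom (R := ℂ) (S := ℂ) (A := ℂ)).comp
    (Algebra.TensorProduct.map
      (UniversalEnvelopingAlgebra.lift ℂ (LieModule.toEnd ℂ (Gl m) V)) (AlgHom.id ℂ _))

/-- The action of `gl_m` on `V ⊗ ℋ`. -/
noncomputable def glAction (σ : VarKind) (k m n : ℕ) (V : Type u) [AddCommGroup V] [Module ℂ V]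
    [LieRingModule (Gl m) V] [LieModule ℂ (Gl m) V] :
    Gl m →ₗ⁅ℂ⁆ Module.End ℂ (V ⊗[ℂ] Fock σ m n) :=
  (AlgHom.toLieHom (bigAction σ m n V)).comp (glEmb σ k m n)

/-- The bimodule `ℰ_{p,q}(V) = V ⊗ ℋ` of a `gl_m`-module `V`, where `m = p + q`. -/
noncomputable def Epq (σ : VarKind) (n p q : ℕ) {m : ℕ} (_h : m = p + q) (V : Type u)
    [AddCommGroup V] [Module ℂ V] [LieRingModule (Gl m) V] [LieModule ℂ (Gl m) V] :
    YBimodule.{u} n (Gl m) where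
  carrier := V ⊗[ℂ] Fock σ m n
  yangian := (bigAction σ m n V).comp (alpha σ p m n)
  lie := glAction σ p m n V
  commute := fun y X => (alpha_commute σ p m n y X).map (bigAction σ m n V)

/-- The pull-back of the Yangian action through `τ_z : T_ij(u) ↦ T_ij(u - z)`. -/
noncomputable def YBimodule.pullTau {n : ℕ} {L : Type} [LieRing L] [LieAlgebra ℂ L]
    (M : YBimodule.{u} n L) (z : ℂ) : YBimodule.{u} n L where
  carrier := M.carrier
  yangian := M.yangian.comp (Yangian.tau n z)
  lie := M.lie
  commute _ x := M.commute _ x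

/-- The bimodule `ℰ_{p,q}^z(V)`: `T_ij(u)` acts as `T_ij(u - θ z)` acts on `ℰ_{p,q}(V)`. -/
noncomputable def EpqShift (σ : VarKind) (n p q : ℕ) {m : ℕ} (h : m = p + q) (z : ℂ) (V : Type u)
    [AddCommGroup V] [Module ℂ V] [LieRingModule (Gl m) V] [LieModule ℂ (Gl m) V] :
    YBimodule.{u} n (Gl m) :=
  (Epq σ n p q h V).pullTau (σ.sign * z)

/-- The tensor product of two bimodules: the Yangian acts through the comultiplication, and the
two Lie algebras act on the two factors. -/
noncomputable def YBimodule.tensor {n : ℕ} {L₁ L₂ : Type} [LieRing L₁] [LieAlgebra ℂ L₁]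
    [LieRing L₂] [LieAlgebra ℂ L₂] (M : YBimodule.{u} n L₁) (N : YBimodule.{v} n L₂) :
    YBimodule.{max u v} n (L₁ × L₂) where
  carrier := M.carrier ⊗[ℂ] N.carrier
  yangian := ((Module.endTensorEndAlgHom (R := ℂ) (S := ℂ) (A := ℂ)).comp
    (Algebra.TensorProduct.map M.yangian N.yangian)).comp (Yangian.comul n)
  lie :=
    { toFun := fun x => (M.lie x.1).rTensor N.carrier + (N.lie x.2).lTensor M.carrier
      map_add' := fun x y => by
        simp only [Prod.fst_add, Prod.snd_add, map_add, LinearMap.rTensor_add,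
          LinearMap.lTensor_add]
        abel
      map_smul' := fun c x => by
        simp only [Prod.smul_fst, Prod.smul_snd, map_smul, LinearMap.rTensor_smul,
          LinearMap.lTensor_smul, smul_add, RingHom.id_apply]
      map_lie' := fun {x y} => by
        refine TensorProduct.ext' fun v w => ?_
        simp only [LieAlgebra.Prod.bracket_apply, LieHom.map_lie,
          LieRing.of_associative_ring_bracket, LinearMap.add_apply, LinearMap.sub_apply,
          Module.End.mul_apply, LinearMap.rTensor_tmul, LinearMap.lTensor_tmul, map_add,
          TensorProduct.sub_tmul, TensorProduct.tmul_sub]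
        abel }
  commute y x := by
    have key : ∀ t : Yangian n ⊗[ℂ] Yangian n,
        Commute (Module.endTensorEndAlgHom (R := ℂ) (S := ℂ) (A := ℂ)
          (Algebra.TensorProduct.map M.yangian N.yangian t))
          ((M.lie x.1).rTensor N.carrier + (N.lie x.2).lTensor M.carrier) := by
      intro t
      induction t using TensorProduct.induction_on with
      | zero => rw [map_zero, map_zero]; exact Commute.zero_left _
      | add s t hs ht => rw [map_add, map_add]; exact hs.add_left ht
      | tmul a b =>
        refine TensorProduct.ext' fun v w => ?_
        have h1 := LinearMap.congr_fun (M.commute a x.1).eq v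
        have h2 := LinearMap.congr_fun (N.commute b x.2).eq w
        simp only [Module.End.mul_apply] at h1 h2
        simp only [Module.End.mul_apply, Algebra.TensorProduct.map_tmul, LinearMap.add_apply,
          Module.endTensorEndAlgHom_apply, map_add, LinearMap.rTensor_tmul,
          LinearMap.lTensor_tmul, TensorProduct.AlgebraTensorModule.map_tmul, h1, h2]
    exact key _


/-- The action of an associative algebra that is induced on a quotient by a stable subspace. -/
noncomputable def quotAlgHom {A : Type} {W : Type u} [Ring A] [Algebra ℂ A] [AddCommGroup W]
    [Module ℂ W] (f : A →ₐ[ℂ] Module.End ℂ W) (N : Submodule ℂ W)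
    (h : ∀ a, N ≤ N.comap (f a)) : A →ₐ[ℂ] Module.End ℂ (W ⧸ N) :=
  AlgHom.ofLinearMap
    { toFun := fun a => N.mapQ N (f a) (h a)
      map_add' := fun a b => Submodule.linearMap_qext _ (LinearMap.ext fun w => by simp)
      map_smul' := fun c a => Submodule.linearMap_qext _ (LinearMap.ext fun w => by simp) }
    (Submodule.linearMap_qext _ (LinearMap.ext fun w => by simp))
    (fun a b => Submodule.linearMap_qext _ (LinearMap.ext fun w => by simp))

/-- The action of a Lie algebra that is induced on a quotient by a stable subspace. -/
noncomputable def quotLieHom {L : Type} {W : Type u} [LieRing L] [LieAlgebra ℂ L] [AddCommGroup W]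
    [Module ℂ W] (f : L →ₗ⁅ℂ⁆ Module.End ℂ W) (N : Submodule ℂ W)
    (h : ∀ x, N ≤ N.comap (f x)) : L →ₗ⁅ℂ⁆ Module.End ℂ (W ⧸ N) where
  toFun x := N.mapQ N (f x) (h x)
  map_add' x y := Submodule.linearMap_qext _ (LinearMap.ext fun w => by simp)
  map_smul' c x := Submodule.linearMap_qext _ (LinearMap.ext fun w => by simp)
  map_lie' {x y} := Submodule.linearMap_qext _ (LinearMap.ext fun w => by
    simp [LieRing.of_associative_ring_bracket])

/-! ### Parabolic induction and coinvariants -/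

/-- The embedding of `gl_m ⊕ gl_l` into `gl_{m+l}` as block diagonal matrices. -/
noncomputable def leviEmb (m l : ℕ) : (Gl m × Gl l) →ₗ⁅ℂ⁆ Gl (m + l) where
  toFun x := Matrix.reindex finSumFinEquiv finSumFinEquiv (Matrix.fromBlocks x.1 0 0 x.2)
  map_add' x y := by
    have : Matrix.fromBlocks (x + y).1 0 0 (x + y).2
        = Matrix.fromBlocks x.1 0 0 x.2 + Matrix.fromBlocks y.1 0 0 y.2 := by
      simp [Matrix.fromBlocks_add]
    rw [this]
    rfl
  map_smul' c x := by
    have : Matrix.fromBlocks (c • x).1 0 0 (c • x).2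
        = c • Matrix.fromBlocks x.1 0 0 x.2 := by
      simp [Matrix.fromBlocks_smul]
    rw [this]
    rfl
  map_lie' {x y} := by
    have : Matrix.fromBlocks ⁅x, y⁆.1 0 0 ⁅x, y⁆.2
        = ⁅Matrix.fromBlocks x.1 0 0 x.2, Matrix.fromBlocks y.1 0 0 y.2⁆ := by
      rw [LieAlgebra.Prod.bracket_apply]
      simp [LieRing.of_associative_ring_bracket, Matrix.fromBlocks_multiply,
        sub_eq_add_neg, Matrix.fromBlocks_neg, Matrix.fromBlocks_add]
    rw [this]
    exact (Matrix.reindexLieEquiv finSumFinEquiv).map_lie _ _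

/-- The Abelian subalgebra `𝔮` of `gl_{m+l}`, spanned by the `E_ba` with `a ≤ m < b`, as a
subspace: the matrices supported in the lower left block. -/
def nilQ (m l : ℕ) : Submodule ℂ (Gl (m + l)) where
  carrier := {X | (∀ a j, X (Fin.castAdd l a) j = 0) ∧ ∀ i b, X i (Fin.natAdd m b) = 0}
  zero_mem' := ⟨fun _ _ => rfl, fun _ _ => rfl⟩
  add_mem' := fun {X Y} hX hY => ⟨fun a j => by simp [hX.1 a j, hY.1 a j],
    fun i b => by simp [hX.2 i b, hY.2 i b]⟩
  smul_mem' := fun c X hX => ⟨fun a j => by simp [hX.1 a j], fun i b => by simp [hX.2 i b]⟩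

/-- The maximal parabolic subalgebra `𝔭 = gl_m ⊕ gl_l ⊕ 𝔮'` of `gl_{m+l}`: the block upper
triangular matrices. -/
def parabolic (m l : ℕ) : LieSubalgebra ℂ (Gl (m + l)) where
  carrier := {X | ∀ a b, X (Fin.natAdd m b) (Fin.castAdd l a) = 0}
  zero_mem' := fun _ _ => rfl
  add_mem' := fun {X Y} hX hY a b => by simp [hX a b, hY a b]
  smul_mem' := fun c X hX a b => by simp [hX a b]
  lie_mem' := fun {X Y} hX hY a b => by
    have hX' : ∀ a b, X (Fin.natAdd m b) (Fin.castAdd l a) = 0 := hX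
    have hY' : ∀ a b, Y (Fin.natAdd m b) (Fin.castAdd l a) = 0 := hY
    simp [LieRing.of_associative_ring_bracket, Matrix.mul_apply, Fin.sum_univ_add, hX', hY']

/-- The projection of `𝔭` to `gl_m ⊕ gl_l` along `𝔮'`. -/
def parabolicProj (m l : ℕ) : parabolic m l →ₗ⁅ℂ⁆ (Gl m × Gl l) where
  toFun X := (X.1.submatrix (Fin.castAdd l) (Fin.castAdd l),
    X.1.submatrix (Fin.natAdd m) (Fin.natAdd m))
  map_add' X Y := rfl
  map_smul' c X := rfl
  map_lie' {X Y} := by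
    have hX : ∀ a b, X.1 (Fin.natAdd m b) (Fin.castAdd l a) = 0 := X.2
    have hY : ∀ a b, Y.1 (Fin.natAdd m b) (Fin.castAdd l a) = 0 := Y.2
    refine Prod.ext (Matrix.ext fun a b => ?_) (Matrix.ext fun a b => ?_) <;>
    simp [LieRing.of_associative_ring_bracket, Matrix.mul_apply, Fin.sum_univ_add, hX, hY]

section Induction

variable (m l : ℕ) (V : Type u) (U : Type v) [AddCommGroup V] [Module ℂ V]
  [LieRingModule (Gl m) V] [LieModule ℂ (Gl m) V] [AddCommGroup U] [Module ℂ U]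
  [LieRingModule (Gl l) U] [LieModule ℂ (Gl l) U]

/-- The action of `gl_m ⊕ gl_l` on `V ⊗ U`. -/
noncomputable def leviAction : (Gl m × Gl l) →ₗ⁅ℂ⁆ Module.End ℂ (V ⊗[ℂ] U) where
  toFun x := (LieModule.toEnd ℂ (Gl m) V x.1).rTensor U + (LieModule.toEnd ℂ (Gl l) U x.2).lTensor V
  map_add' x y := by
    simp only [Prod.fst_add, Prod.snd_add, map_add, LinearMap.rTensor_add, LinearMap.lTensor_add]
    abel
  map_smul' c x := by
    simp only [Prod.smul_fst, Prod.smul_snd, map_smul, LinearMap.rTensor_smul,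
      LinearMap.lTensor_smul, smul_add, RingHom.id_apply]
  map_lie' {x y} := by
    refine TensorProduct.ext' fun v w => ?_
    rw [LieAlgebra.Prod.bracket_apply]
    simp only [LieHom.map_lie]
    simp only [LieRing.of_associative_ring_bracket, LinearMap.add_apply, LinearMap.sub_apply,
      Module.End.mul_apply, LinearMap.rTensor_tmul, LinearMap.lTensor_tmul, map_add,
      TensorProduct.sub_tmul, TensorProduct.tmul_sub]
    abel

/-- The relations `x ⊗ w - 1 ⊗ x w`, `x ∈ 𝔭`, which generate the kernel of
`U(gl_{m+l}) ⊗_ℂ (V ⊗ U) → U(gl_{m+l}) ⊗_{U(𝔭)} (V ⊗ U)` as a left `U(gl_{m+l})`-module;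
here `𝔮' ⊆ 𝔭` acts on `V ⊗ U` by zero. -/
noncomputable def inducedRel : Submodule (UGl (m + l)) (UGl (m + l) ⊗[ℂ] (V ⊗[ℂ] U)) :=
  Submodule.span (UGl (m + l))
    {t | ∃ (x : parabolic m l) (w : V ⊗[ℂ] U),
      t = UniversalEnvelopingAlgebra.ι ℂ (x : Gl (m + l)) ⊗ₜ[ℂ] w
        - 1 ⊗ₜ[ℂ] leviAction m l V U (parabolicProj m l x) w}

/-- The parabolically induced module `V ⊠ U = U(gl_{m+l}) ⊗_{U(𝔭)} (V ⊗ U)`. -/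
def ParInd : Type (max u v) :=
  (UGl (m + l) ⊗[ℂ] (V ⊗[ℂ] U)) ⧸ inducedRel m l V U

noncomputable instance : AddCommGroup (ParInd m l V U) :=
  inferInstanceAs (AddCommGroup ((UGl (m + l) ⊗[ℂ] (V ⊗[ℂ] U)) ⧸ inducedRel m l V U))

noncomputable instance : Module (UGl (m + l)) (ParInd m l V U) :=
  inferInstanceAs (Module (UGl (m + l)) ((UGl (m + l) ⊗[ℂ] (V ⊗[ℂ] U)) ⧸ inducedRel m l V U))

noncomputable instance : Module ℂ (ParInd m l V U) :=
  inferInstanceAs (Module ℂ ((UGl (m + l) ⊗[ℂ] (V ⊗[ℂ] U)) ⧸ inducedRel m l V U))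

instance : IsScalarTower ℂ (UGl (m + l)) (ParInd m l V U) :=
  inferInstanceAs
    (IsScalarTower ℂ (UGl (m + l)) ((UGl (m + l) ⊗[ℂ] (V ⊗[ℂ] U)) ⧸ inducedRel m l V U))

noncomputable instance : LieRingModule (Gl (m + l)) (ParInd m l V U) where
  bracket X w := UniversalEnvelopingAlgebra.ι ℂ X • w
  add_lie X Y w := by
    change UniversalEnvelopingAlgebra.ι ℂ (X + Y) • w = _
    rw [map_add, add_smul]
  lie_add X w w' := smul_add _ _ _
  leibniz_lie X Y w := by
    change UniversalEnvelopingAlgebra.ι ℂ X • UniversalEnvelopingAlgebra.ι ℂ Y • w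
      = UniversalEnvelopingAlgebra.ι ℂ ⁅X, Y⁆ • w
        + UniversalEnvelopingAlgebra.ι ℂ Y • UniversalEnvelopingAlgebra.ι ℂ X • w
    rw [LieHom.map_lie, LieRing.of_associative_ring_bracket, sub_smul, mul_smul, mul_smul]
    abel

instance : LieModule ℂ (Gl (m + l)) (ParInd m l V U) where
  smul_lie c X w := by
    change UniversalEnvelopingAlgebra.ι ℂ (c • X) • w = c • UniversalEnvelopingAlgebra.ι ℂ X • w
    rw [map_smul, smul_assoc]
  lie_smul c X w := by
    change UniversalEnvelopingAlgebra.ι ℂ X • c • w = c • UniversalEnvelopingAlgebra.ι ℂ X • w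
    rw [← algebraMap_smul (UGl (m + l)) c w, ← algebraMap_smul (UGl (m + l)) c (_ • w),
      ← mul_smul, ← mul_smul, Algebra.commutes]

end Induction

/-- The subspace `𝔮 · W`. -/
def YBimodule.qSub {n m l : ℕ} (W : YBimodule.{u} n (Gl (m + l))) : Submodule ℂ W.carrier :=
  Submodule.span ℂ {w | ∃ X ∈ nilQ m l, ∃ v, w = W.lie X v}

theorem levi_lie_nilQ {m l : ℕ} (x : Gl m × Gl l) {X : Gl (m + l)} (hX : X ∈ nilQ m l) :
    ⁅leviEmb m l x, X⁆ ∈ nilQ m l := by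
  have h1 : ∀ a j, X (Fin.castAdd l a) j = 0 := hX.1
  have h2 : ∀ i b, X i (Fin.natAdd m b) = 0 := hX.2
  have e1 : ∀ a b, leviEmb m l x (Fin.castAdd l a) (Fin.natAdd m b) = 0 := by
    intro a b; simp [leviEmb]
  refine ⟨fun a j => ?_, fun i b => ?_⟩
  · simp [LieRing.of_associative_ring_bracket, Matrix.mul_apply, Fin.sum_univ_add, h1, e1]
  · simp [LieRing.of_associative_ring_bracket, Matrix.mul_apply, Fin.sum_univ_add, h2, e1]

/-- The coinvariants `W_𝔮 = W / 𝔮 W` of a bimodule over `Y(gl_n)` and `gl_{m+l}`, as a bimodule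
over `Y(gl_n)` and `gl_m ⊕ gl_l`. -/
noncomputable def YBimodule.coinvariants {n : ℕ} (m l : ℕ) (W : YBimodule.{u} n (Gl (m + l))) :
    YBimodule.{u} n (Gl m × Gl l) where
  carrier := W.carrier ⧸ W.qSub
  yangian := quotAlgHom W.yangian W.qSub (by
    intro y
    rw [YBimodule.qSub, Submodule.span_le]
    rintro _ ⟨X, hX, v, rfl⟩
    refine Submodule.subset_span ⟨X, hX, W.yangian y v, ?_⟩
    exact LinearMap.congr_fun (W.commute y X).eq v)
  lie := quotLieHom (W.lie.comp (leviEmb m l)) W.qSub (by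
    intro x
    rw [YBimodule.qSub, Submodule.span_le]
    rintro _ ⟨X, hX, v, rfl⟩
    have e : W.lie (leviEmb m l x) (W.lie X v)
        = W.lie ⁅leviEmb m l x, X⁆ v + W.lie X (W.lie (leviEmb m l x) v) := by
      rw [LieHom.map_lie, LieRing.of_associative_ring_bracket, LinearMap.sub_apply,
        Module.End.mul_apply, Module.End.mul_apply, sub_add_cancel]
    change W.lie (leviEmb m l x) (W.lie X v) ∈ Submodule.span ℂ _
    rw [e]
    exact add_mem (Submodule.subset_span ⟨_, levi_lie_nilQ x hX, v, rfl⟩)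
      (Submodule.subset_span ⟨X, hX, _, rfl⟩))
  commute y x := by
    refine Submodule.linearMap_qext _ (LinearMap.ext fun w => ?_)
    have := LinearMap.congr_fun (W.commute y (leviEmb m l x)).eq w
    exact congrArg (Submodule.Quotient.mk (p := W.qSub)) this

end Bimodules

end RatYangian

open RatYangian

/-!
Both isomorphisms are instances of one statement about two blocks of `k` and `l` indices,
`nonempty_iso_coinvariants`; only the roles of variables and derivations differ.

*The vector spaces.* By the Poincaré-Birkhoff-Witt theorem `V ⊠ U` is `U(𝔮) ⊗ (V ⊗ U)` with `U(𝔮)`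
a polynomial algebra, so the coinvariants of `(V ⊠ U) ⊗ ℋ` are `(V ⊗ U) ⊗ ℋ`. Instead of the general
theorem, an explicit action of `gl_{k+l}` by differential operators on `ℂ[y] ⊗ (V ⊗ U)` is used
(`modelLie`). It receives a map from `V ⊠ U` and thereby provides a left inverse of the map
`(V ⊗ U) ⊗ ℋ → ((V ⊠ U) ⊗ ℋ)_𝔮` (`coinvIncl_injective`); surjectivity is easy
(`coinvIncl_surjective`). The Fock space `ℋ` of `k + l` rows of variables is the tensor product of
the Fock spaces of the two blocks, with a sign in the Grassmann case that does not affect the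
quadratic operators `q p` (`IsFockSplitting`). This gives the isomorphism, and its compatibility
with `gl_k ⊕ gl_l` is immediate (`IsFockSplitting.coinvIncl_lie`).

*The Yangian.* Write `A(u)` for the matrix `X(u)` of `gl_k` acting on `V`, and `B(u)` for the matrix
`X(u - θ k)` of `gl_l` acting on `U`. On `V ⊗ U ⊆ V ⊠ U` the blocks of `X(u)` for `gl_{k+l}` are
computed by induction on the power of `u⁻¹`, moving `𝔮` to the left:

* the upper left block is `A(u)` and the lower left block is `0`
  (`coeffX_left_left`, `coeffX_right_left`);
* the upper right entries are `X_ad(u) = - θ ∑_{b,c} E_bc A_ac(u) B_bd(u)` with `E_bc ∈ 𝔮`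
  (`coeffX_left_right`);
* the lower right block is `(1 - θ tr A(u)) B(u)` (`coeffX_right_right`).

The shift by `θ k` arises from commuting `𝔮` past `X(u)`, once for each of the `k` columns. In the
coinvariants `E_bc` may be replaced by `- ∑_e q_be p_ce` acting on `ℋ`, and
`q_be p_ce q_ai p_dj = θ q_ai p_ce q_be p_dj + δ_ac δ_ei q_bi p_dj` (`zetaGen_mul`). The first
summand gives `∑_e T_ie(u) ⊗ T_ej(u)` without the contributions of the constant terms, as the
comultiplication requires; the second one cancels the term `- θ tr A(u) B(u)` (`coinvIncl_gen`).
-/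

namespace RatYangian

/-! ### Splitting the Fock space -/

section FockSplitting

open ExteriorAlgebra in
/-- The signed Leibniz rule for the left derivation of the Grassmann algebra along `d`, for a
product whose first factor comes from a map of the generators. -/
theorem contractLeft_map_mul {M N : Type*} [AddCommGroup M] [Module ℂ M] [AddCommGroup N]
    [Module ℂ N] (j : M →ₗ[ℂ] N) (d : Module.Dual ℂ N) (f : ExteriorAlgebra ℂ M)
    (y : ExteriorAlgebra ℂ N) :
    CliffordAlgebra.contractLeft (Q := (0 : QuadraticForm ℂ N)) d (map j f * y)
      = map j (CliffordAlgebra.contractLeft (Q := (0 : QuadraticForm ℂ M)) (d ∘ₗ j) f) * y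
        + map j (CliffordAlgebra.involute (Q := (0 : QuadraticForm ℂ M)) f)
          * CliffordAlgebra.contractLeft (Q := (0 : QuadraticForm ℂ N)) d y := by
  induction f using CliffordAlgebra.left_induction with
  | algebraMap r =>
    rw [CliffordAlgebra.contractLeft_algebraMap, AlgHom.commutes, AlgHom.commutes]
    simp [← Algebra.smul_def]
  | add x y hx hy => simp only [map_add, add_mul, hx, hy]; abel
  | ι_mul f v hf =>
    have e : ∀ f, map j (CliffordAlgebra.ι (0 : QuadraticForm ℂ M) v * f)
        = CliffordAlgebra.ι (0 : QuadraticForm ℂ N) (j v) * map j f := by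
      intro f; rw [map_mul]; congr 1; exact map_apply_ι j v
    rw [e, mul_assoc, CliffordAlgebra.contractLeft_ι_mul, hf, CliffordAlgebra.contractLeft_ι_mul,
      map_sub, map_smul, map_mul CliffordAlgebra.involute, CliffordAlgebra.involute_ι, e, neg_mul,
      map_neg, e]
    simp only [mul_add, sub_mul, smul_mul_assoc, mul_assoc, neg_mul, LinearMap.comp_apply]
    abel

theorem ι_mul_map {M N : Type*} [AddCommGroup M] [Module ℂ M] [AddCommGroup N]
    [Module ℂ N] (j : M →ₗ[ℂ] N) (w : N) (f : ExteriorAlgebra ℂ M) :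
    ExteriorAlgebra.ι ℂ w * ExteriorAlgebra.map j f
      = ExteriorAlgebra.map j (CliffordAlgebra.involute (Q := (0 : QuadraticForm ℂ M)) f)
        * ExteriorAlgebra.ι ℂ w := by
  induction f using CliffordAlgebra.left_induction with
  | algebraMap r =>
    rw [AlgHom.commutes, AlgHom.commutes, AlgHom.commutes, Algebra.commutes]
  | add x y hx hy => simp only [map_add, add_mul, mul_add, hx, hy]
  | ι_mul f v hf =>
    have e : ExteriorAlgebra.map j (CliffordAlgebra.ι (0 : QuadraticForm ℂ M) v)
        = ExteriorAlgebra.ι ℂ (j v) := ExteriorAlgebra.map_apply_ι j v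
    have s := ExteriorAlgebra.ι_add_mul_swap (R := ℂ) w (j v)
    rw [add_eq_zero_iff_eq_neg] at s
    rw [map_mul, map_mul, map_mul, CliffordAlgebra.involute_ι, map_neg, e, ← mul_assoc, s, neg_mul,
      neg_mul, neg_mul, mul_assoc, hf, mul_assoc]

/-- An identification `μ` of the tensor product of the Fock spaces of the variables with first
index `≤ k` and `> k` with the Fock space of all the variables, under which the operators of the
first kind act on the first factor. The operators of the second kind act on the second
factor, up to an involution `π` of the first factor which is the parity for anticommuting
variables and the identity for commuting ones. -/
structure IsFockSplitting (σ : VarKind) {k l n : ℕ}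
    (μ : Fock σ k n ⊗[ℂ] Fock σ l n ≃ₗ[ℂ] Fock σ (k + l) n)
    (π : Module.End ℂ (Fock σ k n)) : Prop where
  invol : π * π = 1
  x_left : ∀ a i f g, xOp σ (Fin.castAdd l a) i (μ (f ⊗ₜ g)) = μ (xOp σ a i f ⊗ₜ g)
  d_left : ∀ a i f g, dOp σ (Fin.castAdd l a) i (μ (f ⊗ₜ g)) = μ (dOp σ a i f ⊗ₜ g)
  x_right : ∀ b i f g, xOp σ (Fin.natAdd k b) i (μ (f ⊗ₜ g)) = μ (π f ⊗ₜ xOp σ b i g)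
  d_right : ∀ b i f g, dOp σ (Fin.natAdd k b) i (μ (f ⊗ₜ g)) = μ (π f ⊗ₜ dOp σ b i g)

theorem castAdd_ne_natAdd {k l : ℕ} (a : Fin k) (b : Fin l) : Fin.castAdd l a ≠ Fin.natAdd k b := by
  intro h
  have := congrArg Fin.val h
  simp at this
  omega

/-- The index set `Fin (k + l) × Fin n` as a disjoint union. -/
def splitIndex (k l n : ℕ) : (Fin k × Fin n) ⊕ (Fin l × Fin n) ≃ Fin (k + l) × Fin n :=
  (Equiv.sumProdDistrib _ _ _).symm.trans (finSumFinEquiv.prodCongr (Equiv.refl _))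

theorem splitIndex_inl (k l n : ℕ) (a : Fin k) (i : Fin n) :
    splitIndex k l n (Sum.inl (a, i)) = (Fin.castAdd l a, i) := rfl

theorem splitIndex_inr (k l n : ℕ) (b : Fin l) (i : Fin n) :
    splitIndex k l n (Sum.inr (b, i)) = (Fin.natAdd k b, i) := rfl

theorem exists_fockSplitting_commuting (k l n : ℕ) :
    ∃ μ π, IsFockSplitting .commuting (k := k) (l := l) (n := n) μ π := by
  let E : MvPolynomial (Fin k × Fin n) ℂ ⊗[ℂ] MvPolynomial (Fin l × Fin n) ℂ
      ≃ₐ[ℂ] MvPolynomial (Fin (k + l) × Fin n) ℂ :=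
    (MvPolynomial.tensorEquivSum ℂ _ _ ℂ).trans (MvPolynomial.renameEquiv ℂ (splitIndex k l n))
  have hl : ∀ a i, E (MvPolynomial.X (a, i) ⊗ₜ 1) = MvPolynomial.X (Fin.castAdd l a, i) := by
    intro a i; simp [E, splitIndex_inl]
  have hr : ∀ b i, E (1 ⊗ₜ MvPolynomial.X (b, i)) = MvPolynomial.X (Fin.natAdd k b, i) := by
    intro b i; simp [E, splitIndex_inr]
  have h1 : E (1 ⊗ₜ 1) = 1 := map_one E
  have hE : ∀ f g, E (f ⊗ₜ g) = E (f ⊗ₜ 1) * E (1 ⊗ₜ g) := by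
    intro f g; rw [← map_mul]; simp
  have hC1 : ∀ c, E (MvPolynomial.C c ⊗ₜ 1) = MvPolynomial.C c := by
    intro c
    exact E.commutes c
  have hC2 : ∀ c, E (1 ⊗ₜ MvPolynomial.C c) = MvPolynomial.C c := by
    intro c
    rw [← hC1, MvPolynomial.C_eq_smul_one, MvPolynomial.C_eq_smul_one, TensorProduct.smul_tmul]
  have m1 : ∀ f g, E ((f * g) ⊗ₜ 1) = E (f ⊗ₜ 1) * E (g ⊗ₜ 1) := by
    intro f g; rw [← map_mul]; simp
  have m2 : ∀ f g, E (1 ⊗ₜ (f * g)) = E (1 ⊗ₜ f) * E (1 ⊗ₜ g) := by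
    intro f g; rw [← map_mul]; simp
  have dll : ∀ a i f, MvPolynomial.pderiv (Fin.castAdd l a, i) (E (f ⊗ₜ 1))
      = E (MvPolynomial.pderiv (a, i) f ⊗ₜ 1) := by
    intro a i f
    induction f using MvPolynomial.induction_on with
    | C c => simp [hC1]
    | add f g hf hg => simp only [TensorProduct.add_tmul, map_add, hf, hg]
    | mul_X f x hf =>
      obtain ⟨b, j⟩ := x
      rw [m1, Derivation.leibniz, Derivation.leibniz, hf, TensorProduct.add_tmul, map_add,
        smul_eq_mul, smul_eq_mul, smul_eq_mul, smul_eq_mul, m1, m1, hl]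
      by_cases h : b = a ∧ j = i
      · obtain ⟨rfl, rfl⟩ := h
        rw [MvPolynomial.pderiv_X_self, MvPolynomial.pderiv_X_self]; simp [h1]
      · rw [MvPolynomial.pderiv_X_of_ne, MvPolynomial.pderiv_X_of_ne]
        · simp
        · simpa [Prod.mk.injEq] using h
        · simpa [Prod.mk.injEq] using h
  have drr : ∀ a i f, MvPolynomial.pderiv (Fin.natAdd k a, i) (E (1 ⊗ₜ f))
      = E (1 ⊗ₜ MvPolynomial.pderiv (a, i) f) := by
    intro a i f
    induction f using MvPolynomial.induction_on with
    | C c => simp [hC2]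
    | add f g hf hg => simp only [TensorProduct.tmul_add, map_add, hf, hg]
    | mul_X f x hf =>
      obtain ⟨b, j⟩ := x
      rw [m2, Derivation.leibniz, Derivation.leibniz, hf, TensorProduct.tmul_add, map_add,
        smul_eq_mul, smul_eq_mul, smul_eq_mul, smul_eq_mul, m2, m2, hr]
      by_cases h : b = a ∧ j = i
      · obtain ⟨rfl, rfl⟩ := h
        rw [MvPolynomial.pderiv_X_self, MvPolynomial.pderiv_X_self]; simp [h1]
      · rw [MvPolynomial.pderiv_X_of_ne, MvPolynomial.pderiv_X_of_ne]
        · simp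
        · simpa [Prod.mk.injEq] using h
        · simpa [Prod.mk.injEq] using h
  have dlr : ∀ a i f, MvPolynomial.pderiv (Fin.castAdd l a, i) (E (1 ⊗ₜ f)) = 0 := by
    intro a i f
    induction f using MvPolynomial.induction_on with
    | C c => simp [hC2]
    | add f g hf hg => simp only [TensorProduct.tmul_add, map_add, hf, hg, add_zero]
    | mul_X f x hf =>
      obtain ⟨b, j⟩ := x
      rw [m2, Derivation.leibniz, hf, hr, MvPolynomial.pderiv_X_of_ne]
      · simp
      · intro h; exact castAdd_ne_natAdd a b (congrArg Prod.fst h).symm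
  have drl : ∀ a i f, MvPolynomial.pderiv (Fin.natAdd k a, i) (E (f ⊗ₜ 1)) = 0 := by
    intro a i f
    induction f using MvPolynomial.induction_on with
    | C c => simp [hC1]
    | add f g hf hg => simp only [TensorProduct.add_tmul, map_add, hf, hg, add_zero]
    | mul_X f x hf =>
      obtain ⟨b, j⟩ := x
      rw [m1, Derivation.leibniz, hf, hl, MvPolynomial.pderiv_X_of_ne]
      · simp
      · intro h; exact castAdd_ne_natAdd b a (congrArg Prod.fst h)
  refine ⟨E.toLinearEquiv, 1, mul_one 1, ?_, ?_, ?_, ?_⟩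
  · intro a i (f : MvPolynomial (Fin k × Fin n) ℂ) (g : MvPolynomial (Fin l × Fin n) ℂ)
    change MvPolynomial.X (Fin.castAdd l a, i) * E (f ⊗ₜ g) = E ((MvPolynomial.X (a, i) * f) ⊗ₜ g)
    rw [← hl, ← map_mul]
    simp
  · intro a i (f : MvPolynomial (Fin k × Fin n) ℂ) (g : MvPolynomial (Fin l × Fin n) ℂ)
    change MvPolynomial.pderiv (Fin.castAdd l a, i) (E (f ⊗ₜ g))
      = E (MvPolynomial.pderiv (a, i) f ⊗ₜ g)
    rw [hE f g, Derivation.leibniz, dll, dlr, hE (MvPolynomial.pderiv (a, i) f) g, smul_zero,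
      zero_add, smul_eq_mul, mul_comm]
  · intro a i (f : MvPolynomial (Fin k × Fin n) ℂ) (g : MvPolynomial (Fin l × Fin n) ℂ)
    change MvPolynomial.X (Fin.natAdd k a, i) * E (f ⊗ₜ g) = E (f ⊗ₜ (MvPolynomial.X (a, i) * g))
    rw [← hr, ← map_mul]
    simp
  · intro a i (f : MvPolynomial (Fin k × Fin n) ℂ) (g : MvPolynomial (Fin l × Fin n) ℂ)
    change MvPolynomial.pderiv (Fin.natAdd k a, i) (E (f ⊗ₜ g))
      = E (f ⊗ₜ MvPolynomial.pderiv (a, i) g)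
    rw [hE f g, Derivation.leibniz, drr, drl, hE f (MvPolynomial.pderiv (a, i) g), smul_zero,
      add_zero, smul_eq_mul]

/-- The splitting is the product `f ⊗ g ↦ f g` in the Grassmann algebra. Mathlib knows that it is
bijective in the form of the isomorphism of the Clifford algebra of an orthogonal sum with a graded
tensor product, applied to zero quadratic forms. -/
theorem exists_fockSplitting_anticommuting (k l n : ℕ) :
    ∃ μ π, IsFockSplitting .anticommuting (k := k) (l := l) (n := n) μ π := by
  let e : ((Fin k × Fin n → ℂ) × (Fin l × Fin n → ℂ)) ≃ₗ[ℂ] (Fin (k + l) × Fin n → ℂ) :=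
    (LinearEquiv.sumArrowLequivProdArrow _ _ ℂ ℂ).symm.trans
      (LinearEquiv.funCongrLeft ℂ ℂ (splitIndex k l n).symm)
  let j₁ : (Fin k × Fin n → ℂ) →ₗ[ℂ] (Fin (k + l) × Fin n → ℂ) :=
    e.toLinearMap ∘ₗ LinearMap.inl ℂ _ _
  let j₂ : (Fin l × Fin n → ℂ) →ₗ[ℂ] (Fin (k + l) × Fin n → ℂ) :=
    e.toLinearMap ∘ₗ LinearMap.inr ℂ _ _
  let Q₁ : QuadraticForm ℂ (Fin k × Fin n → ℂ) := 0
  let Q₂ : QuadraticForm ℂ (Fin l × Fin n → ℂ) := 0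
  let iso : (Q₁.prod Q₂).IsometryEquiv (0 : QuadraticForm ℂ (Fin (k + l) × Fin n → ℂ)) :=
    { e with map_app' := fun m => by simp [Q₁, Q₂] }
  let μ : ExteriorAlgebra ℂ (Fin k × Fin n → ℂ) ⊗[ℂ] ExteriorAlgebra ℂ (Fin l × Fin n → ℂ)
      ≃ₗ[ℂ] ExteriorAlgebra ℂ (Fin (k + l) × Fin n → ℂ) :=
    (GradedTensorProduct.of ℂ (CliffordAlgebra.evenOdd Q₁) (CliffordAlgebra.evenOdd Q₂)).trans
      ((CliffordAlgebra.prodEquiv Q₁ Q₂).symm.toLinearEquiv.trans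
        (CliffordAlgebra.equivOfIsometry iso).toLinearEquiv)
  have hμ : ∀ f g, μ (f ⊗ₜ g) = ExteriorAlgebra.map j₁ f * ExteriorAlgebra.map j₂ g := by
    intro f g
    change CliffordAlgebra.map iso.toIsometry (CliffordAlgebra.toProd Q₁ Q₂
      (GradedTensorProduct.tmul ℂ f g)) = _
    rw [CliffordAlgebra.toProd, GradedTensorProduct.lift_tmul, map_mul]
    congr 1
    · exact DFunLike.congr_fun (CliffordAlgebra.map_comp_map _ _) _
    · exact DFunLike.congr_fun (CliffordAlgebra.map_comp_map _ _) _
  have he : ∀ v w x, e (v, w) x = Sum.elim v w ((splitIndex k l n).symm x) := by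
    intro v w x
    rfl
  have s1 : ∀ a i, (splitIndex k l n).symm (Fin.castAdd l a, i) = Sum.inl (a, i) := by
    intro a i; rw [Equiv.symm_apply_eq]; rfl
  have s2 : ∀ a i, (splitIndex k l n).symm (Fin.natAdd k a, i) = Sum.inr (a, i) := by
    intro a i; rw [Equiv.symm_apply_eq]; rfl
  have v1 : ∀ a i, j₁ (Pi.single (a, i) 1) = Pi.single (Fin.castAdd l a, i) 1 := by
    intro a i
    ext x
    obtain ⟨x, rfl⟩ := (splitIndex k l n).surjective x
    change e (Pi.single (a, i) 1, 0) _ = _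
    rw [he, Equiv.symm_apply_apply, ← splitIndex_inl]
    cases x <;> simp [Pi.single_apply]
  have v2 : ∀ a i, j₂ (Pi.single (a, i) 1) = Pi.single (Fin.natAdd k a, i) 1 := by
    intro a i
    ext x
    obtain ⟨x, rfl⟩ := (splitIndex k l n).surjective x
    change e (0, Pi.single (a, i) 1) _ = _
    rw [he, Equiv.symm_apply_apply, ← splitIndex_inr]
    cases x <;> simp [Pi.single_apply]
  have p11 : ∀ a i, (LinearMap.proj (Fin.castAdd l a, i) : Module.Dual ℂ _) ∘ₗ j₁
      = LinearMap.proj (a, i) := by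
    intro a i
    refine LinearMap.ext fun x => ?_
    change e (_, 0) _ = _
    simp [he, s1]
  have p12 : ∀ a i, (LinearMap.proj (Fin.castAdd l a, i) : Module.Dual ℂ _) ∘ₗ j₂ = 0 := by
    intro a i
    refine LinearMap.ext fun x => ?_
    change e (0, _) _ = _
    simp [he, s1]
  have p21 : ∀ a i, (LinearMap.proj (Fin.natAdd k a, i) : Module.Dual ℂ _) ∘ₗ j₁ = 0 := by
    intro a i
    refine LinearMap.ext fun x => ?_
    change e (_, 0) _ = _
    simp [he, s2]
  have p22 : ∀ a i, (LinearMap.proj (Fin.natAdd k a, i) : Module.Dual ℂ _) ∘ₗ j₂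
      = LinearMap.proj (a, i) := by
    intro a i
    refine LinearMap.ext fun x => ?_
    change e (0, _) _ = _
    simp [he, s2]
  have cm : ∀ d g, CliffordAlgebra.contractLeft
      (Q := (0 : QuadraticForm ℂ (Fin (k + l) × Fin n → ℂ))) d (ExteriorAlgebra.map j₂ g)
      = ExteriorAlgebra.map j₂ (CliffordAlgebra.contractLeft (Q := Q₂) (d ∘ₗ j₂) g) := by
    intro d g
    have := contractLeft_map_mul j₂ d g 1
    rwa [mul_one, mul_one, CliffordAlgebra.contractLeft_one, mul_zero, add_zero] at this
  refine ⟨μ, (CliffordAlgebra.involute (Q := Q₁)).toLinearMap, ?_, ?_, ?_, ?_, ?_⟩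
  · refine LinearMap.ext fun f => ?_
    exact CliffordAlgebra.involute_involute f
  · intro a i (f : ExteriorAlgebra ℂ (Fin k × Fin n → ℂ))
      (g : ExteriorAlgebra ℂ (Fin l × Fin n → ℂ))
    change ExteriorAlgebra.ι ℂ (Pi.single (Fin.castAdd l a, i) 1) * μ (f ⊗ₜ g)
      = μ ((ExteriorAlgebra.ι ℂ (Pi.single (a, i) 1) * f) ⊗ₜ g)
    rw [hμ, hμ, map_mul, ExteriorAlgebra.map_apply_ι, v1, mul_assoc]
  · intro a i (f : ExteriorAlgebra ℂ (Fin k × Fin n → ℂ))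
      (g : ExteriorAlgebra ℂ (Fin l × Fin n → ℂ))
    change CliffordAlgebra.contractLeft (Q := (0 : QuadraticForm ℂ (Fin (k + l) × Fin n → ℂ)))
      (LinearMap.proj (Fin.castAdd l a, i)) (μ (f ⊗ₜ g))
      = μ (CliffordAlgebra.contractLeft (Q := Q₁) (LinearMap.proj (a, i)) f ⊗ₜ g)
    rw [hμ, hμ, contractLeft_map_mul, p11, cm, p12, map_zero, LinearMap.zero_apply, map_zero,
      mul_zero, add_zero]
  · intro a i (f : ExteriorAlgebra ℂ (Fin k × Fin n → ℂ))
      (g : ExteriorAlgebra ℂ (Fin l × Fin n → ℂ))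
    change ExteriorAlgebra.ι ℂ (Pi.single (Fin.natAdd k a, i) 1) * μ (f ⊗ₜ g)
      = μ (CliffordAlgebra.involute (Q := Q₁) f ⊗ₜ (ExteriorAlgebra.ι ℂ (Pi.single (a, i) 1) * g))
    rw [hμ, hμ, map_mul, ExteriorAlgebra.map_apply_ι, v2, ← mul_assoc, ι_mul_map, mul_assoc]
  · intro a i (f : ExteriorAlgebra ℂ (Fin k × Fin n → ℂ))
      (g : ExteriorAlgebra ℂ (Fin l × Fin n → ℂ))
    change CliffordAlgebra.contractLeft (Q := (0 : QuadraticForm ℂ (Fin (k + l) × Fin n → ℂ)))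
      (LinearMap.proj (Fin.natAdd k a, i)) (μ (f ⊗ₜ g))
      = μ (CliffordAlgebra.involute (Q := Q₁) f
        ⊗ₜ CliffordAlgebra.contractLeft (Q := Q₂) (LinearMap.proj (a, i)) g)
    rw [hμ, hμ, contractLeft_map_mul, p21, cm, p22, map_zero, LinearMap.zero_apply, map_zero,
      zero_mul, zero_add]

theorem exists_fockSplitting (σ : VarKind) (k l n : ℕ) :
    ∃ μ π, IsFockSplitting σ (k := k) (l := l) (n := n) μ π := by
  cases σ with
  | commuting => exact exists_fockSplitting_commuting k l n
  | anticommuting => exact exists_fockSplitting_anticommuting k l n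

section Operators

variable {σ : VarKind} {k l n : ℕ} {μ : Fock σ k n ⊗[ℂ] Fock σ l n ≃ₗ[ℂ] Fock σ (k + l) n}
  {π : Module.End ℂ (Fock σ k n)} (h : IsFockSplitting σ μ π) {p₀ p₁ p₂ : ℕ}

include h

theorem IsFockSplitting.q_left (h₁ : ∀ a : Fin k, a.val < p₀ ↔ a.val < p₁) (a : Fin k) (i : Fin n)
    (f : Fock σ k n) (g : Fock σ l n) :
    qOp σ p₀ (Fin.castAdd l a) i (μ (f ⊗ₜ g)) = μ (qOp σ p₁ a i f ⊗ₜ g) := by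
  simp only [qOp, Fin.val_castAdd, h₁ a]
  split_ifs
  · exact h.d_left a i f g
  · exact h.x_left a i f g

theorem IsFockSplitting.p_left (h₁ : ∀ a : Fin k, a.val < p₀ ↔ a.val < p₁) (a : Fin k) (i : Fin n)
    (f : Fock σ k n) (g : Fock σ l n) :
    pOp σ p₀ (Fin.castAdd l a) i (μ (f ⊗ₜ g)) = μ (pOp σ p₁ a i f ⊗ₜ g) := by
  simp only [pOp, Fin.val_castAdd, h₁ a]
  split_ifs
  · rw [LinearMap.smul_apply, LinearMap.smul_apply, h.x_left, ← TensorProduct.smul_tmul', map_smul]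
  · exact h.d_left a i f g

theorem IsFockSplitting.q_right (h₂ : ∀ b : Fin l, k + b.val < p₀ ↔ b.val < p₂) (b : Fin l)
    (i : Fin n) (f : Fock σ k n) (g : Fock σ l n) :
    qOp σ p₀ (Fin.natAdd k b) i (μ (f ⊗ₜ g)) = μ (π f ⊗ₜ qOp σ p₂ b i g) := by
  simp only [qOp, Fin.val_natAdd, h₂ b]
  split_ifs
  · exact h.d_right b i f g
  · exact h.x_right b i f g

theorem IsFockSplitting.p_right (h₂ : ∀ b : Fin l, k + b.val < p₀ ↔ b.val < p₂) (b : Fin l)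
    (i : Fin n) (f : Fock σ k n) (g : Fock σ l n) :
    pOp σ p₀ (Fin.natAdd k b) i (μ (f ⊗ₜ g)) = μ (π f ⊗ₜ pOp σ p₂ b i g) := by
  simp only [pOp, Fin.val_natAdd, h₂ b]
  split_ifs
  · rw [LinearMap.smul_apply, LinearMap.smul_apply, h.x_right, TensorProduct.tmul_smul, map_smul]
  · exact h.d_right b i f g

theorem IsFockSplitting.qp_left (h₁ : ∀ a : Fin k, a.val < p₀ ↔ a.val < p₁) (a c : Fin k)
    (i j : Fin n) (f : Fock σ k n) (g : Fock σ l n) :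
    (qOp σ p₀ (Fin.castAdd l a) i * pOp σ p₀ (Fin.castAdd l c) j) (μ (f ⊗ₜ g))
      = μ ((qOp σ p₁ a i * pOp σ p₁ c j) f ⊗ₜ g) := by
  rw [Module.End.mul_apply, h.p_left h₁, h.q_left h₁, Module.End.mul_apply]

theorem IsFockSplitting.qp_right (h₂ : ∀ b : Fin l, k + b.val < p₀ ↔ b.val < p₂) (b d : Fin l)
    (i j : Fin n) (f : Fock σ k n) (g : Fock σ l n) :
    (qOp σ p₀ (Fin.natAdd k b) i * pOp σ p₀ (Fin.natAdd k d) j) (μ (f ⊗ₜ g))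
      = μ (f ⊗ₜ (qOp σ p₂ b i * pOp σ p₂ d j) g) := by
  have hπ : π (π f) = f := LinearMap.congr_fun h.invol f
  rw [Module.End.mul_apply, h.p_right h₂, h.q_right h₂, hπ, Module.End.mul_apply]

theorem IsFockSplitting.zetaGen_left (h₁ : ∀ a : Fin k, a.val < p₀ ↔ a.val < p₁) (a c : Fin k)
    (f : Fock σ k n) (g : Fock σ l n) :
    zetaGen σ p₀ (k + l) n (Fin.castAdd l a) (Fin.castAdd l c) (μ (f ⊗ₜ g))
      = μ (zetaGen σ p₁ k n a c f ⊗ₜ g) := by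
  simp only [zetaGen, LinearMap.add_apply, LinearMap.smul_apply, LinearMap.sum_apply,
    h.qp_left h₁, TensorProduct.add_tmul, TensorProduct.sum_tmul, map_add, map_sum,
    Module.End.one_apply, ← TensorProduct.smul_tmul', map_smul,
    (Fin.castAdd_injective k l).eq_iff]

theorem IsFockSplitting.zetaGen_right (h₂ : ∀ b : Fin l, k + b.val < p₀ ↔ b.val < p₂) (b d : Fin l)
    (f : Fock σ k n) (g : Fock σ l n) :
    zetaGen σ p₀ (k + l) n (Fin.natAdd k b) (Fin.natAdd k d) (μ (f ⊗ₜ g))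
      = μ (f ⊗ₜ zetaGen σ p₂ l n b d g) := by
  simp only [zetaGen, LinearMap.add_apply, LinearMap.smul_apply, LinearMap.sum_apply,
    h.qp_right h₂, TensorProduct.tmul_add, TensorProduct.tmul_sum, map_add, map_sum,
    Module.End.one_apply, TensorProduct.tmul_smul, map_smul,
    (Fin.natAdd_injective l k).eq_iff]

end Operators

end FockSplitting

/-! ### A polynomial model of the parabolically induced module -/

section PolynomialModel

theorem single_mem_nilQ (k l : ℕ) (b : Fin l) (a : Fin k) :
    (Matrix.single (Fin.natAdd k b) (Fin.castAdd l a) 1 : Gl (k + l)) ∈ nilQ k l := by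
  constructor
  · intro c j
    exact Matrix.single_apply_of_row_ne (castAdd_ne_natAdd c b).symm _ _ _
  · intro i d
    exact Matrix.single_apply_of_col_ne _ _ (castAdd_ne_natAdd a d) _

theorem eq_sum_of_mem_nilQ {k l : ℕ} {X : Gl (k + l)} (hX : X ∈ nilQ k l) :
    X = ∑ b, ∑ a, X (Fin.natAdd k b) (Fin.castAdd l a)
      • Matrix.single (Fin.natAdd k b) (Fin.castAdd l a) (1 : ℂ) := by
  conv_lhs => rw [Matrix.matrix_eq_sum_single X]
  simp only [Fin.sum_univ_add, hX.1, hX.2, Matrix.single_zero, Finset.sum_const_zero, zero_add,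
    add_zero, Matrix.smul_single, smul_eq_mul, mul_one]

theorem exists_parabolic_add_nilQ {k l : ℕ} (X : Gl (k + l)) :
    ∃ P : parabolic k l, ∃ Q ∈ nilQ k l, X = P + Q := by
  let Q : Gl (k + l) := ∑ b : Fin l, ∑ a : Fin k, X (Fin.natAdd k b) (Fin.castAdd l a)
      • Matrix.single (Fin.natAdd k b) (Fin.castAdd l a) (1 : ℂ)
  have hQ : Q ∈ nilQ k l := Submodule.sum_mem _ fun b _ => Submodule.sum_mem _ fun a _ =>
    Submodule.smul_mem _ _ (single_mem_nilQ k l b a)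
  have e : ∀ a b, Q (Fin.natAdd k b) (Fin.castAdd l a) = X (Fin.natAdd k b) (Fin.castAdd l a) := by
    intro a b
    simp only [Q, Matrix.sum_apply, Matrix.smul_apply, Matrix.single_apply,
      (Fin.natAdd_injective l k).eq_iff, (Fin.castAdd_injective k l).eq_iff]
    rw [Finset.sum_eq_single b, Finset.sum_eq_single a]
    · simp
    · intro c _ hc; simp [hc]
    · simp
    · intro d _ hd; simp [hd]
    · simp
  refine ⟨⟨X - Q, fun a b => ?_⟩, Q, hQ, (sub_add_cancel X Q).symm⟩
  rw [Matrix.sub_apply, e, sub_self]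

variable {k l : ℕ} {N : Type*} [AddCommGroup N] [Module ℂ N]

variable (k l) in
/-- The algebra `ℂ[y]` of polynomials in the variables `y_ba`, which is isomorphic to `U(𝔮)`.
It is kept opaque to instance search, so that its tensor products are only seen over `ℂ`. -/
def QPoly : Type := MvPolynomial (Fin l × Fin k) ℂ

noncomputable instance : CommRing (QPoly k l) :=
  inferInstanceAs (CommRing (MvPolynomial (Fin l × Fin k) ℂ))

noncomputable instance : Algebra ℂ (QPoly k l) :=
  inferInstanceAs (Algebra ℂ (MvPolynomial (Fin l × Fin k) ℂ))

/-- The variable `y_ba`. -/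
noncomputable def QPoly.X (b : Fin l) (a : Fin k) : QPoly k l :=
  MvPolynomial.X (R := ℂ) (b, a)

/-- The derivation with respect to `y_ba`. -/
noncomputable def QPoly.pderiv (b : Fin l) (a : Fin k) : Derivation ℂ (QPoly k l) (QPoly k l) :=
  MvPolynomial.pderiv (R := ℂ) (b, a)

theorem QPoly.pderiv_X (b : Fin l) (a : Fin k) (d : Fin l) (c : Fin k) :
    QPoly.pderiv b a (QPoly.X d c) = if b = d ∧ a = c then 1 else 0 := by
  refine (MvPolynomial.pderiv_X (R := ℂ) (b, a) (d, c)).trans ?_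
  by_cases h : b = d ∧ a = c
  · obtain ⟨rfl, rfl⟩ := h
    rw [Pi.single_eq_same, if_pos ⟨rfl, rfl⟩]
    rfl
  · rw [if_neg h, Pi.single_eq_of_ne]
    · rfl
    · rw [Ne, Prod.mk.injEq]; rintro ⟨rfl, rfl⟩; exact h ⟨rfl, rfl⟩

theorem QPoly.induction {motive : QPoly k l → Prop} (f : QPoly k l)
    (scalar : ∀ c : ℂ, motive (c • 1)) (add : ∀ f g, motive f → motive g → motive (f + g))
    (mul_X : ∀ f b a, motive f → motive (QPoly.X b a * f)) : motive f := by
  refine MvPolynomial.induction_on (motive := motive) f (fun c => ?_) add fun f x hf => ?_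
  · rw [MvPolynomial.C_eq_smul_one]
    exact scalar c
  · rw [mul_comm]
    exact mul_X f x.1 x.2 hf

variable (N) in
/-- Multiplication by the variable `y_ba` on `ℂ[y] ⊗ N`, where `1 ≤ a ≤ k` and `1 ≤ b ≤ l`. -/
noncomputable def modelY (b : Fin l) (a : Fin k) :
    Module.End ℂ (QPoly k l ⊗[ℂ] N) :=
  (LinearMap.mulLeft ℂ (QPoly.X b a)).rTensor N

variable (N) in
/-- The derivation with respect to `y_ba` on `ℂ[y] ⊗ N`. -/
noncomputable def modelD (b : Fin l) (a : Fin k) :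
    Module.End ℂ (QPoly k l ⊗[ℂ] N) :=
  (QPoly.pderiv b a).toLinearMap.rTensor N

/-- The action of `gl_k ⊕ gl_l` on the second factor of `ℂ[y] ⊗ N`. -/
noncomputable def modelLevi (ρ : (Gl k × Gl l) →ₗ⁅ℂ⁆ Module.End ℂ N) (x : Gl k × Gl l) :
    Module.End ℂ (QPoly k l ⊗[ℂ] N) :=
  (ρ x).lTensor (QPoly k l)

variable (ρ : (Gl k × Gl l) →ₗ⁅ℂ⁆ Module.End ℂ N)

/-- The operators on `ℂ[y] ⊗ N` by which the matrix units of `gl_{k+l}` act. The matrix units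
of `𝔮` act as the variables; the formulas for the others are obtained by commuting them through
a monomial in `U(𝔮) = ℂ[y]` to the right, until they reach `N`. -/
noncomputable def modelE :
    Fin (k + l) → Fin (k + l) → Module.End ℂ (QPoly k l ⊗[ℂ] N) :=
  Fin.addCases
    (fun a => Fin.addCases
      (fun c => modelLevi ρ (Matrix.single a c 1, 0) - ∑ b, modelY N b c * modelD N b a)
      (fun b => ∑ c, modelLevi ρ (Matrix.single a c 1, 0) * modelD N b c
        - ∑ d, modelLevi ρ (0, Matrix.single d b 1) * modelD N d a
        - ∑ c, ∑ d, modelY N d c * (modelD N d a * modelD N b c)))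
    (fun b => Fin.addCases
      (fun a => modelY N b a)
      (fun d => modelLevi ρ (0, Matrix.single b d 1) + ∑ a, modelY N b a * modelD N d a))

/-- The operators `modelE` satisfy the relations of `gl_{k+l}` whenever one of the two matrix units
lies in `𝔮`. -/
theorem modelE_bracket (i j : Fin (k + l)) (b : Fin l) (a : Fin k) :
    modelE ρ i j * modelY N b a - modelY N b a * modelE ρ i j
      = (if j = Fin.natAdd k b then (1 : ℂ) else 0) • modelE ρ i (Fin.castAdd l a)
        - (if i = Fin.castAdd l a then (1 : ℂ) else 0) • modelE ρ (Fin.natAdd k b) j := by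
  let br : Module.End ℂ (QPoly k l ⊗[ℂ] N) →ₗ[ℂ]
      Module.End ℂ (QPoly k l ⊗[ℂ] N) :=
    LinearMap.mulRight ℂ (modelY N b a) - LinearMap.mulLeft ℂ (modelY N b a)
  have hbr : ∀ T, T * modelY N b a - modelY N b a * T = br T := fun T => rfl
  have br_mul : ∀ S T, br (S * T) = br S * T + S * br T := by
    intro S T; simp only [← hbr, sub_mul, mul_sub, mul_assoc]; abel
  have br_Y : ∀ d c, br (modelY N d c) = 0 := by
    intro d c
    rw [← hbr, sub_eq_zero]
    refine TensorProduct.ext' fun f t => ?_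
    simp [modelY, mul_left_comm]
  have br_L : ∀ x, br (modelLevi ρ x) = 0 := by
    intro x
    rw [← hbr, sub_eq_zero]
    refine TensorProduct.ext' fun f t => ?_
    simp [modelY, modelLevi]
  have br_D : ∀ d c, br (modelD N d c) = if d = b then (if c = a then 1 else 0) else 0 := by
    intro d c
    rw [← hbr]
    refine TensorProduct.ext' fun f t => ?_
    rw [← ite_and]
    by_cases h : d = b ∧ c = a <;>
      simp [modelY, modelD, QPoly.pderiv_X, h, TensorProduct.add_tmul]
  have h1 : ∀ (c : Fin k) (d : Fin l), Fin.castAdd l c ≠ Fin.natAdd k d := castAdd_ne_natAdd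
  have h2 : ∀ (c : Fin k) (d : Fin l), Fin.natAdd k d ≠ Fin.castAdd l c := fun c d => (h1 c d).symm
  rw [hbr]
  induction i using Fin.addCases with
  | left c =>
    induction j using Fin.addCases with
    | left c' =>
      simp only [modelE, Fin.addCases_left, Fin.addCases_right, map_sub, br_L, map_sum, br_mul,
        br_Y, br_D, zero_mul, h1, (Fin.castAdd_injective k l).eq_iff]
      by_cases hc : c = a <;> simp [hc]
    | right d =>
      simp only [modelE, Fin.addCases_left, Fin.addCases_right, map_sub, br_L, map_sum, br_mul,
        br_Y, br_D, zero_mul, (Fin.castAdd_injective k l).eq_iff,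
        (Fin.natAdd_injective l k).eq_iff]
      by_cases hc : c = a <;> by_cases hd : d = b <;>
        simp [hc, hd, mul_add, Finset.sum_add_distrib] <;> abel
  | right d =>
    induction j using Fin.addCases with
    | left c' =>
      simp [modelE, br_Y, h1, h2]
    | right d' =>
      simp only [modelE, Fin.addCases_left, Fin.addCases_right, map_add, br_L, map_sum, br_mul,
        br_Y, br_D, zero_mul, h2, (Fin.natAdd_injective l k).eq_iff]
      by_cases hd : d' = b <;> simp [hd]

/-- The linear extension of `modelE` to `gl_{k+l}`. -/
noncomputable def modelLin :
    Gl (k + l) →ₗ[ℂ] Module.End ℂ (QPoly k l ⊗[ℂ] N) where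
  toFun X := ∑ i, ∑ j, X i j • modelE ρ i j
  map_add' X Y := by simp [add_smul, Finset.sum_add_distrib]
  map_smul' c X := by simp [Finset.smul_sum, mul_smul]

theorem modelLin_single (i j : Fin (k + l)) :
    modelLin ρ (Matrix.single i j 1) = modelE ρ i j := by
  change ∑ i', ∑ j', (Matrix.single i j (1 : ℂ)) i' j' • modelE ρ i' j' = _
  rw [Finset.sum_eq_single i, Finset.sum_eq_single j]
  · simp
  · intro b' _ hb; simp [hb.symm]
  · simp
  · intro a' _ ha; simp [ha.symm]
  · simp

theorem modelLin_nilQ (b : Fin l) (a : Fin k) :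
    modelLin ρ (Matrix.single (Fin.natAdd k b) (Fin.castAdd l a) 1) = modelY N b a := by
  simp [modelLin_single, modelE]

theorem modelLin_bracket (X : Gl (k + l)) (b : Fin l) (a : Fin k) :
    modelLin ρ X * modelY N b a - modelY N b a * modelLin ρ X
      = modelLin ρ ⁅X, Matrix.single (Fin.natAdd k b) (Fin.castAdd l a) (1 : ℂ)⁆ := by
  induction X using Matrix.induction_on' with
  | h_zero => simp
  | h_add X X' hX hX' =>
    rw [add_lie, map_add, map_add, ← hX, ← hX']
    noncomm_ring
  | h_std_basis i j x =>
    have hs : (Matrix.single i j x : Gl (k + l)) = x • Matrix.single i j (1 : ℂ) := by simp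
    rw [hs, smul_lie, map_smul, map_smul, single_lie, map_sub, map_smul, map_smul,
      modelLin_single, modelLin_single, modelLin_single, ← modelE_bracket, smul_sub,
      smul_mul_assoc, mul_smul_comm]

theorem modelLin_one_tmul (P : parabolic k l) (t : N) :
    modelLin ρ P (1 ⊗ₜ t) = 1 ⊗ₜ ρ (parabolicProj k l P) t := by
  have hP : ∀ a b, P.1 (Fin.natAdd k b) (Fin.castAdd l a) = 0 := P.2
  have hD : ∀ b a, modelD N b a ((1 : QPoly k l) ⊗ₜ t) = 0 := by
    intro b a; simp [modelD]
  have e : parabolicProj k l P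
      = ∑ a, ∑ c, P.1 (Fin.castAdd l a) (Fin.castAdd l c) • ((Matrix.single a c 1, 0) : Gl k × Gl l)
        + ∑ b, ∑ d, P.1 (Fin.natAdd k b) (Fin.natAdd k d)
          • ((0, Matrix.single b d 1) : Gl k × Gl l) := by
    refine Prod.ext ?_ ?_
    · simp only [Prod.fst_add, Prod.fst_sum, Prod.smul_fst, smul_zero, Finset.sum_const_zero,
        add_zero, Matrix.smul_single, smul_eq_mul, mul_one]
      exact Matrix.matrix_eq_sum_single _
    · simp only [Prod.snd_add, Prod.snd_sum, Prod.smul_snd, smul_zero, Finset.sum_const_zero,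
        zero_add, Matrix.smul_single, smul_eq_mul, mul_one]
      exact Matrix.matrix_eq_sum_single _
  rw [e]
  change (∑ i, ∑ j, P.1 i j • modelE ρ i j) _ = _
  simp only [Fin.sum_univ_add, hP, zero_smul, Finset.sum_const_zero, zero_add, map_add, map_sum,
    map_smul, LinearMap.add_apply, LinearMap.sum_apply, LinearMap.smul_apply, modelE,
    Fin.addCases_left, Fin.addCases_right, LinearMap.sub_apply, Module.End.mul_apply, hD,
    map_zero, sub_zero, smul_zero, add_zero, modelLevi, LinearMap.lTensor_tmul,
    TensorProduct.tmul_add, TensorProduct.tmul_sum, TensorProduct.tmul_smul]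

/-- The operators `modelLin ρ X` represent `gl_{k+l}`. The defect
`[φ X, φ Z] - φ [X, Z]` vanishes on `1 ⊗ N`, and by the relations with the variables the defect on
a multiple of a variable is expressed through defects on polynomials of lower degree. -/
theorem modelLin_lie (X Z : Gl (k + l)) :
    modelLin ρ ⁅X, Z⁆ = modelLin ρ X * modelLin ρ Z - modelLin ρ Z * modelLin ρ X := by
  have hq : ∀ X Z : Gl (k + l), Z ∈ nilQ k l →
      modelLin ρ ⁅X, Z⁆ = modelLin ρ X * modelLin ρ Z - modelLin ρ Z * modelLin ρ X := by
    intro X Z hZ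
    rw [eq_sum_of_mem_nilQ hZ]
    simp only [lie_sum, lie_smul, map_sum, map_smul, ← modelLin_bracket, modelLin_nilQ,
      Finset.mul_sum, Finset.sum_mul, mul_smul_comm, smul_mul_assoc, smul_sub,
      Finset.sum_sub_distrib]
  have hq' : ∀ X Z : Gl (k + l), X ∈ nilQ k l →
      modelLin ρ ⁅X, Z⁆ = modelLin ρ X * modelLin ρ Z - modelLin ρ Z * modelLin ρ X := by
    intro X Z hX
    rw [← lie_skew, map_neg, hq Z X hX, neg_sub]
  have h1 : ∀ (X Z : Gl (k + l)) (t : N), modelLin ρ ⁅X, Z⁆ (1 ⊗ₜ t)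
      = modelLin ρ X (modelLin ρ Z (1 ⊗ₜ t)) - modelLin ρ Z (modelLin ρ X (1 ⊗ₜ t)) := by
    intro X Z t
    obtain ⟨P, Q, hQ, rfl⟩ := exists_parabolic_add_nilQ X
    obtain ⟨P', Q', hQ', rfl⟩ := exists_parabolic_add_nilQ Z
    have e : ⁅(P : Gl (k + l)), (P' : Gl (k + l))⁆ = ((⁅P, P'⁆ : parabolic k l) : Gl (k + l)) :=
      rfl
    have e1 := LinearMap.congr_fun (hq P Q' hQ') ((1 : QPoly k l) ⊗ₜ[ℂ] t)
    have e2 := LinearMap.congr_fun (hq' Q P' hQ) ((1 : QPoly k l) ⊗ₜ[ℂ] t)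
    have e3 := LinearMap.congr_fun (hq Q Q' hQ') ((1 : QPoly k l) ⊗ₜ[ℂ] t)
    simp only [LinearMap.sub_apply, Module.End.mul_apply] at e1 e2 e3
    simp only [add_lie, lie_add, map_add, LinearMap.add_apply, e1, e2, e3]
    rw [e]
    simp only [modelLin_one_tmul]
    rw [LieHom.map_lie, LieHom.map_lie, LieRing.of_associative_ring_bracket, LinearMap.sub_apply,
      Module.End.mul_apply, Module.End.mul_apply, TensorProduct.tmul_sub]
    abel
  refine TensorProduct.ext' fun f t => ?_
  rw [LinearMap.sub_apply, Module.End.mul_apply, Module.End.mul_apply]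
  induction f using QPoly.induction generalizing X Z with
  | scalar c =>
    rw [TensorProduct.smul_tmul]
    exact h1 X Z _
  | add f g hf hg => simp only [TensorProduct.add_tmul, map_add, hf, hg]; abel
  | mul_X f b a hf =>
    set y : Gl (k + l) := Matrix.single (Fin.natAdd k b) (Fin.castAdd l a) 1 with hy
    have hY : ∀ X w, modelLin ρ X (modelY N b a w)
        = modelY N b a (modelLin ρ X w) + modelLin ρ ⁅X, y⁆ w := by
      intro X w
      rw [hy, ← modelLin_bracket, LinearMap.sub_apply, Module.End.mul_apply, Module.End.mul_apply]
      abel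
    have e : (QPoly.X b a * f) ⊗ₜ t = modelY N b a (f ⊗ₜ t) := rfl
    simp only [e, hY, map_add, hf, map_sub, lie_lie X Z y, LinearMap.sub_apply]
    abel

/-- The representation of `gl_{k+l}` on `ℂ[y] ⊗ N`. -/
noncomputable def modelLie :
    Gl (k + l) →ₗ⁅ℂ⁆ Module.End ℂ (QPoly k l ⊗[ℂ] N) :=
  { modelLin ρ with map_lie' := fun {X Z} => modelLin_lie ρ X Z }

end PolynomialModel

/-! ### The parabolically induced module -/

section InducedModule

variable (k l : ℕ) (V : Type u) (U : Type v) [AddCommGroup V] [Module ℂ V]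
  [LieRingModule (Gl k) V] [LieModule ℂ (Gl k) V] [AddCommGroup U] [Module ℂ U]
  [LieRingModule (Gl l) U] [LieModule ℂ (Gl l) U]

/-- The map `V ⊗ U → V ⊠ U`, `t ↦ 1 ⊗ t`. -/
noncomputable def parIncl : V ⊗[ℂ] U →ₗ[ℂ] ParInd k l V U :=
  ((inducedRel k l V U).mkQ.restrictScalars ℂ) ∘ₗ
    (TensorProduct.mk ℂ (UGl (k + l)) (V ⊗[ℂ] U) 1)

theorem lie_parIncl (P : parabolic k l) (t : V ⊗[ℂ] U) :
    ⁅(P : Gl (k + l)), parIncl k l V U t⁆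
      = parIncl k l V U (leviAction k l V U (parabolicProj k l P) t) := by
  refine (Submodule.Quotient.eq (inducedRel k l V U)).2 (Submodule.subset_span ⟨P, t, ?_⟩)
  change UniversalEnvelopingAlgebra.ι ℂ (P : Gl (k + l)) • ((1 : UGl (k + l)) ⊗ₜ[ℂ] t) - _ = _
  rw [TensorProduct.smul_tmul', smul_eq_mul, mul_one]
  rfl

/-- The comparison map from the induced module to its polynomial model. -/
theorem exists_parInd_model :
    ∃ G : ParInd k l V U →ₗ[ℂ] QPoly k l ⊗[ℂ] (V ⊗[ℂ] U),
      (∀ t, G (parIncl k l V U t) = 1 ⊗ₜ t) ∧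
      ∀ (X : Gl (k + l)) w, G ⁅X, w⁆ = modelLin (leviAction k l V U) X (G w) := by
  let φ := UniversalEnvelopingAlgebra.lift ℂ (modelLie (leviAction k l V U))
  let g : UGl (k + l) ⊗[ℂ] (V ⊗[ℂ] U) →ₗ[ℂ] QPoly k l ⊗[ℂ] (V ⊗[ℂ] U) :=
    TensorProduct.lift
      ((LinearMap.lcomp ℂ _ (TensorProduct.mk ℂ (QPoly k l) (V ⊗[ℂ] U) 1))
        ∘ₗ φ.toLinearMap)
  have g_tmul : ∀ u t, g (u ⊗ₜ t) = φ u (1 ⊗ₜ t) := fun u t => rfl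
  have hφ : ∀ X, φ (UniversalEnvelopingAlgebra.ι ℂ X) = modelLin (leviAction k l V U) X := by
    intro X
    exact UniversalEnvelopingAlgebra.lift_ι_apply ℂ _ _
  have g_smul : ∀ u z, g (u • z) = φ u (g z) := by
    intro u z
    induction z using TensorProduct.induction_on with
    | zero => simp
    | add x y hx hy => simp only [smul_add, map_add, hx, hy]
    | tmul u' t =>
      rw [TensorProduct.smul_tmul', g_tmul, g_tmul, smul_eq_mul, map_mul, Module.End.mul_apply]
  have hker : (inducedRel k l V U).restrictScalars ℂ ≤ LinearMap.ker g := by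
    intro z hz
    rw [LinearMap.mem_ker]
    refine Submodule.span_induction (p := fun z _ => g z = 0) ?_ ?_ ?_ ?_ hz
    · rintro _ ⟨P, t, rfl⟩
      rw [map_sub, g_tmul, g_tmul, hφ, modelLin_one_tmul, map_one, Module.End.one_apply, sub_self]
    · simp
    · intro x y _ _ hx hy; rw [map_add, hx, hy, add_zero]
    · intro u x _ hx; rw [g_smul, hx, map_zero]
  let G : ParInd k l V U →ₗ[ℂ] QPoly k l ⊗[ℂ] (V ⊗[ℂ] U) :=
    (((inducedRel k l V U).restrictScalars ℂ).liftQ g hker) ∘ₗ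
      (Submodule.Quotient.restrictScalarsEquiv ℂ (inducedRel k l V U)).symm.toLinearMap
  have hG : ∀ z, G ((inducedRel k l V U).mkQ z) = g z := fun z => rfl
  refine ⟨G, fun t => ?_, fun X w => ?_⟩
  · change G ((inducedRel k l V U).mkQ (1 ⊗ₜ t)) = _
    rw [hG, g_tmul, map_one, Module.End.one_apply]
  · obtain ⟨z, rfl⟩ := (inducedRel k l V U).mkQ_surjective w
    change G ((inducedRel k l V U).mkQ (UniversalEnvelopingAlgebra.ι ℂ X • z)) = _
    rw [hG, g_smul, hφ]
    rfl

/-- A subspace of the induced module that contains `V ⊗ U` and is stable under `𝔮` is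
everything. -/
theorem parInd_eq_top (S : Submodule ℂ (ParInd k l V U)) (h1 : ∀ t, parIncl k l V U t ∈ S)
    (hq : ∀ Q ∈ nilQ k l, ∀ w ∈ S, ⁅Q, w⁆ ∈ S) : S = ⊤ := by
  -- The smallest such subspace is stable under all of `gl_{k+l}`.
  let S₀ : Submodule ℂ (ParInd k l V U) :=
    sInf {S | (∀ t, parIncl k l V U t ∈ S) ∧ ∀ Q ∈ nilQ k l, ∀ w ∈ S, ⁅Q, w⁆ ∈ S}
  have hS₀ : S₀ ≤ S := sInf_le ⟨h1, hq⟩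
  have a1 : ∀ t, parIncl k l V U t ∈ S₀ := fun t =>
    Submodule.mem_sInf.2 fun S hS => hS.1 t
  have aq : ∀ Q ∈ nilQ k l, ∀ w ∈ S₀, ⁅Q, w⁆ ∈ S₀ := fun Q hQ w hw =>
    Submodule.mem_sInf.2 fun S hS => hS.2 Q hQ w (Submodule.mem_sInf.1 hw S hS)
  let T : Submodule ℂ (ParInd k l V U) :=
    { carrier := {w | w ∈ S₀ ∧ ∀ X : Gl (k + l), ⁅X, w⁆ ∈ S₀}
      add_mem' := fun {x y} hx hy =>
        ⟨add_mem hx.1 hy.1, fun X => by rw [lie_add]; exact add_mem (hx.2 X) (hy.2 X)⟩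
      zero_mem' := ⟨zero_mem _, fun X => by rw [lie_zero]; exact zero_mem _⟩
      smul_mem' := fun c x hx => ⟨S₀.smul_mem c hx.1, fun X => by
        rw [lie_smul]; exact S₀.smul_mem c (hx.2 X)⟩ }
  have hT : S₀ ≤ T := by
    refine sInf_le ⟨fun t => ⟨a1 t, fun X => ?_⟩, fun Q hQ w hw => ⟨aq Q hQ w hw.1, fun X => ?_⟩⟩
    · obtain ⟨P, Q, hQ, rfl⟩ := exists_parabolic_add_nilQ X
      rw [add_lie, lie_parIncl]
      exact add_mem (a1 _) (aq Q hQ _ (a1 t))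
    · rw [leibniz_lie]
      exact add_mem (hw.2 _) (aq Q hQ _ (hw.2 X))
  have hX : ∀ X : Gl (k + l), ∀ w ∈ S₀, ⁅X, w⁆ ∈ S₀ := fun X w hw => (hT hw).2 X
  have hu : ∀ (u : UGl (k + l)), ∀ w ∈ S₀, u • w ∈ S₀ := by
    have main : ∀ z : TensorAlgebra ℂ (Gl (k + l)), ∀ w ∈ S₀,
        UniversalEnvelopingAlgebra.mkAlgHom ℂ (Gl (k + l)) z • w ∈ S₀ := by
      intro z
      induction z using TensorAlgebra.induction with
      | algebraMap c =>
        intro w hw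
        rw [AlgHom.commutes, algebraMap_smul]
        exact S₀.smul_mem c hw
      | ι X => exact hX X
      | mul u u' h h' =>
        intro w hw
        rw [map_mul, mul_smul]
        exact h _ (h' w hw)
      | add u u' h h' =>
        intro w hw
        rw [map_add, add_smul]
        exact add_mem (h w hw) (h' w hw)
    intro u
    obtain ⟨z, rfl⟩ := RingCon.mk'_surjective (UniversalEnvelopingAlgebra.ringCon ℂ (Gl (k + l))) u
    exact main z
  refine eq_top_iff.2 fun w _ => hS₀ ?_
  obtain ⟨z, rfl⟩ : ∃ z, (inducedRel k l V U).mkQ z = w := (inducedRel k l V U).mkQ_surjective w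
  clear * - a1 hu
  induction z using TensorProduct.induction_on with
  | zero => exact zero_mem S₀
  | add x y hx hy =>
    rw [map_add]
    exact add_mem hx hy
  | tmul u t =>
    have e : (inducedRel k l V U).mkQ (u ⊗ₜ t) = u • parIncl k l V U t := by
      change _ = (inducedRel k l V U).mkQ (u • (1 ⊗ₜ t))
      rw [TensorProduct.smul_tmul', smul_eq_mul, mul_one]
    rw [e]
    exact hu u _ (a1 t)

end InducedModule

/-! ### The coinvariants as a vector space -/

section Coinvariants

theorem glAction_tmul (σ : VarKind) (p m n : ℕ) (V : Type u) [AddCommGroup V] [Module ℂ V]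
    [LieRingModule (Gl m) V] [LieModule ℂ (Gl m) V] (X : Gl m) (v : V) (f : Fock σ m n) :
    glAction σ p m n V X (v ⊗ₜ f) = ⁅X, v⁆ ⊗ₜ f + v ⊗ₜ zeta σ p m n X f := by
  change bigAction σ m n V (UniversalEnvelopingAlgebra.ι ℂ X ⊗ₜ[ℂ] 1
    + 1 ⊗ₜ[ℂ] zeta σ p m n X) (v ⊗ₜ f) = _
  rw [map_add, LinearMap.add_apply]
  congr 1
  · change UniversalEnvelopingAlgebra.lift ℂ (LieModule.toEnd ℂ (Gl m) V)
      (UniversalEnvelopingAlgebra.ι ℂ X) v ⊗ₜ f = _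
    rw [UniversalEnvelopingAlgebra.lift_ι_apply]
    rfl
  · change UniversalEnvelopingAlgebra.lift ℂ (LieModule.toEnd ℂ (Gl m) V) 1 v ⊗ₜ _ = _
    rw [map_one]
    rfl

open scoped IsMulCommutative in
/-- Commuting elements of an algebra define a homomorphism from the polynomial algebra. -/
theorem exists_aeval_of_commute {ι A : Type*} [Ring A] [Algebra ℂ A] (x : ι → A)
    (h : ∀ i j, x i * x j = x j * x i) :
    ∃ ψ : MvPolynomial ι ℂ →ₐ[ℂ] A, ∀ i, ψ (MvPolynomial.X i) = x i := by
  have := Algebra.isMulCommutative_adjoin ℂ (s := Set.range x)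
    (by rintro _ ⟨i, rfl⟩ _ ⟨j, rfl⟩; exact h i j)
  refine ⟨(Algebra.adjoin ℂ (Set.range x)).val.comp (MvPolynomial.aeval fun i =>
    (⟨x i, Algebra.subset_adjoin ⟨i, rfl⟩⟩ : Algebra.adjoin ℂ (Set.range x))), fun i => ?_⟩
  rw [AlgHom.comp_apply, MvPolynomial.aeval_X]
  rfl

variable (σ : VarKind) (n k l p₀ : ℕ)
  (V : Type u) (U : Type v) [AddCommGroup V] [Module ℂ V]
  [LieRingModule (Gl k) V] [LieModule ℂ (Gl k) V] [AddCommGroup U] [Module ℂ U]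
  [LieRingModule (Gl l) U] [LieModule ℂ (Gl l) U]

/-- The subspace `𝔮 ((V ⊠ U) ⊗ ℋ)`. -/
noncomputable def coinvRel : Submodule ℂ (ParInd k l V U ⊗[ℂ] Fock σ (k + l) n) :=
  Submodule.span ℂ {w | ∃ X ∈ nilQ k l, ∃ v, w = glAction σ p₀ (k + l) n (ParInd k l V U) X v}

/-- The space of `𝔮`-coinvariants of `(V ⊠ U) ⊗ ℋ`. -/
abbrev Coinv : Type _ := (ParInd k l V U ⊗[ℂ] Fock σ (k + l) n) ⧸ coinvRel σ n k l p₀ V U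

/-- The map from `(V ⊠ U) ⊗ ℋ` to its `𝔮`-coinvariants. -/
noncomputable def toCoinv : ParInd k l V U ⊗[ℂ] Fock σ (k + l) n →ₗ[ℂ]
    Coinv σ n k l p₀ V U :=
  (coinvRel σ n k l p₀ V U).mkQ

theorem toCoinv_surjective : Function.Surjective (toCoinv σ n k l p₀ V U) :=
  Submodule.mkQ_surjective _

/-- In the coinvariants an element of `𝔮` may be moved from the first factor to the second. -/
theorem toCoinv_lie {Q : Gl (k + l)} (hQ : Q ∈ nilQ k l) (w : ParInd k l V U)
    (f : Fock σ (k + l) n) :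
    toCoinv σ n k l p₀ V U (⁅Q, w⁆ ⊗ₜ f)
      = - toCoinv σ n k l p₀ V U (w ⊗ₜ zeta σ p₀ (k + l) n Q f) := by
  rw [← sub_eq_zero, sub_neg_eq_add, ← map_add]
  rw [← glAction_tmul]
  exact (Submodule.Quotient.mk_eq_zero _).2 (Submodule.subset_span ⟨Q, hQ, _, rfl⟩)

/-- The map `(V ⊗ U) ⊗ ℋ → ((V ⊠ U) ⊗ ℋ)_𝔮`. -/
noncomputable def coinvIncl : (V ⊗[ℂ] U) ⊗[ℂ] Fock σ (k + l) n →ₗ[ℂ]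
    Coinv σ n k l p₀ V U :=
  toCoinv σ n k l p₀ V U ∘ₗ (parIncl k l V U).rTensor _

theorem coinvIncl_tmul (t : V ⊗[ℂ] U) (f : Fock σ (k + l) n) :
    coinvIncl σ n k l p₀ V U (t ⊗ₜ f)
      = toCoinv σ n k l p₀ V U (parIncl k l V U t ⊗ₜ f) := rfl

/-- Elements of `𝔮` can be moved from `V ⊠ U = U(𝔮) (V ⊗ U)` to the Fock space. -/
theorem coinvIncl_surjective : Function.Surjective (coinvIncl σ n k l p₀ V U) := by
  let S : Submodule ℂ (ParInd k l V U) :=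
    { carrier := {w | ∀ f, toCoinv σ n k l p₀ V U (w ⊗ₜ f)
        ∈ LinearMap.range (coinvIncl σ n k l p₀ V U)}
      add_mem' := fun {x y} hx hy f => by
        rw [TensorProduct.add_tmul, map_add]
        exact add_mem (hx f) (hy f)
      zero_mem' := fun f => by
        rw [TensorProduct.zero_tmul, map_zero]
        exact zero_mem _
      smul_mem' := fun c x hx f => by
        rw [← TensorProduct.smul_tmul', map_smul]
        exact Submodule.smul_mem _ c (hx f) }
  have hS : S = ⊤ := by
    refine parInd_eq_top k l V U S (fun t f => ⟨t ⊗ₜ f, rfl⟩) fun Q hQ w hw f => ?_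
    rw [toCoinv_lie σ n k l p₀ V U hQ]
    exact neg_mem (hw _)
  intro x
  obtain ⟨z, rfl⟩ := toCoinv_surjective σ n k l p₀ V U x
  rw [← Set.mem_range, ← LinearMap.coe_range, SetLike.mem_coe]
  induction z using TensorProduct.induction_on with
  | zero => rw [map_zero]; exact zero_mem _
  | add x y hx hy => rw [map_add]; exact add_mem hx hy
  | tmul w f => exact (hS ▸ Submodule.mem_top : w ∈ S) f

/-- A left inverse is obtained from the polynomial model of `V ⊠ U`: it sends `(y ⊗ t) ⊗ f` to
`t ⊗ y' f`, where `y'` is the image of `y` under the antipode of `U(𝔮)`. -/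
theorem coinvIncl_injective : Function.Injective (coinvIncl σ n k l p₀ V U) := by
  obtain ⟨G, hG1, hG2⟩ := exists_parInd_model k l V U
  let y : Fin l × Fin k → Gl (k + l) := fun x =>
    Matrix.single (Fin.natAdd k x.1) (Fin.castAdd l x.2) 1
  have hy : ∀ x x', ⁅y x, y x'⁆ = 0 := by
    intro x x'
    simp [y, single_lie, castAdd_ne_natAdd, (castAdd_ne_natAdd _ _).symm]
  obtain ⟨ψ₀, hψ₀⟩ := exists_aeval_of_commute (fun x => - zeta σ p₀ (k + l) n (y x)) (by
    intro x x'
    have := (zeta σ p₀ (k + l) n).map_lie (y x) (y x')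
    rw [hy, map_zero, LieRing.of_associative_ring_bracket, eq_comm, sub_eq_zero] at this
    rw [neg_mul_neg, neg_mul_neg, this])
  let ψ : QPoly k l →ₐ[ℂ] Module.End ℂ (Fock σ (k + l) n) := ψ₀
  have hψ : ∀ b a, ψ (QPoly.X b a) = - zeta σ p₀ (k + l) n
      (Matrix.single (Fin.natAdd k b) (Fin.castAdd l a) 1) := fun b a => hψ₀ (b, a)
  let R : (QPoly k l ⊗[ℂ] (V ⊗[ℂ] U)) ⊗[ℂ] Fock σ (k + l) n →ₗ[ℂ]
      (V ⊗[ℂ] U) ⊗[ℂ] Fock σ (k + l) n :=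
    TensorProduct.lift (TensorProduct.lift (LinearMap.mk₂ ℂ
      (fun s t => (TensorProduct.mk ℂ (V ⊗[ℂ] U) (Fock σ (k + l) n) t) ∘ₗ ψ s)
      (fun s s' t => by rw [map_add, LinearMap.comp_add])
      (fun c s t => by rw [map_smul, LinearMap.comp_smul])
      (fun s t t' => by rw [map_add, LinearMap.add_comp])
      (fun c s t => by rw [map_smul, LinearMap.smul_comp])))
  have hR : ∀ s t f, R ((s ⊗ₜ t) ⊗ₜ f) = t ⊗ₜ ψ s f := fun s t f => rfl
  have hRY : ∀ b a z f, R (modelY (V ⊗[ℂ] U) b a z ⊗ₜ f)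
      = - R (z ⊗ₜ zeta σ p₀ (k + l) n
        (Matrix.single (Fin.natAdd k b) (Fin.castAdd l a) 1) f) := by
    intro b a z f
    induction z using TensorProduct.induction_on with
    | zero => simp
    | add x y hx hy => simp only [map_add, TensorProduct.add_tmul, hx, hy, neg_add]
    | tmul s t =>
      change R (((QPoly.X b a * s) ⊗ₜ t) ⊗ₜ f) = _
      rw [hR, hR, mul_comm, map_mul, hψ, Module.End.mul_apply, LinearMap.neg_apply, map_neg,
        TensorProduct.tmul_neg]
  have hker : coinvRel σ n k l p₀ V U
      ≤ LinearMap.ker (R ∘ₗ G.rTensor (Fock σ (k + l) n)) := by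
    refine Submodule.span_le.2 ?_
    rintro _ ⟨Q, hQ, z, rfl⟩
    rw [SetLike.mem_coe, LinearMap.mem_ker]
    induction z using TensorProduct.induction_on with
    | zero => simp only [map_zero]
    | add x y hx hy => simp only [map_add, hx, hy, add_zero]
    | tmul w f =>
      have e := eq_sum_of_mem_nilQ hQ
      rw [glAction_tmul, map_add, LinearMap.comp_apply, LinearMap.comp_apply,
        LinearMap.rTensor_tmul, LinearMap.rTensor_tmul, hG2, e]
      simp only [map_sum, map_smul, modelLin_nilQ, LinearMap.sum_apply, LinearMap.smul_apply,
        TensorProduct.sum_tmul, TensorProduct.tmul_sum, TensorProduct.tmul_smul,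
        ← TensorProduct.smul_tmul', hRY, smul_neg, Finset.sum_neg_distrib, neg_add_cancel]
  let L := (coinvRel σ n k l p₀ V U).liftQ _ hker
  refine Function.LeftInverse.injective (g := L) fun z => ?_
  induction z using TensorProduct.induction_on with
  | zero => simp only [map_zero]
  | add x y hx hy => simp only [map_add, hx, hy]
  | tmul t f =>
    change R (G (parIncl k l V U t) ⊗ₜ f) = _
    rw [hG1, hR, map_one, Module.End.one_apply]

end Coinvariants

/-! ### The action of `X(u)` on the induced module -/

section Resolvent

/-- The coefficients of `u⁻¹ f(u) g(u)`, for series `f` and `g` in `u⁻¹`. -/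
def convSum {A : Type*} [Ring A] (f g : ℕ → A) : ℕ → A
  | 0 => 0
  | s + 1 => ∑ x ∈ Finset.HasAntidiagonal.antidiagonal s, f x.1 * g x.2

theorem convSum_succ {A : Type*} [Ring A] (f g : ℕ → A) (s : ℕ) :
    convSum f g (s + 1) = f s * g 0 + convSum f (fun j => g (j + 1)) s := by
  cases s with
  | zero => simp [convSum]
  | succ s => simp only [convSum, Finset.Nat.sum_antidiagonal_succ']

theorem convSum_add {A : Type*} [Ring A] (f g g' : ℕ → A) (s : ℕ) :
    convSum f (fun j => g j + g' j) s = convSum f g s + convSum f g' s := by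
  cases s <;> simp [convSum, mul_add, Finset.sum_add_distrib]

theorem convSum_smul {A : Type*} [Ring A] [Algebra ℂ A] (f g : ℕ → A) (c : ℂ) (s : ℕ) :
    convSum f (fun j => c • g j) s = c • convSum f g s := by
  cases s <;> simp [convSum, Finset.smul_sum]

theorem convSum_mul {A : Type*} [Ring A] (f g : ℕ → A) (z : A) (s : ℕ) :
    convSum f (fun j => g j * z) s = convSum f g s * z := by
  cases s <;> simp [convSum, Finset.sum_mul, mul_assoc]

theorem convSum_sum {A ι : Type*} [Ring A] [Fintype ι] (f : ℕ → A) (g : ι → ℕ → A) (s : ℕ) :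
    convSum f (fun j => ∑ e, g e j) s = ∑ e, convSum f (g e) s := by
  cases s with
  | zero => simp [convSum]
  | succ s =>
    simp only [convSum, Finset.mul_sum]
    rw [Finset.sum_comm]

theorem coeffX_zero (σ : VarKind) (m : ℕ) : coeffX σ m 0 = 1 := by
  simp [coeffX]

theorem coeffX_succ (σ : VarKind) (m s : ℕ) (i j : Fin m) :
    coeffX σ m (s + 1) i j = (-σ.sign) • ∑ e, coeffX σ m s i e * genE j e := by
  simp only [coeffX, pow_succ, Matrix.smul_apply, Matrix.mul_apply, smul_mul_assoc,
    ← Finset.smul_sum, smul_smul, mul_comm]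
  rfl

/-- The bracket of a matrix unit with an entry of `X(u)`, as a rule for moving the matrix unit
to the left. -/
theorem coeffX_mul_genE (σ : VarKind) (m s : ℕ) (a b h g : Fin m) :
    coeffX σ m s a b * genE h g = genE h g * coeffX σ m s a b
      - (if b = g then 1 else 0) * coeffX σ m s a h
      + (if a = h then 1 else 0) * coeffX σ m s g b := by
  have := (isGlFamily_genE m).equivariant s h g a b
  simp only [coeffX, Matrix.smul_apply, smul_mul_assoc, mul_smul_comm]
  rw [sub_add, ← smul_sub, ← this, ← smul_sub, sub_sub_cancel]

/-- The coefficient of `u ^ (-s - 1)` in the shifted matrix `X(u - θ z)`; it is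
`(θ z - θ E') ^ s`. -/
noncomputable def coeffXShift (σ : VarKind) (m : ℕ) (z : ℂ) (s : ℕ) :
    Matrix (Fin m) (Fin m) (UGl m) :=
  ((-σ.sign) • transposeMatrix (genE (m := m)) + (σ.sign * z) • 1) ^ s

theorem coeffXShift_zero (σ : VarKind) (m : ℕ) (z : ℂ) : coeffXShift σ m z 0 = 1 := pow_zero _

theorem coeffXShift_succ (σ : VarKind) (m : ℕ) (z : ℂ) (s : ℕ) (i j : Fin m) :
    coeffXShift σ m z (s + 1) i j = (-σ.sign) • ∑ e, coeffXShift σ m z s i e * genE j e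
      + (σ.sign * z) • coeffXShift σ m z s i j := by
  rw [coeffXShift, pow_succ, mul_add, Matrix.add_apply, mul_smul_comm, mul_smul_comm, mul_one,
    Matrix.smul_apply, Matrix.smul_apply, Matrix.mul_apply]
  rfl

theorem coeffXShift_eq_sum (σ : VarKind) (m : ℕ) (z : ℂ) (s : ℕ) :
    coeffXShift σ m z s = ∑ r ∈ Finset.range (s + 1),
      ((s.choose r : ℂ) * (σ.sign * z) ^ (s - r)) • coeffX σ m r := by
  have hc : Commute ((-σ.sign) • transposeMatrix (genE (m := m))) ((σ.sign * z) • 1) :=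
    (Commute.one_right _).smul_right _
  rw [coeffXShift, hc.add_pow]
  refine Finset.sum_congr rfl fun r _ => ?_
  rw [smul_pow, smul_pow, one_pow, mul_smul_comm, mul_one, ← nsmul_eq_mul', mul_smul, coeffX,
    ← Nat.cast_smul_eq_nsmul ℂ]

variable (σ : VarKind) (k l : ℕ) (V : Type u) (U : Type v) [AddCommGroup V] [Module ℂ V]
  [LieRingModule (Gl k) V] [LieModule ℂ (Gl k) V] [AddCommGroup U] [Module ℂ U]
  [LieRingModule (Gl l) U] [LieModule ℂ (Gl l) U]

/-- The action of `U(gl_m)` on a `gl_m`-module. -/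
noncomputable def envAction (m : ℕ) (M : Type*) [AddCommGroup M] [Module ℂ M]
    [LieRingModule (Gl m) M] [LieModule ℂ (Gl m) M] : UGl m →ₐ[ℂ] Module.End ℂ M :=
  UniversalEnvelopingAlgebra.lift ℂ (LieModule.toEnd ℂ (Gl m) M)

/-- The action of `U(gl_k)` on the first factor of `V ⊗ U`. -/
noncomputable def actLeft : UGl k →ₐ[ℂ] Module.End ℂ (V ⊗[ℂ] U) :=
  (Module.End.rTensorAlgHom ℂ V U).comp (envAction k V)

/-- The action of `U(gl_l)` on the second factor of `V ⊗ U`. -/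
noncomputable def actRight : UGl l →ₐ[ℂ] Module.End ℂ (V ⊗[ℂ] U) :=
  (Module.End.lTensorAlgHom ℂ U V).comp (envAction l U)

theorem actLeft_tmul (x : UGl k) (v : V) (w : U) :
    actLeft k V U x (v ⊗ₜ w) = envAction k V x v ⊗ₜ w := rfl

theorem actRight_tmul (x : UGl l) (v : V) (w : U) :
    actRight l V U x (v ⊗ₜ w) = v ⊗ₜ envAction l U x w := rfl

theorem parabolicProj_apply {k l : ℕ} (P : parabolic k l) :
    parabolicProj k l P = (P.1.submatrix (Fin.castAdd l) (Fin.castAdd l),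
      P.1.submatrix (Fin.natAdd k) (Fin.natAdd k)) := rfl

theorem genE_smul_left (a c : Fin k) (t : V ⊗[ℂ] U) :
    genE (Fin.castAdd l a) (Fin.castAdd l c) • parIncl k l V U t
      = parIncl k l V U (actLeft k V U (genE a c) t) := by
  let P : parabolic k l := ⟨Matrix.single (Fin.castAdd l a) (Fin.castAdd l c) 1, fun a' b =>
    Matrix.single_apply_of_row_ne (castAdd_ne_natAdd a b) _ _ _⟩
  refine (lie_parIncl k l V U P t).trans ?_
  have hP : parabolicProj k l P = (Matrix.single a c 1, 0) := by
    rw [parabolicProj_apply]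
    refine Prod.ext (Matrix.ext fun i j => ?_) (Matrix.ext fun i j => ?_) <;>
      simp [P, Matrix.single_apply, castAdd_ne_natAdd]
  rw [hP]
  congr 1
  have e : leviAction k l V U (Matrix.single a c 1, 0) = actLeft k V U (genE a c) := by
    change (LieModule.toEnd ℂ (Gl k) V (Matrix.single a c 1)).rTensor U
      + (LieModule.toEnd ℂ (Gl l) U 0).lTensor V
      = (UniversalEnvelopingAlgebra.lift ℂ (LieModule.toEnd ℂ (Gl k) V)
        (UniversalEnvelopingAlgebra.ι ℂ (Matrix.single a c 1))).rTensor U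
    rw [UniversalEnvelopingAlgebra.lift_ι_apply, map_zero, LinearMap.lTensor_zero, add_zero]
  rw [e]

theorem genE_smul_right (b d : Fin l) (t : V ⊗[ℂ] U) :
    genE (Fin.natAdd k b) (Fin.natAdd k d) • parIncl k l V U t
      = parIncl k l V U (actRight l V U (genE b d) t) := by
  let P : parabolic k l := ⟨Matrix.single (Fin.natAdd k b) (Fin.natAdd k d) 1, fun a' b =>
    Matrix.single_apply_of_col_ne _ _ (castAdd_ne_natAdd a' d).symm _⟩
  refine (lie_parIncl k l V U P t).trans ?_
  have hP : parabolicProj k l P = (0, Matrix.single b d 1) := by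
    rw [parabolicProj_apply]
    refine Prod.ext (Matrix.ext fun i j => ?_) (Matrix.ext fun i j => ?_) <;>
      simp [P, Matrix.single_apply, (castAdd_ne_natAdd _ _).symm]
  rw [hP]
  congr 1
  have e : leviAction k l V U (0, Matrix.single b d 1) = actRight l V U (genE b d) := by
    change (LieModule.toEnd ℂ (Gl k) V 0).rTensor U
      + (LieModule.toEnd ℂ (Gl l) U (Matrix.single b d 1)).lTensor V
      = (UniversalEnvelopingAlgebra.lift ℂ (LieModule.toEnd ℂ (Gl l) U)
        (UniversalEnvelopingAlgebra.ι ℂ (Matrix.single b d 1))).lTensor V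
    rw [UniversalEnvelopingAlgebra.lift_ι_apply, map_zero, LinearMap.rTensor_zero, zero_add]
  rw [e]

theorem genE_smul_nilradical (a : Fin k) (b : Fin l) (t : V ⊗[ℂ] U) :
    genE (Fin.castAdd l a) (Fin.natAdd k b) • parIncl k l V U t = 0 := by
  let P : parabolic k l := ⟨Matrix.single (Fin.castAdd l a) (Fin.natAdd k b) 1, fun a' b =>
    Matrix.single_apply_of_row_ne (castAdd_ne_natAdd a b) _ _ _⟩
  refine (lie_parIncl k l V U P t).trans ?_
  have hP : parabolicProj k l P = 0 := by
    rw [parabolicProj_apply]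
    refine Prod.ext (Matrix.ext fun i j => ?_) (Matrix.ext fun i j => ?_) <;>
      simp [P, castAdd_ne_natAdd, (castAdd_ne_natAdd _ _).symm]
  rw [hP, map_zero, LinearMap.zero_apply, map_zero]

/-- The coefficients of the block of `X(u)` that acts as `X(u)` for `gl_k` on `V ⊗ U`. -/
noncomputable def xLeft (a c : Fin k) (s : ℕ) : Module.End ℂ (V ⊗[ℂ] U) :=
  actLeft k V U (coeffX σ k s a c)

/-- The coefficients of `X(u - θ k)` for `gl_l`, acting on `V ⊗ U`. -/
noncomputable def xRight (b d : Fin l) (s : ℕ) : Module.End ℂ (V ⊗[ℂ] U) :=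
  actRight l V U (coeffXShift σ l k s b d)

theorem smul_comm_env {m : ℕ} {M : Type*} [AddCommGroup M] [Module (UGl m) M] [Module ℂ M]
    [IsScalarTower ℂ (UGl m) M] (c : ℂ) (x : UGl m) (w : M) : x • c • w = c • x • w := by
  rw [← algebraMap_smul (UGl m) c w, ← algebraMap_smul (UGl m) c (x • w), ← mul_smul, ← mul_smul,
    Algebra.commutes]

theorem coeffX_left_left (s : ℕ) (a c : Fin k) (t : V ⊗[ℂ] U) :
    coeffX σ (k + l) s (Fin.castAdd l a) (Fin.castAdd l c) • parIncl k l V U t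
      = parIncl k l V U (xLeft σ k V U a c s t) := by
  induction s generalizing c t with
  | zero =>
    simp only [xLeft, coeffX_zero, Matrix.one_apply, (Fin.castAdd_injective k l).eq_iff]
    split_ifs <;> simp
  | succ s ih =>
    simp only [xLeft, coeffX_succ, Fin.sum_univ_add, smul_assoc, add_smul, Finset.sum_smul,
      mul_smul, genE_smul_left, genE_smul_nilradical, smul_zero, Finset.sum_const_zero, add_zero,
      ih, map_smul, map_sum, map_mul, LinearMap.smul_apply, LinearMap.sum_apply,
      Module.End.mul_apply]

theorem coeffX_right_left (s : ℕ) (b : Fin l) (c : Fin k) (t : V ⊗[ℂ] U) :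
    coeffX σ (k + l) s (Fin.natAdd k b) (Fin.castAdd l c) • parIncl k l V U t = 0 := by
  induction s generalizing c t with
  | zero => simp [coeffX_zero, (castAdd_ne_natAdd _ _).symm]
  | succ s ih =>
    simp only [coeffX_succ, Fin.sum_univ_add, smul_assoc, add_smul, Finset.sum_smul,
      mul_smul, genE_smul_left, genE_smul_nilradical, smul_zero, Finset.sum_const_zero, add_zero,
      ih]

omit [LieRingModule (Gl k) V] [LieModule ℂ (Gl k) V] in
theorem xRight_zero (b d : Fin l) : xRight σ k l V U b d 0 = if b = d then 1 else 0 := by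
  simp only [xRight, coeffXShift_zero, Matrix.one_apply]
  split_ifs <;> simp

omit [LieRingModule (Gl k) V] [LieModule ℂ (Gl k) V] in
theorem xRight_succ (b d : Fin l) (s : ℕ) :
    xRight σ k l V U b d (s + 1)
      = (-σ.sign) • ∑ e, xRight σ k l V U b e s * actRight l V U (genE d e)
        + (σ.sign * k) • xRight σ k l V U b d s := by
  simp only [xRight, coeffXShift_succ, map_add, map_smul, map_sum, map_mul]

omit [LieRingModule (Gl k) V] [LieModule ℂ (Gl k) V] in
theorem convSum_xRight_succ (f : ℕ → Module.End ℂ (V ⊗[ℂ] U)) (b d : Fin l) (s : ℕ) :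
    convSum f (xRight σ k l V U b d) (s + 1)
      = (if b = d then f s else 0)
        + ((-σ.sign) • ∑ e, convSum f (xRight σ k l V U b e) s * actRight l V U (genE d e)
          + (σ.sign * k) • convSum f (xRight σ k l V U b d) s) := by
  rw [convSum_succ]
  simp only [xRight_succ, convSum_add, convSum_smul, convSum_sum, convSum_mul, xRight_zero, mul_ite,
    mul_one, mul_zero]

/-- Applying the last column block of `X(u)` to `V ⊗ U`: the factors from `𝔮` are moved to the
left, which produces the shift of the spectral parameter by `θ k`. -/
theorem coeffX_succ_right_smul (s : ℕ) (i : Fin (k + l)) (d : Fin l) (t : V ⊗[ℂ] U) :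
    coeffX σ (k + l) (s + 1) i (Fin.natAdd k d) • parIncl k l V U t
      = (-σ.sign) • ∑ c, (genE (Fin.natAdd k d) (Fin.castAdd l c)
          • coeffX σ (k + l) s i (Fin.castAdd l c) • parIncl k l V U t
          + (if i = Fin.natAdd k d then (1 : ℂ) else 0)
            • parIncl k l V U (xLeft σ k V U c c s t))
        + ((-σ.sign) • ∑ e, coeffX σ (k + l) s i (Fin.natAdd k e)
            • parIncl k l V U (actRight l V U (genE d e) t)
          + (σ.sign * k) • coeffX σ (k + l) s i (Fin.natAdd k d) • parIncl k l V U t) := by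
  have h : ∀ c : Fin k, (coeffX σ (k + l) s i (Fin.castAdd l c)
      * genE (Fin.natAdd k d) (Fin.castAdd l c)) • parIncl k l V U t
      = genE (Fin.natAdd k d) (Fin.castAdd l c)
          • coeffX σ (k + l) s i (Fin.castAdd l c) • parIncl k l V U t
        + (if i = Fin.natAdd k d then (1 : ℂ) else 0) • parIncl k l V U (xLeft σ k V U c c s t)
        - coeffX σ (k + l) s i (Fin.natAdd k d) • parIncl k l V U t := by
    intro c
    rw [coeffX_mul_genE, if_pos rfl, one_mul, add_smul, sub_smul, mul_smul, ite_mul, one_mul,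
      zero_mul, ite_smul, zero_smul, coeffX_left_left, ite_smul, one_smul, zero_smul]
    abel
  have h' : ∀ e : Fin l, (coeffX σ (k + l) s i (Fin.natAdd k e)
      * genE (Fin.natAdd k d) (Fin.natAdd k e)) • parIncl k l V U t
      = coeffX σ (k + l) s i (Fin.natAdd k e) • parIncl k l V U (actRight l V U (genE d e) t) :=
    fun e => by rw [mul_smul, genE_smul_right]
  rw [coeffX_succ, Fin.sum_univ_add, smul_assoc, add_smul, Finset.sum_smul, Finset.sum_smul,
    Finset.sum_congr rfl fun c _ => h c, Finset.sum_congr rfl fun e _ => h' e,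
    Finset.sum_sub_distrib, Finset.sum_const, Finset.card_univ, Fintype.card_fin,
    ← Nat.cast_smul_eq_nsmul ℂ]
  have key : ∀ x y z : ParInd k l V U, (-σ.sign) • (x - (k : ℂ) • y + z)
      = (-σ.sign) • x + ((-σ.sign) • z + (σ.sign * k) • y) := by
    intro x y z
    module
  exact key _ _ _

/-- On `V ⊗ U` the lower right block of `X(u)` acts as `(1 - θ tr X_k(u)) X_l(u - θ k)`, where
`X_k` and `X_l` are the matrices for `gl_k` and `gl_l`. -/
theorem coeffX_right_right (s : ℕ) (b d : Fin l) (t : V ⊗[ℂ] U) :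
    coeffX σ (k + l) s (Fin.natAdd k b) (Fin.natAdd k d) • parIncl k l V U t
      = parIncl k l V U (xRight σ k l V U b d s t)
        - σ.sign • ∑ c, parIncl k l V U
          (convSum (xLeft σ k V U c c) (xRight σ k l V U b d) s t) := by
  induction s generalizing d t with
  | zero =>
    simp only [coeffX_zero, Matrix.one_apply, (Fin.natAdd_injective l k).eq_iff, xRight_zero,
      convSum]
    split_ifs <;> simp
  | succ s ih =>
    rw [coeffX_succ_right_smul]
    simp only [coeffX_right_left, smul_zero, zero_add, ih, xRight_succ, convSum_xRight_succ,
      (Fin.natAdd_injective l k).eq_iff, LinearMap.add_apply, LinearMap.smul_apply,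
      LinearMap.sum_apply, Module.End.mul_apply, map_add, map_smul, map_sum,
      Finset.sum_add_distrib, ← Finset.smul_sum, Finset.sum_sub_distrib]
    rw [Finset.sum_comm (s := (Finset.univ : Finset (Fin k)))]
    split_ifs <;> simp only [one_smul, zero_smul, LinearMap.zero_apply, map_zero,
      Finset.sum_const_zero] <;> module

/-- On `V ⊗ U` the upper right block of `X(u)` acts through elements of `𝔮`, which stand on the
left, where passing to the coinvariants moves them to the Fock space. -/
theorem coeffX_left_right (s : ℕ) (a : Fin k) (d : Fin l) (t : V ⊗[ℂ] U) :
    coeffX σ (k + l) s (Fin.castAdd l a) (Fin.natAdd k d) • parIncl k l V U t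
      = (-σ.sign) • ∑ b, ∑ c, genE (Fin.natAdd k b) (Fin.castAdd l c)
        • parIncl k l V U (convSum (xLeft σ k V U a c) (xRight σ k l V U b d) s t) := by
  induction s generalizing d t with
  | zero => simp [coeffX_zero, castAdd_ne_natAdd, convSum]
  | succ s ih =>
    rw [coeffX_succ_right_smul]
    have h0 : ∑ b, ∑ c, genE (Fin.natAdd k b) (Fin.castAdd l c)
        • parIncl k l V U ((if b = d then xLeft σ k V U a c s else 0) t)
        = ∑ c, genE (Fin.natAdd k d) (Fin.castAdd l c)
          • parIncl k l V U (xLeft σ k V U a c s t) := by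
      rw [Finset.sum_eq_single d]
      · simp
      · intro b _ hb; simp [hb]
      · simp
    have h1 : ∑ b, ∑ c, genE (Fin.natAdd k b) (Fin.castAdd l c)
        • ∑ e, parIncl k l V U (convSum (xLeft σ k V U a c) (xRight σ k l V U b e) s
          (actRight l V U (genE d e) t))
        = ∑ e, ∑ b, ∑ c, genE (Fin.natAdd k b) (Fin.castAdd l c)
        • parIncl k l V U (convSum (xLeft σ k V U a c) (xRight σ k l V U b e) s
          (actRight l V U (genE d e) t)) := by
      simp only [Finset.smul_sum]
      rw [Finset.sum_congr rfl fun b _ => Finset.sum_comm, Finset.sum_comm]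
    simp only [castAdd_ne_natAdd, if_false, zero_smul, add_zero, coeffX_left_left, ih,
      convSum_xRight_succ, LinearMap.add_apply, LinearMap.smul_apply, LinearMap.sum_apply,
      Module.End.mul_apply, map_add, map_smul, map_sum, smul_add, Finset.smul_sum,
      Finset.sum_add_distrib, smul_comm_env]
    simp only [← Finset.smul_sum, h0, h1]
    module

end Resolvent

/-! ### The Yangian actions on generators -/

section Generators

/-- A linear map that intertwines the generators of the Yangian intertwines the Yangian
actions. -/
theorem Yangian.intertwine {n : ℕ} {X Z : Type*} [AddCommGroup X] [Module ℂ X] [AddCommGroup Z]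
    [Module ℂ Z] (φ : Yangian n →ₐ[ℂ] Module.End ℂ X) (ψ : Yangian n →ₐ[ℂ] Module.End ℂ Z)
    (e : X →ₗ[ℂ] Z)
    (h : ∀ s i j x, e (φ (Yangian.T n (s + 1) i j) x) = ψ (Yangian.T n (s + 1) i j) (e x))
    (y : Yangian n) (x : X) : e (φ y x) = ψ y (e x) := by
  obtain ⟨y, rfl⟩ : ∃ z : FreeAlgebra ℂ (ℕ × Fin n × Fin n),
      (RingQuot.mkAlgHom ℂ (YangianRel n) z : Yangian n) = y :=
    RingQuot.mkAlgHom_surjective ℂ (YangianRel n) y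
  let m : FreeAlgebra ℂ (ℕ × Fin n × Fin n) →ₐ[ℂ] Yangian n :=
    RingQuot.mkAlgHom ℂ (YangianRel n)
  change e (φ (m y) x) = ψ (m y) (e x)
  induction y using FreeAlgebra.induction generalizing x with
  | grade0 c =>
    rw [AlgHom.commutes, AlgHom.commutes, AlgHom.commutes, Module.algebraMap_end_apply,
      Module.algebraMap_end_apply, map_smul]
  | grade1 z => exact h z.1 z.2.1 z.2.2 x
  | mul y y' hy hy' =>
    rw [map_mul, map_mul, map_mul, Module.End.mul_apply, Module.End.mul_apply, hy, hy']
  | add y y' hy hy' =>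
    rw [map_add, map_add, map_add, LinearMap.add_apply, LinearMap.add_apply, map_add, hy, hy']

/-- The comultiplication formula with the terms `T^(0) = δ` split off. -/
theorem convFamily_succ {n : ℕ} {A : Type*} [Ring A] (t s : ℕ → Fin n → Fin n → A)
    (ht : ∀ i j, t 0 i j = if i = j then 1 else 0) (hs : ∀ i j, s 0 i j = if i = j then 1 else 0)
    (r : ℕ) (i j : Fin n) :
    convFamily t s (r + 1) i j = t (r + 1) i j + s (r + 1) i j
      + ∑ k, convSum (fun x => t (x + 1) i k) (fun x => s (x + 1) k j) r := by
  have e : ∀ k, ∑ x ∈ Finset.HasAntidiagonal.antidiagonal r, t (x.1 + 1) i k * s x.2 k j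
      = t (r + 1) i k * s 0 k j
        + convSum (fun x => t (x + 1) i k) (fun x => s (x + 1) k j) r := by
    intro k
    cases r with
    | zero => simp [convSum]
    | succ r => rw [Finset.Nat.sum_antidiagonal_succ']; rfl
  simp only [convFamily, Finset.Nat.sum_antidiagonal_succ, e, Finset.sum_add_distrib, ht, hs]
  simp
  abel

/-- The tensor product of two actions of the Yangian, through the comultiplication. -/
noncomputable def tensorAction {n : ℕ} {X : Type u} {Z : Type v} [AddCommGroup X] [Module ℂ X]
    [AddCommGroup Z] [Module ℂ Z] (φ : Yangian n →ₐ[ℂ] Module.End ℂ X)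
    (ψ : Yangian n →ₐ[ℂ] Module.End ℂ Z) : Yangian n →ₐ[ℂ] Module.End ℂ (X ⊗[ℂ] Z) :=
  ((Module.endTensorEndAlgHom (R := ℂ) (S := ℂ) (A := ℂ)).comp
    (Algebra.TensorProduct.map φ ψ)).comp (Yangian.comul n)

theorem tensorAction_T {n : ℕ} {X : Type u} {Z : Type v} [AddCommGroup X] [Module ℂ X]
    [AddCommGroup Z] [Module ℂ Z] (φ : Yangian n →ₐ[ℂ] Module.End ℂ X)
    (ψ : Yangian n →ₐ[ℂ] Module.End ℂ Z) (s : ℕ) (i j : Fin n) :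
    tensorAction φ ψ (Yangian.T n (s + 1) i j)
      = (φ (Yangian.T n (s + 1) i j)).rTensor Z + (ψ (Yangian.T n (s + 1) i j)).lTensor X
        + ∑ k, convSum (fun x => (φ (Yangian.T n (x + 1) i k)).rTensor Z)
          (fun x => (ψ (Yangian.T n (x + 1) k j)).lTensor X) s := by
  have h0 : ∀ i j, Yangian.T n 0 i j = if i = j then 1 else 0 := (Yangian.isYangianFamily n).zero
  rw [← convFamily_succ (fun r i j => (φ (Yangian.T n r i j)).rTensor Z)
    (fun r i j => (ψ (Yangian.T n r i j)).lTensor X)]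
  · rw [tensorAction, AlgHom.comp_apply, Yangian.comul, Yangian.lift_T]
    simp only [map_sum, convFamily]
    refine Finset.sum_congr rfl fun k _ => Finset.sum_congr rfl fun x _ => ?_
    refine TensorProduct.ext' fun v w => ?_
    rfl
  · intro i j
    rw [h0]
    split_ifs
    · rw [map_one]; exact LinearMap.rTensor_id _ _
    · rw [map_zero, LinearMap.rTensor_zero]
  · intro i j
    rw [h0]
    split_ifs
    · rw [map_one]; exact LinearMap.lTensor_id _ _
    · rw [map_zero, LinearMap.lTensor_zero]

variable (σ : VarKind) (p m n : ℕ) (V : Type u) [AddCommGroup V] [Module ℂ V]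
  [LieRingModule (Gl m) V] [LieModule ℂ (Gl m) V]

theorem bigAction_tmul (x : UGl m) (y : Module.End ℂ (Fock σ m n)) :
    bigAction σ m n V (x ⊗ₜ y) = TensorProduct.map (envAction m V x) y := by
  refine TensorProduct.ext' fun v f => ?_
  rfl

theorem bigAction_alpha (s : ℕ) (i j : Fin n) :
    bigAction σ m n V (alpha σ p m n (Yangian.T n (s + 1) i j))
      = ∑ a, ∑ b, TensorProduct.map (envAction m V (coeffX σ m s a b))
        (qOp σ p a i * pOp σ p b j) := by
  rw [alpha, Yangian.lift_T]
  simp only [alphaCoeff, map_sum, bigAction_tmul]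

theorem bigAction_alpha_tau (z : ℂ) (s : ℕ) (i j : Fin n) :
    bigAction σ m n V (alpha σ p m n (Yangian.tau n (σ.sign * z) (Yangian.T n (s + 1) i j)))
      = ∑ a, ∑ b, TensorProduct.map (envAction m V (coeffXShift σ m z s a b))
        (qOp σ p a i * pOp σ p b j) := by
  rw [Yangian.tau, Yangian.lift_T]
  simp only [shiftFamily, map_sum, map_smul, bigAction_alpha, coeffXShift_eq_sum, Matrix.sum_apply,
    Matrix.smul_apply]
  simp only [← TensorProduct.mapBilinear_apply, map_sum, map_smul, LinearMap.sum_apply,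
    LinearMap.smul_apply, Finset.smul_sum]
  rw [Finset.sum_comm]
  refine Finset.sum_congr rfl fun a _ => Finset.sum_comm

end Generators

/-! ### The Yangian action on the coinvariants -/

section Intertwining

variable (σ : VarKind) (n k l p₀ : ℕ)
  (V : Type u) (U : Type v) [AddCommGroup V] [Module ℂ V]
  [LieRingModule (Gl k) V] [LieModule ℂ (Gl k) V] [AddCommGroup U] [Module ℂ U]
  [LieRingModule (Gl l) U] [LieModule ℂ (Gl l) U]

theorem envAction_parInd (x : UGl (k + l)) (w : ParInd k l V U) :
    envAction (k + l) (ParInd k l V U) x w = x • w := by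
  have h : envAction (k + l) (ParInd k l V U)
      = (Algebra.lsmul ℂ ℂ (ParInd k l V U) : UGl (k + l) →ₐ[ℂ] Module.End ℂ (ParInd k l V U)) := by
    refine UniversalEnvelopingAlgebra.hom_ext ℂ (LieHom.ext fun X => LinearMap.ext fun w => ?_)
    change UniversalEnvelopingAlgebra.lift ℂ (LieModule.toEnd ℂ (Gl (k + l)) (ParInd k l V U))
      (UniversalEnvelopingAlgebra.ι ℂ X) w = _
    rw [UniversalEnvelopingAlgebra.lift_ι_apply]
    rfl
  rw [h]
  rfl

theorem zeta_single (p m : ℕ) (a b : Fin m) :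
    zeta σ p m n (Matrix.single a b 1) = zetaGen σ p m n a b := by
  rw [zeta_apply, Finset.sum_eq_single a, Finset.sum_eq_single b]
  · simp
  · intro b' _ hb; simp [hb.symm]
  · simp
  · intro a' _ ha; simp [ha.symm]
  · simp

/-- The action of `T_ij^(s+1)` on the first factor of the tensor product of bimodules. -/
noncomputable def genLeft (i j : Fin n) (s : ℕ) :
    Module.End ℂ ((V ⊗[ℂ] U) ⊗[ℂ] Fock σ (k + l) n) :=
  ∑ a, ∑ c, TensorProduct.map (xLeft σ k V U a c s)
    (qOp σ p₀ (Fin.castAdd l a) i * pOp σ p₀ (Fin.castAdd l c) j)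

/-- The action of `T_ij^(s+1)` on the second factor of the tensor product of bimodules. -/
noncomputable def genRight (i j : Fin n) (s : ℕ) :
    Module.End ℂ ((V ⊗[ℂ] U) ⊗[ℂ] Fock σ (k + l) n) :=
  ∑ b, ∑ d, TensorProduct.map (xRight σ k l V U b d s)
    (qOp σ p₀ (Fin.natAdd k b) i * pOp σ p₀ (Fin.natAdd k d) j)

theorem convSum_sum_sum {A ι κ : Type*} [Ring A] [Fintype ι] [Fintype κ] (f : ι → ℕ → A)
    (g : κ → ℕ → A) (s : ℕ) :
    convSum (fun r => ∑ a, f a r) (fun r => ∑ b, g b r) s = ∑ a, ∑ b, convSum (f a) (g b) s := by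
  cases s with
  | zero => simp [convSum]
  | succ s =>
    simp only [convSum, Finset.sum_mul_sum]
    rw [Finset.sum_comm]
    exact Finset.sum_congr rfl fun a _ => Finset.sum_comm

theorem convSum_map {M N : Type*} [AddCommGroup M] [Module ℂ M] [AddCommGroup N] [Module ℂ N]
    (f g : ℕ → Module.End ℂ M) (x y : Module.End ℂ N) (s : ℕ) :
    convSum (A := Module.End ℂ (M ⊗[ℂ] N)) (fun r => TensorProduct.map (f r) x)
      (fun r => TensorProduct.map (g r) y) s = TensorProduct.map (convSum f g s) (x * y) := by
  cases s with
  | zero => simp [convSum]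
  | succ s =>
    simp only [convSum, ← TensorProduct.map_mul]
    simp only [← TensorProduct.mapBilinear_apply, map_sum, LinearMap.sum_apply]

theorem convSum_gen_tmul (i j : Fin n) (s : ℕ) (t : V ⊗[ℂ] U) (f : Fock σ (k + l) n) :
    (∑ e, convSum (genLeft σ n k l p₀ V U i e) (genRight σ n k l p₀ V U e j) s) (t ⊗ₜ f)
      = ∑ e, ∑ a, ∑ c, ∑ b, ∑ d, convSum (xLeft σ k V U a c) (xRight σ k l V U b d) s t
        ⊗ₜ (qOp σ p₀ (Fin.castAdd l a) i * pOp σ p₀ (Fin.castAdd l c) e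
          * (qOp σ p₀ (Fin.natAdd k b) e * pOp σ p₀ (Fin.natAdd k d) j) :
            Module.End ℂ (Fock σ (k + l) n)) f := by
  rw [LinearMap.sum_apply]
  refine Finset.sum_congr rfl fun e _ => ?_
  have h : convSum (genLeft σ n k l p₀ V U i e) (genRight σ n k l p₀ V U e j) s
      = ∑ a, ∑ b, ∑ c, ∑ d, TensorProduct.map
        (convSum (xLeft σ k V U a c) (xRight σ k l V U b d) s)
        (qOp σ p₀ (Fin.castAdd l a) i * pOp σ p₀ (Fin.castAdd l c) e
          * (qOp σ p₀ (Fin.natAdd k b) e * pOp σ p₀ (Fin.natAdd k d) j)) := by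
    refine (convSum_sum_sum _ _ s).trans
      (Finset.sum_congr rfl fun a _ => Finset.sum_congr rfl fun b _ => ?_)
    refine (convSum_sum_sum _ _ s).trans
      (Finset.sum_congr rfl fun c _ => Finset.sum_congr rfl fun d _ => ?_)
    exact convSum_map _ _ _ _ s
  rw [h]
  simp only [LinearMap.sum_apply, TensorProduct.map_tmul]
  exact Finset.sum_congr rfl fun a _ => Finset.sum_comm

/-- The commutation of `∑_e q_be p_ce` (`c ≤ k < b`) past `q_ai p_dj`. -/
theorem zetaGen_mul (i j : Fin n) (a c : Fin k) (b d : Fin l) :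
    zetaGen σ p₀ (k + l) n (Fin.natAdd k b) (Fin.castAdd l c)
        * (qOp σ p₀ (Fin.castAdd l a) i * pOp σ p₀ (Fin.natAdd k d) j)
      = σ.sign • ∑ e, qOp σ p₀ (Fin.castAdd l a) i * pOp σ p₀ (Fin.castAdd l c) e
          * (qOp σ p₀ (Fin.natAdd k b) e * pOp σ p₀ (Fin.natAdd k d) j)
        + if c = a then qOp σ p₀ (Fin.natAdd k b) i * pOp σ p₀ (Fin.natAdd k d) j else 0 := by
  have h := isOscillator σ p₀ (k + l) n
  rw [zetaGen, if_neg (castAdd_ne_natAdd c b).symm, zero_smul, zero_add, Finset.sum_mul,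
    Finset.sum_congr rfl fun e _ => h.rel2 σ.sign_mul_sign (Fin.natAdd k b) e (Fin.castAdd l c) e
      (Fin.castAdd l a) i (Fin.natAdd k d) j]
  simp only [(castAdd_ne_natAdd c b).symm, false_and, if_false, zero_mul, smul_zero, sub_zero,
    Finset.sum_add_distrib, ← Finset.smul_sum, (Fin.castAdd_injective k l).eq_iff]
  congr 1
  split_ifs with hc <;> simp [hc]

/-- The action of `T_ij^(s+1)` on the coinvariants, in terms of the two tensor factors. Moving `𝔮`
to the Fock space in the upper right block of `X(u)` gives the mixed term of the comultiplication,
and reordering the oscillators produces a trace term that cancels the one in the lower right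
block. -/
theorem coinvIncl_gen (i j : Fin n) (s : ℕ) (t : V ⊗[ℂ] U) (f : Fock σ (k + l) n) :
    toCoinv σ n k l p₀ V U (bigAction σ (k + l) n (ParInd k l V U)
        (alpha σ p₀ (k + l) n (Yangian.T n (s + 1) i j)) (parIncl k l V U t ⊗ₜ f))
      = coinvIncl σ n k l p₀ V U ((genLeft σ n k l p₀ V U i j s + genRight σ n k l p₀ V U i j s
        + ∑ e, convSum (genLeft σ n k l p₀ V U i e) (genRight σ n k l p₀ V U e j) s)
          (t ⊗ₜ f)) := by
  -- The contribution of the upper right block of `X(u)`.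
  have hlr : ∀ (a : Fin k) (d : Fin l), toCoinv σ n k l p₀ V U
      ((coeffX σ (k + l) s (Fin.castAdd l a) (Fin.natAdd k d) • parIncl k l V U t)
        ⊗ₜ (qOp σ p₀ (Fin.castAdd l a) i * pOp σ p₀ (Fin.natAdd k d) j) f)
      = ∑ b, ∑ c, ∑ e, coinvIncl σ n k l p₀ V U
          (convSum (xLeft σ k V U a c) (xRight σ k l V U b d) s t
            ⊗ₜ (qOp σ p₀ (Fin.castAdd l a) i * pOp σ p₀ (Fin.castAdd l c) e
              * (qOp σ p₀ (Fin.natAdd k b) e * pOp σ p₀ (Fin.natAdd k d) j) :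
                Module.End ℂ (Fock σ (k + l) n)) f)
        + σ.sign • ∑ b, coinvIncl σ n k l p₀ V U
          (convSum (xLeft σ k V U a a) (xRight σ k l V U b d) s t
            ⊗ₜ (qOp σ p₀ (Fin.natAdd k b) i * pOp σ p₀ (Fin.natAdd k d) j) f) := by
    intro a d
    have h1 : ∀ b c, toCoinv σ n k l p₀ V U ((genE (Fin.natAdd k b) (Fin.castAdd l c)
        • parIncl k l V U (convSum (xLeft σ k V U a c) (xRight σ k l V U b d) s t))
        ⊗ₜ (qOp σ p₀ (Fin.castAdd l a) i * pOp σ p₀ (Fin.natAdd k d) j) f)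
        = -(σ.sign • ∑ e, coinvIncl σ n k l p₀ V U
          (convSum (xLeft σ k V U a c) (xRight σ k l V U b d) s t
            ⊗ₜ (qOp σ p₀ (Fin.castAdd l a) i * pOp σ p₀ (Fin.castAdd l c) e
              * (qOp σ p₀ (Fin.natAdd k b) e * pOp σ p₀ (Fin.natAdd k d) j) :
                Module.End ℂ (Fock σ (k + l) n)) f)
          + if c = a then coinvIncl σ n k l p₀ V U
          (convSum (xLeft σ k V U a c) (xRight σ k l V U b d) s t
            ⊗ₜ (qOp σ p₀ (Fin.natAdd k b) i * pOp σ p₀ (Fin.natAdd k d) j) f) else 0) := by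
      intro b c
      refine (toCoinv_lie σ n k l p₀ V U (single_mem_nilQ k l b c) _ _).trans ?_
      rw [zeta_single, ← Module.End.mul_apply, zetaGen_mul, LinearMap.add_apply,
        LinearMap.smul_apply, LinearMap.sum_apply, TensorProduct.tmul_add, TensorProduct.tmul_smul,
        TensorProduct.tmul_sum, map_add, map_smul, map_sum]
      refine congrArg Neg.neg (congrArg₂ (· + ·) rfl ?_)
      split_ifs
      · rfl
      · rw [LinearMap.zero_apply, TensorProduct.tmul_zero, map_zero]
    have hs : ∀ x : Coinv σ n k l p₀ V U, (-σ.sign) • -(σ.sign • x) = x := by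
      intro x
      rw [neg_smul_neg, smul_smul, σ.sign_mul_sign, one_smul]
    rw [coeffX_left_right, ← TensorProduct.smul_tmul', map_smul]
    simp only [TensorProduct.sum_tmul, map_sum, h1]
    simp only [neg_add, Finset.sum_add_distrib, smul_add, Finset.sum_neg_distrib,
      Finset.sum_ite_eq', Finset.mem_univ, if_true, ← Finset.smul_sum, hs]
    rw [smul_neg, neg_smul, neg_neg]
  -- The contribution of the lower right block of `X(u)`.
  have hrr : ∀ (b d : Fin l), toCoinv σ n k l p₀ V U
      ((coeffX σ (k + l) s (Fin.natAdd k b) (Fin.natAdd k d) • parIncl k l V U t)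
        ⊗ₜ (qOp σ p₀ (Fin.natAdd k b) i * pOp σ p₀ (Fin.natAdd k d) j) f)
      = coinvIncl σ n k l p₀ V U (xRight σ k l V U b d s t
          ⊗ₜ (qOp σ p₀ (Fin.natAdd k b) i * pOp σ p₀ (Fin.natAdd k d) j) f)
        - σ.sign • ∑ a, coinvIncl σ n k l p₀ V U
          (convSum (xLeft σ k V U a a) (xRight σ k l V U b d) s t
            ⊗ₜ (qOp σ p₀ (Fin.natAdd k b) i * pOp σ p₀ (Fin.natAdd k d) j) f) := by
    intro b d
    rw [coeffX_right_right, TensorProduct.sub_tmul, map_sub, ← TensorProduct.smul_tmul', map_smul,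
      TensorProduct.sum_tmul, map_sum]
    rfl
  rw [bigAction_alpha, LinearMap.add_apply, LinearMap.add_apply, convSum_gen_tmul]
  simp only [genLeft, genRight, LinearMap.add_apply, LinearMap.sum_apply,
    TensorProduct.map_tmul, envAction_parInd,
    Fin.sum_univ_add, map_add, map_sum, coeffX_left_left, coeffX_right_left,
    TensorProduct.zero_tmul, map_zero, Finset.sum_const_zero, hlr, hrr,
    Finset.sum_add_distrib, Finset.sum_sub_distrib, ← Finset.smul_sum]
  have hsum : ∀ G : Fin n → Fin k → Fin k → Fin l → Fin l → Coinv σ n k l p₀ V U,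
      ∑ e, ∑ a, ∑ c, ∑ b, ∑ d, G e a c b d = ∑ a, ∑ d, ∑ b, ∑ c, ∑ e, G e a c b d := by
    intro G
    rw [Finset.sum_comm]
    refine Finset.sum_congr rfl fun a _ => ?_
    rw [Finset.sum_comm, Finset.sum_congr rfl fun c _ => Finset.sum_comm, Finset.sum_comm,
      Finset.sum_congr rfl fun b _ => Finset.sum_congr rfl fun c _ => Finset.sum_comm,
      Finset.sum_congr rfl fun b _ => Finset.sum_comm, Finset.sum_comm]
  have hcancel : ∑ b : Fin l, ∑ d : Fin l, ∑ a : Fin k, coinvIncl σ n k l p₀ V U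
          (convSum (xLeft σ k V U a a) (xRight σ k l V U b d) s t
            ⊗ₜ (qOp σ p₀ (Fin.natAdd k b) i * pOp σ p₀ (Fin.natAdd k d) j) f)
      = ∑ a : Fin k, ∑ d : Fin l, ∑ b : Fin l, coinvIncl σ n k l p₀ V U
          (convSum (xLeft σ k V U a a) (xRight σ k l V U b d) s t
            ⊗ₜ (qOp σ p₀ (Fin.natAdd k b) i * pOp σ p₀ (Fin.natAdd k d) j) f) := by
    rw [Finset.sum_congr rfl fun b _ => Finset.sum_comm, Finset.sum_comm,
      Finset.sum_congr rfl fun d _ => Finset.sum_comm, Finset.sum_comm]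
  rw [hsum, hcancel]
  have key : ∀ x y z w : Coinv σ n k l p₀ V U, x + 0 + (y + w + (z - w)) = x + z + y := by
    intro x y z w
    abel
  exact key _ _ _ _

end Intertwining

/-! ### The isomorphism of bimodules -/

section Isomorphism

theorem convSum_intertwine {M N : Type*} [AddCommGroup M] [Module ℂ M] [AddCommGroup N]
    [Module ℂ N] (C : M →ₗ[ℂ] N) {f g : ℕ → Module.End ℂ M} {f' g' : ℕ → Module.End ℂ N}
    (hf : ∀ r x, C (f r x) = f' r (C x)) (hg : ∀ r x, C (g r x) = g' r (C x)) (s : ℕ) (x : M) :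
    C (convSum f g s x) = convSum f' g' s (C x) := by
  cases s with
  | zero => simp [convSum]
  | succ s =>
    simp only [convSum, LinearMap.sum_apply, map_sum, Module.End.mul_apply, hf, hg]

theorem leviEmb_apply {k l : ℕ} (x : Gl k × Gl l) :
    (∀ a c, leviEmb k l x (Fin.castAdd l a) (Fin.castAdd l c) = x.1 a c) ∧
    (∀ a d, leviEmb k l x (Fin.castAdd l a) (Fin.natAdd k d) = 0) ∧
    (∀ b c, leviEmb k l x (Fin.natAdd k b) (Fin.castAdd l c) = 0) ∧
    ∀ b d, leviEmb k l x (Fin.natAdd k b) (Fin.natAdd k d) = x.2 b d := by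
  refine ⟨fun _ _ => ?_, fun _ _ => ?_, fun _ _ => ?_, fun _ _ => ?_⟩ <;> simp [leviEmb]

theorem parabolicProj_leviEmb {k l : ℕ} (x : Gl k × Gl l) :
    parabolicProj k l ⟨leviEmb k l x, fun _ _ => (leviEmb_apply x).2.2.1 _ _⟩ = x :=
  Prod.ext (Matrix.ext (leviEmb_apply x).1) (Matrix.ext (leviEmb_apply x).2.2.2)

variable {σ : VarKind} {n k l : ℕ} (V : Type u) (U : Type v) [AddCommGroup V] [Module ℂ V]
  [AddCommGroup U] [Module ℂ U]

/-- The isomorphism `(V ⊗ ℋ_k) ⊗ (U ⊗ ℋ_l) ≅ (V ⊗ U) ⊗ ℋ_{k+l}` induced by a splitting of the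
Fock space. -/
noncomputable def regroup (μ : Fock σ k n ⊗[ℂ] Fock σ l n ≃ₗ[ℂ] Fock σ (k + l) n) :
    (V ⊗[ℂ] Fock σ k n) ⊗[ℂ] (U ⊗[ℂ] Fock σ l n) ≃ₗ[ℂ] (V ⊗[ℂ] U) ⊗[ℂ] Fock σ (k + l) n :=
  (TensorProduct.tensorTensorTensorComm ℂ V (Fock σ k n) U (Fock σ l n)).trans
    (TensorProduct.congr (LinearEquiv.refl ℂ _) μ)

theorem regroup_tmul (μ : Fock σ k n ⊗[ℂ] Fock σ l n ≃ₗ[ℂ] Fock σ (k + l) n) (v : V)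
    (f : Fock σ k n) (w : U) (g : Fock σ l n) :
    regroup V U μ ((v ⊗ₜ f) ⊗ₜ (w ⊗ₜ g)) = (v ⊗ₜ w) ⊗ₜ μ (f ⊗ₜ g) := rfl

variable [LieRingModule (Gl k) V] [LieModule ℂ (Gl k) V] [LieRingModule (Gl l) U]
  [LieModule ℂ (Gl l) U] {μ : Fock σ k n ⊗[ℂ] Fock σ l n ≃ₗ[ℂ] Fock σ (k + l) n}
  {π : Module.End ℂ (Fock σ k n)} (h : IsFockSplitting σ μ π) {p₀ p₁ p₂ : ℕ}
  (h₁ : ∀ a : Fin k, a.val < p₀ ↔ a.val < p₁) (h₂ : ∀ b : Fin l, k + b.val < p₀ ↔ b.val < p₂)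

include h

omit [LieRingModule (Gl l) U] [LieModule ℂ (Gl l) U] in
include h₁ in
theorem IsFockSplitting.genLeft_regroup (i j : Fin n) (s : ℕ)
    (x : (V ⊗[ℂ] Fock σ k n) ⊗[ℂ] (U ⊗[ℂ] Fock σ l n)) :
    regroup V U μ ((bigAction σ k n V
        (alpha σ p₁ k n (Yangian.T n (s + 1) i j))).rTensor (U ⊗[ℂ] Fock σ l n) x)
      = genLeft σ n k l p₀ V U i j s (regroup V U μ x) := by
  refine LinearMap.congr_fun (f := (regroup V U μ).toLinearMap ∘ₗ (bigAction σ k n V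
        (alpha σ p₁ k n (Yangian.T n (s + 1) i j))).rTensor (U ⊗[ℂ] Fock σ l n))
    (g := genLeft σ n k l p₀ V U i j s ∘ₗ (regroup V U μ).toLinearMap)
    (TensorProduct.ext_fourfold' fun v f w g => ?_) x
  rw [LinearMap.comp_apply, LinearMap.comp_apply, LinearMap.rTensor_tmul, bigAction_alpha, genLeft]
  simp only [LinearEquiv.coe_coe, LinearMap.sum_apply, TensorProduct.map_tmul,
    TensorProduct.sum_tmul, map_sum, regroup_tmul, h.qp_left h₁, xLeft, actLeft_tmul]

omit [LieRingModule (Gl k) V] [LieModule ℂ (Gl k) V] in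
include h₂ in
theorem IsFockSplitting.genRight_regroup (i j : Fin n) (s : ℕ)
    (x : (V ⊗[ℂ] Fock σ k n) ⊗[ℂ] (U ⊗[ℂ] Fock σ l n)) :
    regroup V U μ ((bigAction σ l n U (alpha σ p₂ l n
        (Yangian.tau n (σ.sign * k) (Yangian.T n (s + 1) i j)))).lTensor (V ⊗[ℂ] Fock σ k n) x)
      = genRight σ n k l p₀ V U i j s (regroup V U μ x) := by
  refine LinearMap.congr_fun (f := (regroup V U μ).toLinearMap ∘ₗ (bigAction σ l n U
        (alpha σ p₂ l n (Yangian.tau n (σ.sign * k)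
          (Yangian.T n (s + 1) i j)))).lTensor (V ⊗[ℂ] Fock σ k n))
    (g := genRight σ n k l p₀ V U i j s ∘ₗ (regroup V U μ).toLinearMap)
    (TensorProduct.ext_fourfold' fun v f w g => ?_) x
  rw [LinearMap.comp_apply, LinearMap.comp_apply, LinearMap.lTensor_tmul, bigAction_alpha_tau,
    genRight]
  simp only [LinearEquiv.coe_coe, LinearMap.sum_apply, TensorProduct.map_tmul,
    TensorProduct.tmul_sum, map_sum, regroup_tmul, h.qp_right h₂, xRight, actRight_tmul]

include h₁ h₂

/-- The map from the tensor product of bimodules to the coinvariants commutes with the generators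
of the Yangian; `y` stands for the operator that `T_ij^(s+1)` induces on the coinvariants. -/
theorem IsFockSplitting.coinvIncl_yangian (s : ℕ) (i j : Fin n)
    (x : (V ⊗[ℂ] Fock σ k n) ⊗[ℂ] (U ⊗[ℂ] Fock σ l n)) {y : Coinv σ n k l p₀ V U →ₗ[ℂ]
      Coinv σ n k l p₀ V U}
    (hy : ∀ z, y (toCoinv σ n k l p₀ V U z) = toCoinv σ n k l p₀ V U
      (bigAction σ (k + l) n (ParInd k l V U)
        (alpha σ p₀ (k + l) n (Yangian.T n (s + 1) i j)) z)) :
    coinvIncl σ n k l p₀ V U (regroup V U μ (tensorAction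
        ((bigAction σ k n V).comp (alpha σ p₁ k n))
        (((bigAction σ l n U).comp (alpha σ p₂ l n)).comp (Yangian.tau n (σ.sign * k)))
        (Yangian.T n (s + 1) i j) x))
      = y (coinvIncl σ n k l p₀ V U (regroup V U μ x)) := by
  have hL := h.genLeft_regroup V U h₁
  have hR := h.genRight_regroup V U h₂
  have e : ∀ t, y (coinvIncl σ n k l p₀ V U t) = coinvIncl σ n k l p₀ V U
      ((genLeft σ n k l p₀ V U i j s + genRight σ n k l p₀ V U i j s
        + ∑ e, convSum (genLeft σ n k l p₀ V U i e) (genRight σ n k l p₀ V U e j) s) t) := by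
    intro t
    refine LinearMap.congr_fun (f := y ∘ₗ coinvIncl σ n k l p₀ V U)
      (g := coinvIncl σ n k l p₀ V U ∘ₗ (_ : Module.End ℂ _)) (TensorProduct.ext' fun t f => ?_) t
    rw [LinearMap.comp_apply, coinvIncl_tmul, hy, coinvIncl_gen]
    rfl
  rw [e, tensorAction_T]
  congr 1
  rw [LinearMap.add_apply, LinearMap.add_apply, LinearMap.add_apply, LinearMap.add_apply,
    LinearMap.sum_apply, LinearMap.sum_apply, map_add, map_add, map_sum]
  refine congrArg₂ (· + ·) (congrArg₂ (· + ·) (hL i j s x) (hR i j s x))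
    (Finset.sum_congr rfl fun e _ => ?_)
  exact convSum_intertwine (regroup V U μ).toLinearMap (hL i e) (hR e j) s x

theorem IsFockSplitting.zeta_leviEmb (x : Gl k × Gl l) (f : Fock σ k n) (g : Fock σ l n) :
    zeta σ p₀ (k + l) n (leviEmb k l x) (μ (f ⊗ₜ g))
      = μ (zeta σ p₁ k n x.1 f ⊗ₜ g) + μ (f ⊗ₜ zeta σ p₂ l n x.2 g) := by
  obtain ⟨e1, e2, e3, e4⟩ := leviEmb_apply x
  simp only [zeta_apply, Fin.sum_univ_add, e1, e2, e3, e4, zero_smul, Finset.sum_const_zero,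
    add_zero, zero_add, LinearMap.add_apply, LinearMap.sum_apply, LinearMap.smul_apply,
    h.zetaGen_left h₁, h.zetaGen_right h₂, TensorProduct.sum_tmul, TensorProduct.tmul_sum,
    TensorProduct.tmul_smul, ← TensorProduct.smul_tmul', map_sum, map_smul]

/-- The map from the tensor product of bimodules to the coinvariants commutes with `gl_k ⊕ gl_l`;
`y` stands for the operator that `x` induces on the coinvariants. -/
theorem IsFockSplitting.coinvIncl_lie (x : Gl k × Gl l)
    (z : (V ⊗[ℂ] Fock σ k n) ⊗[ℂ] (U ⊗[ℂ] Fock σ l n)) {y : Coinv σ n k l p₀ V U →ₗ[ℂ]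
      Coinv σ n k l p₀ V U}
    (hy : ∀ z, y (toCoinv σ n k l p₀ V U z) = toCoinv σ n k l p₀ V U
      (glAction σ p₀ (k + l) n (ParInd k l V U) (leviEmb k l x) z)) :
    coinvIncl σ n k l p₀ V U (regroup V U μ
        (((glAction σ p₁ k n V x.1).rTensor (U ⊗[ℂ] Fock σ l n)
          + (glAction σ p₂ l n U x.2).lTensor (V ⊗[ℂ] Fock σ k n)) z))
      = y (coinvIncl σ n k l p₀ V U (regroup V U μ z)) := by
  refine LinearMap.congr_fun
    (f := coinvIncl σ n k l p₀ V U ∘ₗ (regroup V U μ).toLinearMap ∘ₗ (_ : Module.End ℂ _))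
    (g := y ∘ₗ coinvIncl σ n k l p₀ V U ∘ₗ (regroup V U μ).toLinearMap)
    (TensorProduct.ext_fourfold' fun v f w g => ?_) z
  have e : leviAction k l V U x (v ⊗ₜ w) = ⁅x.1, v⁆ ⊗ₜ w + v ⊗ₜ ⁅x.2, w⁆ := rfl
  have e' := lie_parIncl k l V U ⟨leviEmb k l x, fun _ _ => (leviEmb_apply x).2.2.1 _ _⟩ (v ⊗ₜ w)
  rw [parabolicProj_leviEmb, e] at e'
  simp only [LinearMap.comp_apply, LinearEquiv.coe_coe, LinearMap.add_apply,
    LinearMap.rTensor_tmul, LinearMap.lTensor_tmul, glAction_tmul, TensorProduct.add_tmul,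
    TensorProduct.tmul_add, map_add, regroup_tmul, coinvIncl_tmul, hy, e',
    h.zeta_leviEmb h₁ h₂ x]
  abel

omit h in
/-- Both isomorphisms of the theorem are instances of this one. The number `p₀` of the `k + l`
indices at which the roles of variables and derivations are exchanged only enters through its
restrictions `p₁` and `p₂` to the two blocks of indices. -/
theorem nonempty_iso_coinvariants {q₀ q₁ q₂ : ℕ} (hm₀ : k + l = p₀ + q₀) (hm₁ : k = p₁ + q₁)
    (hm₂ : l = p₂ + q₂) :
    Nonempty (YBimodule.Iso ((Epq σ n p₀ q₀ hm₀ (ParInd k l V U)).coinvariants k l)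
      ((Epq σ n p₁ q₁ hm₁ V).tensor (EpqShift σ n p₂ q₂ hm₂ (k : ℂ) U))) := by
  obtain ⟨μ, π, h⟩ := exists_fockSplitting σ k l n
  let F : (V ⊗[ℂ] Fock σ k n) ⊗[ℂ] (U ⊗[ℂ] Fock σ l n) ≃ₗ[ℂ] Coinv σ n k l p₀ V U :=
    (regroup V U μ).trans (LinearEquiv.ofBijective (coinvIncl σ n k l p₀ V U)
      ⟨coinvIncl_injective σ n k l p₀ V U, coinvIncl_surjective σ n k l p₀ V U⟩)
  let W := (Epq σ n p₀ q₀ hm₀ (ParInd k l V U)).coinvariants k l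
  have hY : ∀ (y : Yangian n) x, F (tensorAction ((bigAction σ k n V).comp (alpha σ p₁ k n))
      (((bigAction σ l n U).comp (alpha σ p₂ l n)).comp (Yangian.tau n (σ.sign * k))) y x)
      = W.yangian y (F x) :=
    Yangian.intertwine _ W.yangian F.toLinearMap fun s i j x =>
      h.coinvIncl_yangian V U h₁ h₂ s i j x fun z => rfl
  have hL : ∀ (x : Gl k × Gl l) z, F (((glAction σ p₁ k n V x.1).rTensor (U ⊗[ℂ] Fock σ l n)
      + (glAction σ p₂ l n U x.2).lTensor (V ⊗[ℂ] Fock σ k n)) z) = W.lie x (F z) :=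
    fun x z => h.coinvIncl_lie V U h₁ h₂ x z fun z => rfl
  refine ⟨⟨F.symm, fun y w => ?_, fun x w => ?_⟩⟩
  · refine F.symm_apply_eq.2 (Eq.trans ?_ (hY y (F.symm w)).symm)
    exact congrArg (W.yangian y) (F.apply_symm_apply w).symm
  · refine F.symm_apply_eq.2 (Eq.trans ?_ (hL x (F.symm w)).symm)
    exact congrArg (W.lie x) (F.apply_symm_apply w).symm

end Isomorphism

end RatYangian

theorem theorem2p1 (σ : VarKind) (n p q r : ℕ) :
    (∀ (V : Type u) (U : Type v)
      [AddCommGroup V] [Module ℂ V] [LieRingModule (Gl (p + q)) V] [LieModule ℂ (Gl (p + q)) V]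
      [AddCommGroup U] [Module ℂ U] [LieRingModule (Gl r) U] [LieModule ℂ (Gl r) U],
      Nonempty (YBimodule.Iso
        ((Epq σ n p (q + r) (Nat.add_assoc p q r) (ParInd (p + q) r V U)).coinvariants (p + q) r)
        ((Epq σ n p q rfl V).tensor
          (EpqShift σ n 0 r (Nat.zero_add r).symm ((p + q : ℕ) : ℂ) U)))) ∧
    (∀ (V : Type u) (U : Type v)
      [AddCommGroup V] [Module ℂ V] [LieRingModule (Gl r) V] [LieModule ℂ (Gl r) V]
      [AddCommGroup U] [Module ℂ U] [LieRingModule (Gl (p + q)) U] [LieModule ℂ (Gl (p + q)) U],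
      Nonempty (YBimodule.Iso
        ((Epq σ n (p + r) q ((Nat.add_assoc r p q).symm.trans
            (congrArg (· + q) (Nat.add_comm r p))) (ParInd r (p + q) V U)).coinvariants r (p + q))
        ((Epq σ n r 0 (Nat.add_zero r).symm V).tensor
          (EpqShift σ n p q rfl (r : ℂ) U)))) := by
  refine ⟨fun V U _ _ _ _ _ _ _ _ => ?_, fun V U _ _ _ _ _ _ _ _ => ?_⟩
  · exact nonempty_iso_coinvariants (p₀ := p) (p₁ := p) (p₂ := 0) V U (fun a => Iff.rfl)
      (fun b => by omega) _ _ _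
  · exact nonempty_iso_coinvariants (p₀ := p + r) (p₁ := r) (p₂ := p) V U (fun a => by omega)
      (fun b => by omega) _ _ _
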